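/- **Setting.** $H,K,\Xi$ are real separable Hilbert spaces, $\overline H$ is a real separable Banach space, and $H\subseteq\overline H$ with continuous dense inclusion. Let $e^{tA}$ be a $C_0$-semigroup on $H$ that extends to a $C_0$-semigroup $\overline{e^{tA}}$ on $\overline H$. Let $G\in\mathcal L(\Xi,H)$ be such that $Q_t=\int_0^te^{sA}GG^*e^{sA^*}ds$ is trace class for $t>0$, and let $C\in\mathcal L(K,\overline H)$. Let $P\in\mathcal L(H)$ be such that for every $t>0$ the operator $Pe^{tA}$ extends to $\overline{Pe^{tA}}\in\mathcal L(\overline H,H)$. Assume that for every $T>0$ and $\bar x\in\overline H$ the map $t\mapsto\overline{Pe^{tA}}\bar x$ is in $L^2(0,T;H)$, and that for every $T>0$ there are $c_T>0$, $\eta\in[0,1/2)$ with $|\overline{Pe^{tA}}\bar x|\le c_Tt^{-\eta}|\bar x|$ for $t\in(0,T]$, $\bar x\in\overline H$. Let $\rho>0$ and assume $\|\overline{e^{tA}}\|\le Me^{\omega t}$, $t\ge0$, for some $M$ and some $\omega<\rho$. Let $L^2_\rho$ be the space of $f:(0,\infty)\to H$ with $\int_0^\infty e^{-2\rho t}|f(t)|^2dt<\infty$.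 Put $y_{\bar x}(t)=\overline{Pe^{tA}}\bar x$, $t>0$. Let $\mathcal C=\{y_{\bar x}:\bar x\in\overline H\}\subseteq C((0,\infty);H)$, with the topology of uniform convergence on compact sets, and $\Upsilon:\overline H\to L^2_\rho$, $\Upsilon\bar x=y_{\bar x}$; $\Upsilon^*$ in $\Upsilon Q_t\Upsilon^*$ is the adjoint of $\Upsilon|_H$. Elements of $\mathcal C$ are identified with their classes in $L^2_\rho$. Inverses of operators are pseudo-inverses (values in the orthogonal complement of the kernel). $W$ is a cylindrical Wiener process in $\Xi$, $W_A(t)=\int_0^te^{(t-s)A}G\,dW(s)$ and $X(t;\bar x)=\overline{e^{tA}}\bar x+W_A(t)$. A function $f:\overline H\to\mathbb R$ is *$C$-Fréchet differentiable* at $\bar x$, with derivative $\nabla^Cf(\bar x)\in K$, if $\frac1s(f(\bar x+sCk)-f(\bar x))\to\langle\nabla^Cf(\bar x),k\rangle$ as $s\to0$ for every $k\in K$, uniformly for $|k|\le1$. *Spaces* ($T>0$, $\gamma\in(0,1)$). * $\mathcal S^P_\infty(\overline H)$: functions $\phi(\bar x)=\hat\phi(y_{\bar x})$ with $\hat\phi:\mathcal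 C\to\mathbb R$ bounded and Borel. * $\mathcal S^P((0,T]\times\overline H;Z)$: functions $f(t,\bar x)=\hat f(t,y_{\bar x})$ with $\hat f:(0,T]\times\mathcal C\to Z$ bounded and Borel. * $\mathcal S^P_{prog}((0,T]\times\overline H;Z)$: functions with $f(t,\bar x)=\hat f(t,y_{\bar x})=\hat f(t,y_{\bar x}(\cdot\wedge t))$ for some bounded Borel $\hat f:(0,T]\times C((0,\infty);H)\to Z$. * $C^{0,1,C}_\gamma([0,T]\times\overline H)$: real functions $f$, defined on $H$ for $t=0$ and on $\overline H$ for $t\in(0,T]$, that are bounded and continuous on $[0,T]\times H$ and on $(0,T]\times\overline H$, $C$-Fréchet differentiable in $\bar x\in\overline H$ for each $t\in(0,T]$, with $t^\gamma\nabla^Cf$ bounded and continuous from $(0,T]\times\overline H$ to $K$. * $\mathcal S^{1,P}_\gamma$ (resp. $\mathcal S^{1,P}_{\gamma,prog}$): those $f\in C^{0,1,C}_\gamma([0,T]\times\overline H)$ for which $f$ and $t^\gamma\nabla^Cf$ belong to $\mathcal S^P$ (resp. $\mathcal S^P_{prog}$) on $(0,T]\times\overline H$ (with $Z=\mathbb R$,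 resp. $Z=K$). * $C^P_b(H)$: functions $\phi(x)=\bar\phi(Px)$ on $H$ with $\bar\phi:\operatorname{Im}P\to\mathbb R$ bounded and continuous. For $\phi\in\mathcal S^P_\infty(\overline H)$ let $R_t[\phi](\bar x)=\int_H\phi(z+\overline{e^{tA}}\bar x)\,\mathcal N(0,Q_t)(dz)$. **Proposition.** Assume that $\Upsilon\overline{e^{tA}}Ck\in\operatorname{Im}(\Upsilon Q_t\Upsilon^*)^{1/2}$ for all $t>0$, $k\in K$, and let $\hat\Lambda(t)=(\Upsilon Q_t\Upsilon^*)^{-1/2}\Upsilon\overline{e^{tA}}C\in\mathcal L(K,L^2_\rho)$. Let $\phi=\hat\phi\circ y_{(\cdot)}\in\mathcal S^P_\infty(\overline H)$. 1. For every $t>0$, $R_t[\phi]$ is $C$-Fréchet differentiable on $\overline H$ and, for $\bar x\in\overline H$, $k\in K$, $$\langle\nabla^CR_t[\phi](\bar x),k\rangle=\int_{L^2_\rho}\hat\phi\big(z_1+\Upsilon\overline{e^{tA}}\bar x\big)\big\langle\hat\Lambda(t)k,(\Upsilon Q_t\Upsilon^*)^{-1/2}z_1\big\rangle\,\mathcal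 N(0,\Upsilon Q_t\Upsilon^*)(dz_1)$$ $$=\mathbb E\Big[\hat\phi\big(\Upsilon X(t;\bar x)\big)\big\langle\hat\Lambda(t)k,(\Upsilon Q_t\Upsilon^*)^{-1/2}\Upsilon W_A(t)\big\rangle\Big].$$ Here $z_1\mapsto\langle h,(\Upsilon Q_t\Upsilon^*)^{-1/2}z_1\rangle$ denotes the limit in $L^2(\mathcal N(0,\Upsilon Q_t\Upsilon^*))$ of $z_1\mapsto\langle a_n,z_1\rangle$ for any sequence with $(\Upsilon Q_t\Upsilon^*)^{1/2}a_n\to h$; for $h=\hat\Lambda(t)k$ it exists. 2. $|\langle\nabla^CR_t[\phi](\bar x),k\rangle|\le\|\hat\Lambda(t)\|\,\|\phi\|_\infty\,|k|$ for $t>0$, $\bar x\in\overline H$, $k\in K$. 3. If $\hat\phi$ is continuous, then $(t,\bar x)\mapsto\nabla^CR_t[\phi](\bar x)$ is continuous from $(0,T]\times\overline H$ to $K$, for every $T>0$. 4. If $\hat\phi$ is continuous and, for some $\kappa_0>0$ and $\gamma\in(0,1)$, $\|\hat\Lambda(t)\|\le\kappa_0(t^{-\gamma}\vee1)$ for all $t>0$,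 then for every $T>0$ the map $(t,\bar x)\mapsto R_t[\phi](\bar x)$ belongs to $\mathcal S^{1,P}_\gamma$, hence to $C^{0,1,C}_\gamma([0,T]\times\overline H)$. 5. Suppose that $\operatorname{Im}\overline{Pe^{tA}}C\subseteq\operatorname{Im}(PQ_tP^*)^{1/2}$ for all $t>0$ and that, for some $T>0$, $\kappa_1>0$, $\gamma\in(0,1)$, $\|(PQ_tP^*)^{-1/2}\overline{Pe^{tA}}C\|\le\kappa_1(t^{-\gamma}\vee1)$ for $t\in(0,T]$. Suppose also that $\operatorname{Im}\overline{Pe^{tA}}\subseteq\operatorname{Im}P$ for all $t>0$ (automatic if $\operatorname{Im}P$ is closed). If $\phi=\bar\phi\circ P\in C^P_b(H)$, then $(t,\bar x)\mapsto R_t[\phi](\bar x)$, defined by $R_t[\phi](\bar x)=\int_H\bar\phi(Pz+\overline{Pe^{tA}}\bar x)\,\mathcal N(0,Q_t)(dz)$ for $t>0$ and $R_0[\phi]=\phi$ on $H$, belongs to $\mathcal S^{1,P}_{\gamma,prog}$. -/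

import Mathlib

open MeasureTheory Set Filter Topology
open scoped RealInnerProductSpace InnerProduct NNReal

noncomputable section

theorem aestronglyMeasurable_of_inner {α E : Type*} [MeasurableSpace α] {μ : Measure α}
    [NormedAddCommGroup E] [InnerProductSpace ℝ E] [CompleteSpace E]
    [TopologicalSpace.SeparableSpace E] {f : α → E}
    (hf : ∀ y : E, AEStronglyMeasurable (fun a => ⟪y, f a⟫) μ) : AEStronglyMeasurable f μ := by
  obtain ⟨w, b, hb⟩ := exists_hilbertBasis ℝ E
  have hw : w.Countable := by
    refine Set.PairwiseDisjoint.countable_of_isOpen (s := fun x : E => Metric.ball x (1 / 2)) ?_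
      (fun _ _ => Metric.isOpen_ball) (fun x _ => ⟨x, by simp⟩)
    intro x hx y hy hxy
    refine Metric.ball_disjoint_ball ?_
    have hx1 : ‖x‖ = 1 := by
      have := b.orthonormal.norm_eq_one ⟨x, hx⟩; simpa [hb] using this
    have hy1 : ‖y‖ = 1 := by
      have := b.orthonormal.norm_eq_one ⟨y, hy⟩; simpa [hb] using this
    have h0 : ⟪x, y⟫ = 0 := by
      have := b.orthonormal.inner_eq_zero (i := ⟨x, hx⟩) (j := ⟨y, hy⟩)
        (by simpa [Subtype.ext_iff] using hxy)
      simpa [hb] using this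
    have h2 : ‖x - y‖ ^ 2 = 2 := by
      rw [norm_sub_sq_real, hx1, hy1, h0]; norm_num
    rw [dist_eq_norm]
    nlinarith [norm_nonneg (x - y)]
  have : Countable w := hw.to_subtype
  refine aestronglyMeasurable_of_tendsto_ae (u := (atTop : Filter (Finset w)))
    (f := fun s a => ∑ i ∈ s, ⟪b i, f a⟫ • b i) (fun s => ?_) (ae_of_all _ fun a => ?_)
  · exact Finset.aestronglyMeasurable_fun_sum s fun i _ => (hf (b i)).smul_const (b i)
  · have := b.hasSum_repr (f a)
    simpa [HasSum, b.repr_apply_apply] using this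

/-- A `C₀`-semigroup of bounded operators on `E`; only the values at `t ≥ 0` matter. -/
structure C0Semigroup (E : Type*) [NormedAddCommGroup E] [NormedSpace ℝ E] where
  toFun : ℝ → E →L[ℝ] E
  map_zero : toFun 0 = ContinuousLinearMap.id ℝ E
  map_add : ∀ s t : ℝ, 0 ≤ s → 0 ≤ t → toFun (s + t) = (toFun s).comp (toFun t)
  continuousOn : ∀ x : E, ContinuousOn (fun t => toFun t x) (Ici 0)

instance {E : Type*} [NormedAddCommGroup E] [NormedSpace ℝ E] :
    CoeFun (C0Semigroup E) (fun _ => ℝ → E →L[ℝ] E) := ⟨C0Semigroup.toFun⟩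

theorem C0Semigroup.exists_bound {E : Type*} [NormedAddCommGroup E] [NormedSpace ℝ E]
    [CompleteSpace E] (S : C0Semigroup E) (t : ℝ) :
    ∃ M : ℝ, 0 ≤ M ∧ ∀ s ∈ Icc 0 t, ‖S s‖ ≤ M := by
  have := banach_steinhaus (g := fun s : Icc (0 : ℝ) t => S s) (fun x => by
    have hc : IsCompact ((fun s => S s x) '' Icc 0 t) :=
      isCompact_Icc.image_of_continuousOn ((S.continuousOn x).mono Icc_subset_Ici_self)
    obtain ⟨M, hM⟩ := hc.isBounded.exists_norm_le
    exact ⟨M, fun s => hM _ ⟨s, s.2, rfl⟩⟩)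
  obtain ⟨M, hM⟩ := this
  exact ⟨max M 0, le_max_right _ _, fun s hs => (hM ⟨s, hs⟩).trans (le_max_left _ _)⟩

section Gramian
variable {H Ξ : Type*} [NormedAddCommGroup H] [InnerProductSpace ℝ H] [CompleteSpace H]
  [TopologicalSpace.SeparableSpace H] [NormedAddCommGroup Ξ] [InnerProductSpace ℝ Ξ]
  [CompleteSpace Ξ] [TopologicalSpace.SeparableSpace Ξ]

/-- The operator `S(s) G G* S(s)*`. -/
def gramianIntegrand (S : C0Semigroup H) (G : Ξ →L[ℝ] H) (s : ℝ) : H →L[ℝ] H :=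
  (S s).comp (G.comp ((G†).comp ((S s)†)))

theorem norm_gramianIntegrand_le (S : C0Semigroup H) (G : Ξ →L[ℝ] H) {M s : ℝ} (hM : ‖S s‖ ≤ M)
    (x : H) : ‖gramianIntegrand S G s x‖ ≤ M * (‖G‖ * (‖G‖ * M)) * ‖x‖ := by
  have h0 : 0 ≤ M := (norm_nonneg _).trans hM
  refine (ContinuousLinearMap.le_opNorm _ x).trans ?_
  gcongr
  refine (ContinuousLinearMap.opNorm_comp_le _ _).trans ?_
  gcongr
  refine (ContinuousLinearMap.opNorm_comp_le _ _).trans ?_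
  gcongr
  refine (ContinuousLinearMap.opNorm_comp_le _ _).trans ?_
  rw [LinearIsometryEquiv.norm_map, LinearIsometryEquiv.norm_map]
  gcongr

theorem integrableOn_gramianIntegrand (S : C0Semigroup H) (G : Ξ →L[ℝ] H) (t : ℝ) (x : H) :
    IntegrableOn (fun s => gramianIntegrand S G s x) (Ioc 0 t) := by
  obtain ⟨M, hM0, hM⟩ := S.exists_bound t
  have hg : ∀ y : H, AEStronglyMeasurable (fun s => (G†) (((S s)†) y))
      (volume.restrict (Ioc 0 t)) := fun y => by
    refine aestronglyMeasurable_of_inner fun ξ => ?_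
    have : (fun s => ⟪ξ, (G†) (((S s)†) y)⟫) = fun s => ⟪S s (G ξ), y⟫ := by
      funext s
      rw [ContinuousLinearMap.adjoint_inner_right, ContinuousLinearMap.adjoint_inner_right]
    rw [this]
    have hc : ContinuousOn (fun s => ⟪S s (G ξ), y⟫) (Ioc 0 t) :=
      (((S.continuousOn (G ξ)).mono (Ioc_subset_Icc_self.trans Icc_subset_Ici_self)).inner
        continuousOn_const)
    exact hc.aestronglyMeasurable measurableSet_Ioc
  refine IntegrableOn.of_bound (C := M * (‖G‖ * (‖G‖ * M)) * ‖x‖) (by simp) ?_ ?_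
  · refine aestronglyMeasurable_of_inner fun y => ?_
    have : (fun s => ⟪y, gramianIntegrand S G s x⟫) =
        fun s => ⟪(G†) (((S s)†) y), (G†) (((S s)†) x)⟫ := by
      funext s
      exact ((ContinuousLinearMap.adjoint_inner_left G _ _).trans
        (ContinuousLinearMap.adjoint_inner_left (S s) _ _)).symm
    rw [this]
    exact (hg y).inner (𝕜 := ℝ) (hg x)
  · refine (ae_restrict_iff' measurableSet_Ioc).2 (ae_of_all _ fun s hs => ?_)
    exact norm_gramianIntegrand_le S G (hM s (Ioc_subset_Icc_self hs)) x

/-- The operator `x ↦ ∫₀ᵗ S(s) G G* S(s)* x ds`, for `t ≥ 0`. -/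
def gramian (S : C0Semigroup H) (G : Ξ →L[ℝ] H) (t : ℝ) : H →L[ℝ] H :=
  LinearMap.mkContinuousOfExistsBound
    { toFun := fun x => ∫ s in Ioc 0 t, gramianIntegrand S G s x
      map_add' := fun x y => by
        simp only [map_add]
        exact integral_add (integrableOn_gramianIntegrand S G t x)
          (integrableOn_gramianIntegrand S G t y)
      map_smul' := fun c x => by
        simp only [map_smul, RingHom.id_apply]
        exact integral_smul c _ }
    (by
      obtain ⟨M, hM0, hM⟩ := S.exists_bound t
      refine ⟨M * (‖G‖ * (‖G‖ * M)) * volume.real (Ioc 0 t), fun x => ?_⟩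
      refine (norm_setIntegral_le_of_norm_le_const (by simp) fun s hs =>
        norm_gramianIntegrand_le S G (hM s (Ioc_subset_Icc_self hs)) x).trans (le_of_eq ?_)
      ring)

end Gramian

section PseudoInverse
variable {E F K : Type*} [NormedAddCommGroup E] [InnerProductSpace ℝ E] [CompleteSpace E]
  [NormedAddCommGroup F] [InnerProductSpace ℝ F] [CompleteSpace F]
  [NormedAddCommGroup K] [InnerProductSpace ℝ K] [CompleteSpace K]

theorem exists_pinv (B : E →L[ℝ] F) {y : F} (hy : y ∈ range B) :
    ∃ x ∈ (B.ker)ᗮ, B x = y := by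
  obtain ⟨z, rfl⟩ := hy
  have : CompleteSpace (B.ker : Submodule ℝ E) := B.isClosed_ker.completeSpace_coe
  refine ⟨z - (B.ker).starProjection z, Submodule.sub_starProjection_mem_orthogonal z, ?_⟩
  have : B ((B.ker).starProjection z) = 0 :=
    LinearMap.mem_ker.1 (Submodule.starProjection_apply_mem (B.ker) z)
  simp [this]

/-- The pseudo-inverse `B⁻¹ : Im B → (ker B)ᗮ` (the value off `Im B` is irrelevant). -/
def pinv (B : E →L[ℝ] F) (y : F) : E :=
  open scoped Classical in if hy : y ∈ range B then (exists_pinv B hy).choose else 0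

theorem pinv_mem (B : E →L[ℝ] F) {y : F} (hy : y ∈ range B) : pinv B y ∈ (B.ker)ᗮ := by
  rw [pinv, dif_pos hy]; exact (exists_pinv B hy).choose_spec.1

theorem apply_pinv (B : E →L[ℝ] F) {y : F} (hy : y ∈ range B) : B (pinv B y) = y := by
  rw [pinv, dif_pos hy]; exact (exists_pinv B hy).choose_spec.2

theorem pinv_unique (B : E →L[ℝ] F) {x : E} (hx : x ∈ (B.ker)ᗮ) : pinv B (B x) = x := by
  have hy : B x ∈ range B := ⟨x, rfl⟩
  have h1 : pinv B (B x) - x ∈ B.ker := by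
    rw [LinearMap.mem_ker]; simp [apply_pinv B hy]
  have h2 : pinv B (B x) - x ∈ (B.ker)ᗮ := Submodule.sub_mem _ (pinv_mem B hy) hx
  have := Submodule.inner_right_of_mem_orthogonal h1 h2
  exact sub_eq_zero.1 (inner_self_eq_zero.1 this)

/-- `B⁻¹ T` as a linear map. -/
def pinvLin (B : E →L[ℝ] F) (T : K →L[ℝ] F) (h : ∀ k, T k ∈ range B) : K →ₗ[ℝ] E where
  toFun k := pinv B (T k)
  map_add' k l := by
    rw [← pinv_unique B (Submodule.add_mem _ (pinv_mem B (h k)) (pinv_mem B (h l)))]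
    simp [apply_pinv B (h k), apply_pinv B (h l)]
  map_smul' c k := by
    rw [RingHom.id_apply, ← pinv_unique B (Submodule.smul_mem _ c (pinv_mem B (h k)))]
    simp [apply_pinv B (h k)]

theorem isClosed_graph_pinvLin (B : E →L[ℝ] F) (T : K →L[ℝ] F) (h : ∀ k, T k ∈ range B) :
    IsClosed ((pinvLin B T h).graph : Set (K × E)) := by
  have : ((pinvLin B T h).graph : Set (K × E)) =
      {p : K × E | B p.2 = T p.1} ∩ {p : K × E | p.2 ∈ (B.ker)ᗮ} := by
    ext ⟨k, x⟩
    simp only [SetLike.mem_coe, LinearMap.mem_graph_iff, pinvLin, LinearMap.coe_mk,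
      AddHom.coe_mk, mem_inter_iff, mem_ofPred_eq]
    constructor
    · rintro rfl
      exact ⟨apply_pinv B (h k), pinv_mem B (h k)⟩
    · rintro ⟨h1, h2⟩
      rw [← h1, pinv_unique B h2]
  rw [this]
  refine IsClosed.inter (isClosed_eq (by fun_prop) (by fun_prop)) ?_
  exact (Submodule.isClosed_orthogonal _).preimage continuous_snd

/-- The bounded operator `B⁻¹ T`, with `B⁻¹` the pseudo-inverse, when `Im T ⊆ Im B`
(bounded by the closed graph theorem). -/
def pinvComp (B : E →L[ℝ] F) (T : K →L[ℝ] F) (h : ∀ k, T k ∈ range B) : K →L[ℝ] E :=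
  ContinuousLinearMap.ofIsClosedGraph (isClosed_graph_pinvLin B T h)

theorem pinvComp_apply (B : E →L[ℝ] F) (T : K →L[ℝ] F) (h : ∀ k, T k ∈ range B) (k : K) :
    pinvComp B T h k = pinv B (T k) := rfl

end PseudoInverse

/-! ### Positive square roots, traces, Gaussian measures -/

section Gaussian
variable {E : Type*} [NormedAddCommGroup E] [InnerProductSpace ℝ E] [CompleteSpace E]

/-- The positive square root `R^{1/2}` of a positive operator `R` (a positive operator on a real
Hilbert space has exactly one; the value for other operators is irrelevant). -/
def opSqrt (R : E →L[ℝ] E) : E →L[ℝ] E :=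
  open scoped Classical in
  if h : ∃ B : E →L[ℝ] E, B.IsPositive ∧ B.comp B = R then h.choose else 0

/-- A positive operator is trace class when its trace `∑ ⟨R eᵢ, eᵢ⟩` in an orthonormal basis
converges; this does not depend on the basis. -/
def IsTraceClassPos (R : E →L[ℝ] E) : Prop :=
  R.IsPositive ∧ ∃ (w : Set E) (b : HilbertBasis w ℝ E), Summable fun i => ⟪R (b i), b i⟫

variable [MeasurableSpace E]

/-- The centered Gaussian measure `𝒩(0, R)`: the (unique) probability measure with characteristic
function `h ↦ exp (-⟨R h, h⟩ / 2)`, which exists when `R` is positive and trace class. -/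
def centeredGaussian (R : E →L[ℝ] E) : Measure E :=
  open scoped Classical in
  if h : ∃ μ : Measure E, IsProbabilityMeasure μ ∧
      ∀ x : E, charFun μ x = Complex.exp (-((⟪R x, x⟫ / 2 : ℝ) : ℂ)) then h.choose else 0

/-- `ξ` is (a version of) the Gaussian random variable `z ↦ ⟨h, R^{-1/2} z⟩` on
`(E, 𝒩(0, R))`: the limit in `L²(𝒩(0, R))` of the linear functionals
`z ↦ ⟨a n, z⟩ = ⟨R^{1/2} (a n), R^{-1/2} z⟩` along a sequence with `R^{1/2} (a n) → h`. -/
def IsGaussianFunctional (R : E →L[ℝ] E) (h : E) (ξ : E → ℝ) : Prop :=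
  MemLp ξ 2 (centeredGaussian R) ∧ ∃ a : ℕ → E,
    Tendsto (fun n => opSqrt R (a n)) atTop (𝓝 h) ∧
    Tendsto (fun n => eLpNorm (fun z => ⟪a n, z⟫ - ξ z) 2 (centeredGaussian R)) atTop (𝓝 0)

end Gaussian

/-! ### Cylindrical Wiener processes and stochastic convolutions -/

section Wiener
variable {Ω H Ξ : Type*} [MeasurableSpace Ω] [NormedAddCommGroup H] [InnerProductSpace ℝ H]
  [CompleteSpace H] [MeasurableSpace H] [NormedAddCommGroup Ξ] [InnerProductSpace ℝ Ξ]
  [CompleteSpace Ξ]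

/-- `W` is a cylindrical Wiener process in `Ξ`; `W t ξ` stands for `⟨W(t), ξ⟩`. -/
structure IsCylindricalWiener (W : ℝ≥0 → Ξ → Ω → ℝ) (ℙ : Measure Ω) : Prop where
  gaussian : ProbabilityTheory.IsGaussianProcess (fun p : ℝ≥0 × Ξ => W p.1 p.2) ℙ
  mean : ∀ t ξ, ∫ ω, W t ξ ω ∂ℙ = 0
  cov : ∀ s t ξ η, ProbabilityTheory.covariance (W s ξ) (W t η) ℙ = min (s : ℝ) t * ⟪ξ, η⟫
  continuous : ∀ ξ, ∀ᵐ ω ∂ℙ, Continuous fun t => W t ξ ω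

/-- `Y` is (a version of) the stochastic convolution `W_A(t) = ∫₀ᵗ e^{(t-s)A} G dW(s)`: for every
`h`, `⟨h, Y⟩` is the Wiener integral over `[0, t]` of the continuous `Ξ`-valued function
`s ↦ G* (e^{(t-s)A})* h`, i.e. the `L²`-limit of its Riemann-Itô sums. -/
def IsStochasticConvolution (S : C0Semigroup H) (G : Ξ →L[ℝ] H) (W : ℝ≥0 → Ξ → Ω → ℝ)
    (ℙ : Measure Ω) (t : ℝ) (Y : Ω → H) : Prop :=
  AEMeasurable Y ℙ ∧ ∀ h : H, Tendsto (fun n : ℕ => eLpNorm (fun ω => ⟪h, Y ω⟫ -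
    ∑ i ∈ Finset.range n,
      (W (Real.toNNReal ((i + 1) * t / n)) ((G†) (((S (t - i * t / n))†) h)) ω
        - W (Real.toNNReal (i * t / n)) ((G†) (((S (t - i * t / n))†) h)) ω)) 2 ℙ) atTop (𝓝 0)

end Wiener

/-! ### `C`-derivatives -/

section CDeriv
variable {K E : Type*} [NormedAddCommGroup K] [InnerProductSpace ℝ K] [CompleteSpace K]
  [NormedAddCommGroup E] [NormedSpace ℝ E]

/-- `f` is `C`-Fréchet differentiable at `x` with `C`-derivative `L`: the difference quotients
`(f (x + s C k) - f x) / s` converge to `L k` as `s → 0`, uniformly for `k` in the unit ball. -/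
def HasCFDerivAt (C : K →L[ℝ] E) (f : E → ℝ) (L : K →L[ℝ] ℝ) (x : E) : Prop :=
  (∀ k, Tendsto (fun s : ℝ => (f (x + s • C k) - f x) / s) (𝓝[≠] 0) (𝓝 (L k))) ∧
  TendstoUniformlyOn (fun (s : ℝ) k => (f (x + s • C k) - f x) / s) L (𝓝[≠] 0)
    (Metric.closedBall 0 1)

/-- `f` is `C`-Fréchet differentiable at `x`. -/
def CFDifferentiableAt (C : K →L[ℝ] E) (f : E → ℝ) (x : E) : Prop :=
  ∃ L, HasCFDerivAt C f L x

/-- The `C`-derivative `∇^C f(x)`, as an element of `K` (and `0` if `f` is not `C`-Fréchet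
differentiable at `x`). -/
def cGrad (C : K →L[ℝ] E) (f : E → ℝ) (x : E) : K :=
  open scoped Classical in
  if h : CFDifferentiableAt C f x then (InnerProductSpace.toDual ℝ K).symm h.choose else 0

end CDeriv

/-! ### The weighted space `L²_ρ(0, ∞; H)` -/

/-- The measure `e^{-2ρt} dt` on `(0, ∞)`. -/
def weightMeasure (ρ : ℝ) : Measure ℝ :=
  (volume.restrict (Ioi 0)).withDensity fun t => ENNReal.ofReal (Real.exp (-2 * ρ * t))

/-- `L²_ρ(0, ∞; H)`. -/
abbrev L2w (H : Type*) [NormedAddCommGroup H] [InnerProductSpace ℝ H] (ρ : ℝ) : Type _ :=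
  Lp H 2 (weightMeasure ρ)

instance (H : Type*) [NormedAddCommGroup H] [InnerProductSpace ℝ H] (ρ : ℝ) :
    MeasurableSpace (L2w H ρ) := borel _

instance (H : Type*) [NormedAddCommGroup H] [InnerProductSpace ℝ H] (ρ : ℝ) :
    BorelSpace (L2w H ρ) := ⟨rfl⟩

theorem weightMeasure_ac (ρ : ℝ) : weightMeasure ρ ≪ volume.restrict (Ioi 0) :=
  withDensity_absolutelyContinuous _ _

theorem memLp_weight_of_sq {ρ : ℝ} {g : ℝ → ℝ} (hg : AEStronglyMeasurable g (volume.restrict (Ioi 0)))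
    (h : IntegrableOn (fun t => Real.exp (-2 * ρ * t) * g t ^ 2) (Ioi 0)) :
    MemLp g 2 (weightMeasure ρ) := by
  rw [memLp_two_iff_integrable_sq (hg.mono_ac (weightMeasure_ac ρ)), weightMeasure,
    integrable_withDensity_iff (by fun_prop) (by simp)]
  refine h.congr (ae_of_all _ fun t => ?_)
  simp [ENNReal.toReal_ofReal (Real.exp_pos _).le, mul_comm]

theorem memLp_weight_rpow (ρ η : ℝ) (h1 : η < 1 / 2) :
    MemLp ((Ioc (0 : ℝ) 1).indicator fun t => t ^ (-η)) 2 (weightMeasure ρ) := by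
  have hm : Measurable ((Ioc (0 : ℝ) 1).indicator fun t : ℝ => t ^ (-η)) :=
    Measurable.indicator (by fun_prop) measurableSet_Ioc
  refine memLp_weight_of_sq hm.aestronglyMeasurable ?_
  have h2 : IntegrableOn (fun t : ℝ => t ^ (-(2 * η))) (Ioc 0 1) := by
    have := (intervalIntegral.intervalIntegrable_rpow' (a := 0) (b := 1)
      (r := -(2 * η)) (by linarith))
    rwa [intervalIntegrable_iff_integrableOn_Ioc_of_le zero_le_one] at this
  have h3 : IntegrableOn ((Ioc (0 : ℝ) 1).indicator fun t : ℝ => t ^ (-(2 * η))) (Ioi 0) :=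
    (integrable_indicator_iff measurableSet_Ioc).2 h2 |>.integrableOn
  refine (h3.const_mul (Real.exp (2 * |ρ|))).mono' (by fun_prop) (ae_of_all _ fun t => ?_)
  by_cases ht : t ∈ Ioc (0 : ℝ) 1
  · simp only [indicator_of_mem ht]
    rw [Real.norm_of_nonneg (by positivity), ← Real.rpow_natCast, ← Real.rpow_mul ht.1.le]
    have e1 : -η * ((2 : ℕ) : ℝ) = -(2 * η) := by push_cast; ring
    rw [e1]
    have e2 : -2 * ρ * t ≤ 2 * |ρ| := by
      have h4 := neg_abs_le ρ
      have h5 := abs_nonneg ρ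
      nlinarith [ht.1, ht.2]
    have := Real.rpow_nonneg ht.1.le (-(2 * η))
    gcongr
  · simp [indicator_of_notMem ht]

theorem memLp_weight_exp (ρ ω : ℝ) (h : ω < ρ) :
    MemLp (fun t : ℝ => Real.exp (ω * t)) 2 (weightMeasure ρ) := by
  refine memLp_weight_of_sq (by fun_prop) ?_
  have := exp_neg_integrableOn_Ioi 0 (b := 2 * (ρ - ω)) (by linarith)
  refine this.congr (ae_of_all _ fun t => ?_)
  simp only [← Real.exp_nat_mul, ← Real.exp_add]
  congr 1; push_cast; ring

/-! ### The setting -/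

/-- The standing data and assumptions. `H`, `K`, `Ξ` are the state, control and noise spaces and
`Hb` is the enlarged Banach space `H̄`. -/
structure OUSetting (H K Ξ Hb : Type*)
    [NormedAddCommGroup H] [InnerProductSpace ℝ H] [CompleteSpace H]
    [TopologicalSpace.SeparableSpace H]
    [NormedAddCommGroup K] [InnerProductSpace ℝ K]
    [NormedAddCommGroup Ξ] [InnerProductSpace ℝ Ξ] [CompleteSpace Ξ]
    [TopologicalSpace.SeparableSpace Ξ]
    [NormedAddCommGroup Hb] [NormedSpace ℝ Hb] where
  /-- the semigroup `e^{tA}` on `H` -/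
  S : C0Semigroup H
  G : Ξ →L[ℝ] H
  /-- `Q_t` is trace class -/
  traceClass : ∀ t, 0 < t → IsTraceClassPos (gramian S G t)
  /-- the continuous dense inclusion of `H` into `H̄` -/
  ι : H →L[ℝ] Hb
  ι_injective : Function.Injective ι
  ι_dense : DenseRange ι
  /-- the extension of `e^{tA}` to a `C₀`-semigroup on `H̄` -/
  Sb : C0Semigroup Hb
  Sb_ι : ∀ t, 0 ≤ t → ∀ x, Sb t (ι x) = ι (S t x)
  /-- the control operator -/
  C : K →L[ℝ] Hb
  P : H →L[ℝ] H
  /-- `PS t`, for `t > 0`, is the continuous extension of `P e^{tA}` to `H̄` -/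
  PS : ℝ → Hb →L[ℝ] H
  PS_ι : ∀ t, 0 < t → ∀ x, PS t (ι x) = P (S t x)
  memLp_PS : ∀ T, 0 < T → ∀ x, MemLp (fun t => PS t x) 2 (volume.restrict (Ioc 0 T))
  PS_bound : ∀ T, 0 < T → ∃ c > 0, ∃ η : ℝ, 0 ≤ η ∧ η < 1 / 2 ∧
    ∀ t ∈ Ioc 0 T, ∀ x, ‖PS t x‖ ≤ c / t ^ η * ‖x‖
  /-- the weight -/
  ρ : ℝ
  ρ_pos : 0 < ρ
  /-- the extended semigroup has type smaller than `ρ` -/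
  type_lt : ∃ M ω : ℝ, ω < ρ ∧ ∀ t, 0 ≤ t → ‖Sb t‖ ≤ M * Real.exp (ω * t)

namespace OUSetting

variable {H K Ξ Hb : Type*}
    [NormedAddCommGroup H] [InnerProductSpace ℝ H] [CompleteSpace H]
    [TopologicalSpace.SeparableSpace H]
    [NormedAddCommGroup K] [InnerProductSpace ℝ K]
    [NormedAddCommGroup Ξ] [InnerProductSpace ℝ Ξ] [CompleteSpace Ξ]
    [TopologicalSpace.SeparableSpace Ξ]
    [NormedAddCommGroup Hb] [NormedSpace ℝ Hb]
    (D : OUSetting H K Ξ Hb)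

theorem PS_eq {s t : ℝ} (hs : 0 < s) (hst : s ≤ t) (x : Hb) :
    D.PS t x = D.PS s (D.Sb (t - s) x) := by
  refine D.ι_dense.induction_on (p := fun x => D.PS t x = D.PS s (D.Sb (t - s) x)) x
    (isClosed_eq (by fun_prop) (by fun_prop)) fun x => ?_
  rw [D.PS_ι t (hs.trans_le hst), D.Sb_ι _ (by linarith), D.PS_ι s hs]
  have h := D.S.map_add s (t - s) hs.le (by linarith)
  rw [add_sub_cancel] at h
  rw [h]
  rfl

theorem continuousOn_PS (x : Hb) : ContinuousOn (fun t => D.PS t x) (Ioi 0) := by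
  intro t ht
  have ht : 0 < t := ht
  refine ContinuousAt.continuousWithinAt ?_
  have h1 : ContinuousAt (fun r => D.Sb (r - t / 2) x) t := by
    refine ContinuousAt.comp (f := fun r : ℝ => r - t / 2) (g := fun r => D.Sb r x) ?_ (by fun_prop)
    exact (D.Sb.continuousOn x).continuousAt (Ici_mem_nhds (by linarith))
  refine ((D.PS (t / 2)).continuous.continuousAt.comp h1).congr ?_
  filter_upwards [Ioi_mem_nhds (show t / 2 < t by linarith)] with r hr
  exact (D.PS_eq (by linarith) (le_of_lt hr) x).symm

/-- The path `y_x : (0, ∞) → H`, `t ↦ (P e^{tA})‾ x`. -/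
def path (x : Hb) : C(Ioi (0 : ℝ), H) :=
  ⟨fun t => D.PS t x, continuousOn_iff_continuous_domRestrict.1 (D.continuousOn_PS x)⟩

/-- The space of paths `𝒞^P_A((0, ∞); H)`, with the topology of uniform convergence on compact
sets. -/
abbrev PathSpace : Type _ := Set.range D.path

/-- `x ↦ y_x` as a map onto the path space. -/
def toPath (x : Hb) : D.PathSpace := ⟨D.path x, x, rfl⟩

/-- The path `y(· ∧ t)`. -/
def stopPath (t : Ioi (0 : ℝ)) (y : C(Ioi (0 : ℝ), H)) : C(Ioi (0 : ℝ), H) :=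
  y.comp ⟨fun s => min s t, by fun_prop⟩

theorem exists_dom : ∃ g : ℝ → ℝ, MemLp g 2 (weightMeasure D.ρ) ∧
    ∀ t, 0 < t → ∀ x, ‖D.PS t x‖ ≤ ‖x‖ * ‖g t‖ := by
  obtain ⟨c, hc, η, -, h1, hb⟩ := D.PS_bound 1 one_pos
  obtain ⟨M, ω, hω, hM⟩ := D.type_lt
  have hM0 : 0 ≤ M := by
    have := (norm_nonneg _).trans (hM 0 le_rfl)
    simpa using this
  refine ⟨fun t => c * (Ioc (0 : ℝ) 1).indicator (fun t => t ^ (-η)) t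
    + (c * M * Real.exp (-ω)) * Real.exp (ω * t), ?_, fun t ht x => ?_⟩
  · exact ((memLp_weight_rpow D.ρ η h1).const_mul c).add
      ((memLp_weight_exp D.ρ ω hω).const_mul _)
  · have hnn : 0 ≤ c * (Ioc (0 : ℝ) 1).indicator (fun t => t ^ (-η)) t :=
      mul_nonneg hc.le (indicator_nonneg (fun s hs => Real.rpow_nonneg hs.1.le _) _)
    have hnn2 : 0 ≤ (c * M * Real.exp (-ω)) * Real.exp (ω * t) := by positivity
    rw [Real.norm_of_nonneg (add_nonneg hnn hnn2)]
    rcases le_or_gt t 1 with h | h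
    · refine (hb t ⟨ht, h⟩ x).trans ?_
      rw [mul_comm, div_eq_mul_inv, ← Real.rpow_neg ht.le]
      refine mul_le_mul_of_nonneg_left ?_ (norm_nonneg _)
      rw [indicator_of_mem (show t ∈ Ioc (0 : ℝ) 1 from ⟨ht, h⟩)]
      linarith
    · rw [D.PS_eq one_pos h.le]
      have e1 := hb 1 ⟨one_pos, le_rfl⟩ (D.Sb (t - 1) x)
      rw [Real.one_rpow, div_one] at e1
      have e2 : ‖D.Sb (t - 1) x‖ ≤ M * Real.exp (ω * (t - 1)) * ‖x‖ :=
        ((D.Sb (t - 1)).le_opNorm x).trans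
          (mul_le_mul_of_nonneg_right (hM _ (by linarith)) (norm_nonneg _))
      have e3 : Real.exp (ω * (t - 1)) = Real.exp (-ω) * Real.exp (ω * t) := by
        rw [← Real.exp_add]; congr 1; ring
      rw [e3] at e2
      calc _ ≤ c * (M * (Real.exp (-ω) * Real.exp (ω * t)) * ‖x‖) :=
            e1.trans (mul_le_mul_of_nonneg_left e2 hc.le)
        _ = ‖x‖ * ((c * M * Real.exp (-ω)) * Real.exp (ω * t)) := by ring
        _ ≤ _ := mul_le_mul_of_nonneg_left (by linarith) (norm_nonneg _)

theorem ae_weight_pos (ρ : ℝ) : ∀ᵐ t ∂weightMeasure ρ, 0 < t :=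
  (weightMeasure_ac ρ).ae_le (ae_restrict_mem measurableSet_Ioi)

theorem memLp_path (x : Hb) : MemLp (fun t => D.PS t x) 2 (weightMeasure D.ρ) := by
  obtain ⟨g, hg, hb⟩ := D.exists_dom
  refine hg.of_le_mul (c := ‖x‖) ?_ ?_
  · exact ((D.continuousOn_PS x).aestronglyMeasurable measurableSet_Ioi).mono_ac
      (weightMeasure_ac D.ρ)
  · filter_upwards [ae_weight_pos D.ρ] with t ht using hb t ht x

/-- The operator `Υ^P_∞ : H̄ → L²_ρ(0, ∞; H)`, `x ↦ y_x`. -/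
def upsilon : Hb →L[ℝ] L2w H D.ρ :=
  LinearMap.mkContinuousOfExistsBound
    { toFun := fun x => (D.memLp_path x).toLp
      map_add' := fun x y => by
        rw [← MemLp.toLp_add]; congr 1; funext t; simp
      map_smul' := fun c x => by
        rw [RingHom.id_apply, ← MemLp.toLp_const_smul]; congr 1; funext t; simp }
    (by
      obtain ⟨g, hg, hb⟩ := D.exists_dom
      refine ⟨‖hg.toLp‖, fun x => ?_⟩
      rw [mul_comm]
      refine Lp.norm_le_mul_norm_of_ae_le_mul ?_
      filter_upwards [ae_weight_pos D.ρ, (D.memLp_path x).coeFn_toLp, hg.coeFn_toLp]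
        with t ht h1 h2
      simp only [LinearMap.coe_mk, AddHom.coe_mk]
      rw [h1, h2]
      exact hb t ht x)

theorem memLp_pathSpace (y : D.PathSpace) :
    MemLp (fun t => if h : 0 < t then y.1 ⟨t, h⟩ else 0) 2 (weightMeasure D.ρ) := by
  obtain ⟨y, x, rfl⟩ := y
  refine (D.memLp_path x).ae_eq ?_
  filter_upwards [ae_weight_pos D.ρ] with t ht
  rw [dif_pos ht]
  rfl

/-- The inclusion of the path space into `L²_ρ(0, ∞; H)`: a continuous path on `(0, ∞)` is
identified with its class. -/
def pathToL2 (y : D.PathSpace) : L2w H D.ρ := (D.memLp_pathSpace y).toLp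

theorem pathToL2_toPath (x : Hb) : D.pathToL2 (D.toPath x) = D.upsilon x := by
  refine (MemLp.toLp_eq_toLp_iff (D.memLp_pathSpace _) (D.memLp_path x)).2 ?_
  filter_upwards [ae_weight_pos D.ρ] with t ht
  rw [dif_pos ht]
  rfl

theorem pathToL2_injective : Function.Injective D.pathToL2 := by
  rintro ⟨_, x, rfl⟩ ⟨_, z, rfl⟩ h
  have h' : D.upsilon x = D.upsilon z := by
    rw [← D.pathToL2_toPath, ← D.pathToL2_toPath]; exact h
  have h1 := (MemLp.toLp_eq_toLp_iff (D.memLp_path x) (D.memLp_path z)).1 h'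
  have h2 : volume.restrict (Ioi 0) ≪ weightMeasure D.ρ :=
    withDensity_absolutelyContinuous' (by fun_prop) (ae_of_all _ fun t => by
      simp [Real.exp_pos])
  have h3 := Measure.eqOn_open_of_ae_eq (h2.ae_le h1) isOpen_Ioi (D.continuousOn_PS x)
    (D.continuousOn_PS z)
  refine Subtype.ext (ContinuousMap.ext fun t => h3 t.2)

/-- A function of paths, seen as a function on `L²_ρ(0, ∞; H)` (with value `0` at those elements
that are not classes of paths). -/
def extendL2 (φhat : D.PathSpace → ℝ) : L2w H D.ρ → ℝ := Function.extend D.pathToL2 φhat 0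

/-! ### Function spaces -/

section Spaces
variable {Z : Type*} [NormedAddCommGroup Z] [NormedSpace ℝ Z]

/-- `φ ∈ 𝒮^P_∞(H̄)`, with representing bounded Borel function `φhat` on the path space. -/
def IsPathRep (φ : Hb → ℝ) (φhat : D.PathSpace → ℝ) : Prop :=
  Measurable[borel _, borel _] φhat ∧ (∃ M, ∀ y, |φhat y| ≤ M) ∧ ∀ x, φ x = φhat (D.toPath x)

/-- `f ∈ 𝒮^P_η((0, T] × H̄; Z)`. -/
def MemS (T η : ℝ) (f : ℝ → Hb → Z) : Prop :=
  ∃ fhat : Ioc 0 T × D.PathSpace → Z, Measurable[borel _, borel _] fhat ∧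
    (∃ M, ∀ p, ‖(p.1 : ℝ) ^ η • fhat p‖ ≤ M) ∧
    ∀ (t : Ioc 0 T) x, f t x = fhat (t, D.toPath x)

/-- `f ∈ 𝒮^P_{η,prog}((0, T] × H̄; Z)`. Stopped paths `y_x(· ∧ t)` are in general not of the form
`y_z`, so here the representing function lives on all continuous paths `(0, ∞) → H`. -/
def MemSProg (T η : ℝ) (f : ℝ → Hb → Z) : Prop :=
  ∃ fhat : Ioc 0 T × C(Ioi (0 : ℝ), H) → Z, Measurable[borel _, borel _] fhat ∧
    (∃ M, ∀ p, ‖(p.1 : ℝ) ^ η • fhat p‖ ≤ M) ∧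
    ∀ (t : Ioc 0 T) x, f t x = fhat (t, D.path x) ∧
      f t x = fhat (t, stopPath ⟨t, t.2.1⟩ (D.path x))

end Spaces

variable [CompleteSpace K]

/-- `f ∈ C^{0,1,C}_α([0, T] × H̄)`: at time `0`, `f` is only considered on `H`. -/
structure MemC01C (T α : ℝ) (f : ℝ → Hb → ℝ) : Prop where
  continuousOn_H : ContinuousOn (fun p : ℝ × H => f p.1 (D.ι p.2)) (Icc 0 T ×ˢ univ)
  bounded_H : ∃ M, ∀ t ∈ Icc 0 T, ∀ x : H, |f t (D.ι x)| ≤ M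
  continuousOn : ContinuousOn (fun p : ℝ × Hb => f p.1 p.2) (Ioc 0 T ×ˢ univ)
  bounded : ∃ M, ∀ t ∈ Ioc 0 T, ∀ x, |f t x| ≤ M
  differentiable : ∀ t ∈ Ioc 0 T, ∀ x, CFDifferentiableAt D.C (f t) x
  continuousOn_cGrad : ContinuousOn (fun p : ℝ × Hb => p.1 ^ α • cGrad D.C (f p.1) p.2)
    (Ioc 0 T ×ˢ univ)
  bounded_cGrad : ∃ M, ∀ t ∈ Ioc 0 T, ∀ x, ‖t ^ α • cGrad D.C (f t) x‖ ≤ M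

/-- `f ∈ 𝒮^{1,P}_η((0, T] × H̄)`. -/
structure MemS1 (T η : ℝ) (f : ℝ → Hb → ℝ) : Prop where
  memC01C : D.MemC01C T η f
  memS : D.MemS T 0 f
  memS_cGrad : D.MemS T 0 fun t x => t ^ η • cGrad D.C (f t) x

/-- `f ∈ 𝒮^{1,P}_{η,prog}((0, T] × H̄)`. -/
structure MemS1Prog (T η : ℝ) (f : ℝ → Hb → ℝ) : Prop where
  memC01C : D.MemC01C T η f
  memSProg : D.MemSProg T 0 f
  memSProg_cGrad : D.MemSProg T 0 fun t x => t ^ η • cGrad D.C (f t) x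

/-! ### Controllability hypotheses -/

/-- The covariance operator `Q_t = ∫₀ᵗ e^{sA} G G* e^{sA*} ds`. -/
def Q (t : ℝ) : H →L[ℝ] H := gramian D.S D.G t

/-- `Υ^P_∞ Q_t (Υ^P_∞)*` on `L²_ρ(0, ∞; H)`, with `Υ^P_∞` restricted to `H` in the adjoint. -/
def liftedCov (t : ℝ) : L2w H D.ρ →L[ℝ] L2w H D.ρ :=
  (D.upsilon.comp D.ι).comp ((D.Q t).comp ((D.upsilon.comp D.ι)†))

/-- `Υ^P_∞ e^{tA} C k ∈ Im (Υ^P_∞ Q_t (Υ^P_∞)*)^{1/2}` for all `t > 0` and `k`. -/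
def LiftedControllable : Prop :=
  ∀ t, 0 < t → ∀ k, D.upsilon (D.Sb t (D.C k)) ∈ range (opSqrt (D.liftedCov t))

/-- `Λ̂^{P,C}(t) = (Υ^P_∞ Q_t (Υ^P_∞)*)^{-1/2} Υ^P_∞ e^{tA} C`. -/
def liftedLambda (h : D.LiftedControllable) (t : ℝ) (ht : 0 < t) : K →L[ℝ] L2w H D.ρ :=
  pinvComp (opSqrt (D.liftedCov t)) (D.upsilon.comp ((D.Sb t).comp D.C)) (h t ht)

/-- `P Q_t P*`. -/
def projCov (t : ℝ) : H →L[ℝ] H := D.P.comp ((D.Q t).comp (D.P†))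

/-- `Im (P e^{tA})‾ C ⊆ Im (P Q_t P*)^{1/2}` for all `t > 0`. -/
def Controllable : Prop :=
  ∀ t, 0 < t → ∀ k, D.PS t (D.C k) ∈ range (opSqrt (D.projCov t))

/-- `Λ^{P,C}(t) = (P Q_t P*)^{-1/2} (P e^{tA})‾ C`. -/
def lambda (h : D.Controllable) (t : ℝ) (ht : 0 < t) : K →L[ℝ] H :=
  pinvComp (opSqrt (D.projCov t)) ((D.PS t).comp D.C) (h t ht)

/-! ### The Ornstein-Uhlenbeck semigroup -/

variable [MeasurableSpace H]

/-- `R_t[φ](x) = ∫_H φ(z + e^{tA} x) 𝒩(0, Q_t)(dz)` for `φ : H̄ → ℝ` and `x ∈ H̄`. -/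
def R (t : ℝ) (φ : Hb → ℝ) (x : Hb) : ℝ :=
  ∫ z, φ (D.ι z + D.Sb t x) ∂centeredGaussian (D.Q t)

/-- `R_t[φ](x)` for `φ = φbar ∘ P : H → ℝ`: for `t > 0` it is defined at every `x ∈ H̄` by
`∫_H φbar(P z + (P e^{tA})‾ x) 𝒩(0, Q_t)(dz)`, and for `t = 0` it is `φ`, defined on `H` only. -/
def RP (φbar : H → ℝ) (t : ℝ) (x : Hb) : ℝ :=
  open scoped Classical in
  if t = 0 then Function.extend D.ι (fun z => φbar (D.P z)) 0 x
  else ∫ z, φbar (D.P z + D.PS t x) ∂centeredGaussian (D.Q t)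

end OUSetting

end

/-!
The proof rests on three facts.

*Gaussian smoothing.* For a bounded Borel function `ψ` on a Hilbert space, the Cameron-Martin
formula (`IsGaussianFunctional.integral_translate`) says that translating `𝒩(0, R)` by `R^{1/2} h`
multiplies it by `exp (ξ - ‖h‖² / 2)`, where `ξ` is the Gaussian functional `⟨h, R^{-1/2} ·⟩`. The
first order expansion of this density in mean square makes the average of `ψ` differentiable along
the range of `R^{1/2}`, uniformly over bounded sets of `h`, with derivative the average of `ψ ξ`;
since `ξ` has variance `‖h‖²`, the derivative is at most `‖ψ‖_∞ ‖h‖` (`exists_hasCFDerivAt`). Now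
`R_t[φ](x)` is an average against `𝒩(0, Q_t)` of a function of the path of `z + e^{tA} x`, hence an
average of a Borel function on `L²_ρ` against the image measure `𝒩(0, Υ Q_t Υ*)`, and moving `x`
along `C k` translates this measure by `Υ e^{tA} C k = (Υ Q_t Υ*)^{1/2} Λ̂(t) k`. The same argument
with `P Q_t P*` gives the bound for functions of `P x`. The formula with an expectation follows
because `W_A(t)` has law `𝒩(0, Q_t)` (`IsStochasticConvolution.map_eq`).

*The semigroup property.* As `Q_{r+s} = Q_r + e^{rA} Q_s e^{rA*}`, the functions `f t = R_t[φ]`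
satisfy `f (r + s) = R_s[f r]`. Near a time `t₀` the gradient of `f t` is therefore an average of
the continuous function `f (t - t₀ / 2)` against Gaussian functionals that do not depend on `t`, and
continuity of the gradient follows by dominated convergence
(`OUSetting.continuousOn_cGrad_of_semigroup`). No continuity of `Λ̂` in `t` is needed. Continuity of
`f` itself, down to `t = 0` on `H`, comes from the weak continuity of `t ↦ 𝒩(0, Q_t)`
(`continuous_integral_gramian`).

*Borel factorization.* A Borel function on a Polish space which is constant on the fibres of a Borel
map factors through it in a Borel way, by the Lusin-Souslin theorem and the Doob-Dynkin lemma
(`exists_measurable_factor`). This turns "`f t x` only depends on the path of `x`", or on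
`P e^{tA} x`, into a Borel representing function on paths.

Square roots of positive operators and Gaussian measures with a given trace class covariance are
constructed from scratch: the former by the binomial series of `√(1 - x)`, the latter by a random
series.
-/

noncomputable section
set_option linter.unusedSectionVars false

/-! ### Square roots of positive operators -/

section OperatorSquareRoot

/-- The Catalan numbers scaled by `4⁻ⁿ`: the Taylor coefficients of `2 (1 - √(1 - x)) / x`. -/
def catalanWeight (n : ℕ) : ℝ := catalan n / 4 ^ n

theorem catalanWeight_nonneg (n : ℕ) : 0 ≤ catalanWeight n := by
  unfold catalanWeight; positivity

theorem catalanWeight_succ (n : ℕ) : catalanWeight (n + 1) =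
    1 / 4 * ∑ p ∈ Finset.HasAntidiagonal.antidiagonal n, catalanWeight p.1 * catalanWeight p.2 := by
  have h : ∀ p ∈ Finset.HasAntidiagonal.antidiagonal n, catalanWeight p.1 * catalanWeight p.2 =
      (catalan p.1 * catalan p.2 : ℝ) * (1 / 4 ^ n) := by
    intro p hp
    rw [← Finset.HasAntidiagonal.mem_antidiagonal.1 hp, pow_add]
    unfold catalanWeight
    field_simp
  rw [Finset.sum_congr rfl h, ← Finset.sum_mul, catalanWeight, catalan_succ', pow_succ]
  push_cast
  field_simp

/-- The recursion bounds the next partial sum by `1 + s² / 4`, which preserves `s ≤ 2`. -/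
theorem sum_catalanWeight_le (N : ℕ) : ∑ n ∈ Finset.range N, catalanWeight n ≤ 2 := by
  induction N with
  | zero => simp
  | succ N ih =>
    rw [Finset.sum_range_succ']
    have h0 : catalanWeight 0 = 1 := by simp [catalanWeight]
    have h1 : ∑ n ∈ Finset.range N, catalanWeight (n + 1) ≤
        1 / 4 * (∑ n ∈ Finset.range N, catalanWeight n) ^ 2 := by
      simp_rw [catalanWeight_succ]
      rw [← Finset.mul_sum]
      refine mul_le_mul_of_nonneg_left ?_ (by norm_num)
      simp_rw [Finset.Nat.sum_antidiagonal_eq_sum_range_succ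
        (fun i j => catalanWeight i * catalanWeight j)]
      rw [Finset.sum_range_diag_flip N (fun i j => catalanWeight i * catalanWeight j), sq,
        Finset.sum_mul_sum]
      refine Finset.sum_le_sum fun i _ => Finset.sum_le_sum_of_subset_of_nonneg
        (Finset.range_subset_range.2 (Nat.sub_le N i)) fun j _ _ =>
          mul_nonneg (catalanWeight_nonneg i) (catalanWeight_nonneg j)
    have h2 : 0 ≤ ∑ n ∈ Finset.range N, catalanWeight n :=
      Finset.sum_nonneg fun n _ => catalanWeight_nonneg n
    nlinarith

theorem summable_catalanWeight : Summable catalanWeight :=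
  summable_of_sum_range_le catalanWeight_nonneg sum_catalanWeight_le

theorem tsum_catalanWeight_le : ∑' n, catalanWeight n ≤ 2 :=
  Real.tsum_le_of_sum_range_le catalanWeight_nonneg sum_catalanWeight_le

variable {A : Type*} [NormedRing A] [NormedAlgebra ℝ A] [CompleteSpace A]

/-- The power series `∑ₙ Cₙ (x / 4)ⁿ` of the Catalan numbers `Cₙ`, for `‖x‖ ≤ 1`. -/
def catalanSeries (x : A) : A := ∑' n, catalanWeight n • x ^ n

variable [NormOneClass A]

theorem norm_catalanWeight_smul_pow_le {x : A} (hx : ‖x‖ ≤ 1) (n : ℕ) :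
    ‖catalanWeight n • x ^ n‖ ≤ catalanWeight n := by
  rw [norm_smul, Real.norm_of_nonneg (catalanWeight_nonneg n)]
  exact mul_le_of_le_one_right (catalanWeight_nonneg n)
    ((norm_pow_le x n).trans (pow_le_one₀ (norm_nonneg _) hx))

theorem summable_norm_catalanSeries {x : A} (hx : ‖x‖ ≤ 1) :
    Summable fun n => ‖catalanWeight n • x ^ n‖ :=
  Summable.of_nonneg_of_le (fun _ => norm_nonneg _) (norm_catalanWeight_smul_pow_le hx)
    summable_catalanWeight

theorem norm_catalanSeries_le {x : A} (hx : ‖x‖ ≤ 1) : ‖catalanSeries x‖ ≤ 2 :=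
  (tsum_of_norm_bounded summable_catalanWeight.hasSum
    (norm_catalanWeight_smul_pow_le hx)).trans tsum_catalanWeight_le

/-- The quadratic equation of the Catalan generating function. -/
theorem catalanSeries_eq {x : A} (hx : ‖x‖ ≤ 1) :
    catalanSeries x = 1 + (1 / 4 : ℝ) • (x * (catalanSeries x * catalanSeries x)) := by
  have hs := summable_norm_catalanSeries hx
  have h1 : catalanSeries x * catalanSeries x =
      ∑' n, ∑ p ∈ Finset.HasAntidiagonal.antidiagonal n,
        (catalanWeight p.1 • x ^ p.1) * (catalanWeight p.2 • x ^ p.2) :=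
    tsum_mul_tsum_eq_tsum_sum_antidiagonal_of_summable_norm hs hs
  have h2 : ∀ n, ∑ p ∈ Finset.HasAntidiagonal.antidiagonal n,
      (catalanWeight p.1 • x ^ p.1) * (catalanWeight p.2 • x ^ p.2) =
      (4 * catalanWeight (n + 1)) • x ^ n := by
    intro n
    rw [catalanWeight_succ, ← mul_assoc, show (4 : ℝ) * (1 / 4) = 1 by norm_num, one_mul,
      Finset.sum_smul]
    refine Finset.sum_congr rfl fun p hp => ?_
    rw [smul_mul_smul_comm, ← pow_add, Finset.HasAntidiagonal.mem_antidiagonal.1 hp]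
  have hs2 : Summable fun n => (4 * catalanWeight (n + 1)) • x ^ n := by
    have := summable_norm_sum_mul_antidiagonal_of_summable_norm hs hs
    simp_rw [h2] at this
    exact this.of_norm
  rw [h1]
  simp_rw [h2]
  rw [← hs2.tsum_mul_left, ← tsum_const_smul'']
  rw [catalanSeries, hs.of_norm.tsum_eq_zero_add]
  congr 1
  · simp [catalanWeight]
  · refine tsum_congr fun n => ?_
    rw [mul_smul_comm, smul_smul, ← pow_succ', ← mul_assoc]
    norm_num

theorem commute_catalanSeries {x : A} (hx : ‖x‖ ≤ 1) :
    x * catalanSeries x = catalanSeries x * x := by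
  rw [catalanSeries, ← (summable_norm_catalanSeries hx).of_norm.tsum_mul_left,
    ← (summable_norm_catalanSeries hx).of_norm.tsum_mul_right]
  refine tsum_congr fun n => ?_
  rw [mul_smul_comm, smul_mul_assoc, ← pow_succ', ← pow_succ]

/-- The square root `√(1 - x)` as a power series. -/
theorem sqrt_one_sub_mul_self {x : A} (hx : ‖x‖ ≤ 1) :
    (1 - (1 / 2 : ℝ) • (x * catalanSeries x)) * (1 - (1 / 2 : ℝ) • (x * catalanSeries x)) =
      1 - x := by
  set c := catalanSeries x with hc
  have h1 : c = 1 + (1 / 4 : ℝ) • (x * (c * c)) := catalanSeries_eq hx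
  have h2 : x * c = c * x := commute_catalanSeries hx
  have h3 : x * c * (x * c) = (4 : ℝ) • (x * (c - 1)) := by
    have h4 : c - 1 = (1 / 4 : ℝ) • (x * (c * c)) := by
      rw [sub_eq_iff_eq_add']; exact h1
    rw [h4, mul_smul_comm, smul_smul]
    norm_num
    rw [mul_assoc, ← mul_assoc c x c, ← h2, mul_assoc]
  rw [sub_mul, one_mul, mul_sub, mul_one, smul_mul_smul_comm, h3, smul_smul, mul_sub, mul_one]
  module

end OperatorSquareRoot

section PositiveSquareRoot
variable {E : Type*} [NormedAddCommGroup E] [InnerProductSpace ℝ E] [CompleteSpace E]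

theorem norm_le_one_of_isPositive {X : E →L[ℝ] E} (hX : X.IsPositive)
    (h : ∀ x, ⟪X x, x⟫ ≤ ‖x‖ ^ 2) : ‖X‖ ≤ 1 := by
  refine ContinuousLinearMap.opNorm_le_bound _ zero_le_one fun x => ?_
  have h1 := hX.inner_nonneg_left (x - X x)
  have h2 : ⟪X (X x), x⟫ = ‖X x‖ ^ 2 := by
    rw [← real_inner_self_eq_norm_sq]; exact hX.inner_left_eq_inner_right _ _
  have h3 := h (X x)
  have h4 := h x
  rw [map_sub, inner_sub_left, inner_sub_right, inner_sub_right, h2,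
    real_inner_self_eq_norm_sq] at h1
  rw [one_mul]
  exact abs_le_of_sq_le_sq' (by linarith) (norm_nonneg _) |>.2

/-- A contraction which is positive has a positive operator as square root of its complement. -/
theorem isPositive_sqrt_one_sub {X : E →L[ℝ] E} (hX : X.IsPositive) (h : ‖X‖ ≤ 1) :
    ∃ B : E →L[ℝ] E, B.IsPositive ∧ B.comp B = 1 - X := by
  rcases subsingleton_or_nontrivial E with hE | hE
  · exact ⟨0, ContinuousLinearMap.isPositive_zero,
      ContinuousLinearMap.ext fun x => Subsingleton.elim _ _⟩
  refine ⟨1 - (1 / 2 : ℝ) • (X * catalanSeries X), ?_, sqrt_one_sub_mul_self h⟩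
  have hsa : IsSelfAdjoint X := hX.isSelfAdjoint
  have hc : IsSelfAdjoint (catalanSeries X) := by
    rw [IsSelfAdjoint, catalanSeries, tsum_star]
    refine tsum_congr fun n => ?_
    rw [star_smul, star_pow, hsa.star_eq, star_trivial]
  have hxc : IsSelfAdjoint (X * catalanSeries X) := by
    rw [IsSelfAdjoint, star_mul, hsa.star_eq, hc.star_eq, commute_catalanSeries h]
  refine (ContinuousLinearMap.isPositive_iff' _).2 ⟨?_, fun x => ?_⟩
  · rw [IsSelfAdjoint, star_sub, star_one, star_smul, star_trivial, hxc.star_eq]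
  · have h1 : ‖(1 / 2 : ℝ) • (X * catalanSeries X)‖ ≤ 1 := by
      rw [norm_smul, Real.norm_of_nonneg (by norm_num)]
      have h2 := norm_mul_le X (catalanSeries X)
      have h3 := norm_catalanSeries_le h
      have h4 : ‖X‖ * ‖catalanSeries X‖ ≤ 1 * 2 :=
        mul_le_mul h h3 (norm_nonneg _) zero_le_one
      linarith
    have h2 := real_inner_le_norm (((1 / 2 : ℝ) • (X * catalanSeries X)) x) x
    have h3 := ((1 / 2 : ℝ) • (X * catalanSeries X)).le_of_opNorm_le h1 x
    have h4 := mul_le_mul_of_nonneg_right h3 (norm_nonneg x)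
    have h5 : ⟪(1 - (1 / 2 : ℝ) • (X * catalanSeries X) : E →L[ℝ] E) x, x⟫ =
        ‖x‖ ^ 2 - ⟪((1 / 2 : ℝ) • (X * catalanSeries X)) x, x⟫ := by
      rw [← real_inner_self_eq_norm_sq, ← inner_sub_left]
      rfl
    rw [h5]
    nlinarith

/-- Positive operators have positive square roots: after normalization, `R = 1 - (1 - R)` with a
positive contraction `1 - R`. -/
theorem exists_isPositive_comp_self_eq {R : E →L[ℝ] E} (hR : R.IsPositive) :
    ∃ B : E →L[ℝ] E, B.IsPositive ∧ B.comp B = R := by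
  rcases eq_or_ne R 0 with rfl | h0
  · exact ⟨0, ContinuousLinearMap.isPositive_zero, by simp⟩
  have hr : 0 < ‖R‖ := norm_pos_iff.2 h0
  have hle : ∀ x, ⟪R x, x⟫ ≤ ‖R‖ * ‖x‖ ^ 2 := fun x => by
    have := (real_inner_le_norm (R x) x).trans
      (mul_le_mul_of_nonneg_right (R.le_opNorm x) (norm_nonneg x))
    linarith
  have hin : ∀ x, ⟪(1 - ‖R‖⁻¹ • R : E →L[ℝ] E) x, x⟫ = ‖x‖ ^ 2 - ‖R‖⁻¹ * ⟪R x, x⟫ := fun x => by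
    rw [← real_inner_self_eq_norm_sq, ← real_inner_smul_left, ← inner_sub_left]
    rfl
  have hX : (1 - ‖R‖⁻¹ • R : E →L[ℝ] E).IsPositive := by
    refine (ContinuousLinearMap.isPositive_iff' _).2 ⟨?_, fun x => ?_⟩
    · rw [IsSelfAdjoint, star_sub, star_one, star_smul, star_trivial, hR.isSelfAdjoint.star_eq]
    · rw [hin, sub_nonneg, inv_mul_le_iff₀ hr]
      exact hle x
  obtain ⟨B, hB, hBB⟩ := isPositive_sqrt_one_sub hX (norm_le_one_of_isPositive hX fun x => by
    have := mul_nonneg (inv_nonneg.2 hr.le) (hR.inner_nonneg_left x)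
    rw [hin]
    linarith)
  refine ⟨√‖R‖ • B, hB.smul_of_nonneg (Real.sqrt_nonneg _), ?_⟩
  rw [ContinuousLinearMap.smul_comp, ContinuousLinearMap.comp_smul, hBB, smul_smul,
    Real.mul_self_sqrt hr.le, sub_sub_cancel, smul_smul, mul_inv_cancel₀ hr.ne', one_smul]

theorem isPositive_opSqrt {R : E →L[ℝ] E} (hR : R.IsPositive) : (opSqrt R).IsPositive := by
  rw [opSqrt, dif_pos (exists_isPositive_comp_self_eq hR)]
  exact (exists_isPositive_comp_self_eq hR).choose_spec.1

theorem opSqrt_opSqrt_apply {R : E →L[ℝ] E} (hR : R.IsPositive) (x : E) :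
    opSqrt R (opSqrt R x) = R x := by
  have h := (exists_isPositive_comp_self_eq hR).choose_spec.2
  conv_rhs => rw [← h]
  rw [opSqrt, dif_pos (exists_isPositive_comp_self_eq hR)]
  rfl

theorem inner_opSqrt_opSqrt {R : E →L[ℝ] E} (hR : R.IsPositive) (x y : E) :
    ⟪opSqrt R x, opSqrt R y⟫ = ⟪R x, y⟫ := by
  rw [← opSqrt_opSqrt_apply hR x]
  exact ((isPositive_opSqrt hR).inner_left_eq_inner_right _ _).symm

theorem norm_opSqrt_sq {R : E →L[ℝ] E} (hR : R.IsPositive) (x : E) :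
    ‖opSqrt R x‖ ^ 2 = ⟪R x, x⟫ := by
  rw [← real_inner_self_eq_norm_sq, inner_opSqrt_opSqrt hR]

/-- The values of the pseudo-inverse of `R^{1/2}` are limits of elements `R^{1/2} a`. -/
theorem mem_closure_range_opSqrt {R : E →L[ℝ] E} (hR : R.IsPositive) {h : E}
    (hh : h ∈ ((opSqrt R).ker)ᗮ) : h ∈ closure (range (opSqrt R)) := by
  have h1 : ((opSqrt R).range)ᗮ = ((opSqrt R)†).ker := ContinuousLinearMap.orthogonal_range _
  rw [(isPositive_opSqrt hR).isSelfAdjoint.adjoint_eq] at h1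
  rw [← h1, Submodule.orthogonal_orthogonal_eq_closure] at hh
  exact hh

end PositiveSquareRoot

/-! ### Centered Gaussian measures on Hilbert spaces -/

theorem enorm_exp_mul_I_sub_le (a b : ℝ) :
    ‖Complex.exp (a * Complex.I) - Complex.exp (b * Complex.I)‖ₑ ≤ ‖a - b‖ₑ := by
  have h : Complex.exp (a * Complex.I) - Complex.exp (b * Complex.I) =
      Complex.exp (Complex.I * b) * (Complex.exp (Complex.I * (a - b : ℝ)) - 1) := by
    rw [mul_sub, ← Complex.exp_add, mul_one]
    push_cast
    ring_nf
  rw [h, enorm_mul, Complex.enorm_exp_I_mul_ofReal, one_mul]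
  exact Real.enorm_exp_I_mul_ofReal_sub_one_le

/-- Characteristic functions converge along an `L²`-convergent family of random variables. -/
theorem tendsto_integral_exp_mul_I {Ω ι : Type*} [MeasurableSpace Ω] {P : Measure Ω}
    [IsProbabilityMeasure P] {l : Filter ι} {X : ι → Ω → ℝ} {Y : Ω → ℝ}
    (hX : ∀ i, AEStronglyMeasurable (X i) P) (hY : AEStronglyMeasurable Y P)
    (h : Tendsto (fun i => eLpNorm (fun ω => X i ω - Y ω) 2 P) l (𝓝 0)) :
    Tendsto (fun i => ∫ ω, Complex.exp (X i ω * Complex.I) ∂P) l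
      (𝓝 (∫ ω, Complex.exp (Y ω * Complex.I) ∂P)) := by
  have hm : ∀ {Z : Ω → ℝ}, AEStronglyMeasurable Z P →
      AEStronglyMeasurable (fun ω => Complex.exp (Z ω * Complex.I)) P := fun hZ =>
    (by fun_prop : Continuous fun x : ℝ => Complex.exp (x * Complex.I)).comp_aestronglyMeasurable hZ
  refine tendsto_integral_of_L1 _ (hm hY) (Eventually.of_forall fun i => ?_) ?_
  · exact Integrable.of_bound (hm (hX i)) 1 (ae_of_all _ fun ω => by
      rw [Complex.norm_exp_ofReal_mul_I])
  · refine tendsto_of_tendsto_of_tendsto_of_le_of_le tendsto_const_nhds h (fun _ => zero_le)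
      fun i => ?_
    refine (lintegral_mono fun ω => enorm_exp_mul_I_sub_le (X i ω) (Y ω)).trans ?_
    rw [← eLpNorm_one_eq_lintegral_enorm]
    exact eLpNorm_le_eLpNorm_of_exponent_le (by norm_num) ((hX i).sub hY)

/-- A real random variable with Gaussian characteristic function is Gaussian. -/
theorem map_eq_gaussianReal_of_integral_exp {Ω : Type*} [MeasurableSpace Ω] {P : Measure Ω}
    [IsProbabilityMeasure P] {X : Ω → ℝ} (hX : AEMeasurable X P) {v : ℝ≥0}
    (h : ∀ r : ℝ, ∫ ω, Complex.exp ((r * X ω : ℝ) * Complex.I) ∂P =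
      Complex.exp (-((v * r ^ 2 / 2 : ℝ) : ℂ))) :
    P.map X = ProbabilityTheory.gaussianReal 0 v := by
  have := Measure.isProbabilityMeasure_map (μ := P) hX
  refine Measure.ext_of_charFun (funext fun r => ?_)
  rw [ProbabilityTheory.charFun_gaussianReal, charFun_apply_real, integral_map hX (by fun_prop)]
  convert h r using 2
  · push_cast; rfl
  · push_cast; ring_nf

section CenteredGaussian
variable {E : Type*} [NormedAddCommGroup E] [InnerProductSpace ℝ E] [MeasurableSpace E]

/-- `μ` is a centered Gaussian probability measure with covariance operator `R`, expressed by its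
characteristic function. -/
structure IsCenteredGaussian (μ : Measure E) (R : E →L[ℝ] E) : Prop where
  isProbabilityMeasure : IsProbabilityMeasure μ
  charFun_eq : ∀ x, charFun μ x = Complex.exp (-((⟪R x, x⟫ / 2 : ℝ) : ℂ))

namespace IsCenteredGaussian
variable {μ ν : Measure E} {R R' : E →L[ℝ] E}

theorem inner_nonneg (h : IsCenteredGaussian μ R) (x : E) : 0 ≤ ⟪R x, x⟫ := by
  have := h.isProbabilityMeasure
  have h1 := norm_charFun_le_one (μ := μ) x
  rw [h.charFun_eq, ← Complex.ofReal_neg, Complex.norm_exp_ofReal, Real.exp_le_one_iff] at h1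
  linarith

theorem congr (h : IsCenteredGaussian μ R) (hR : ∀ x, ⟪R x, x⟫ = ⟪R' x, x⟫) :
    IsCenteredGaussian μ R' :=
  ⟨h.isProbabilityMeasure, fun x => by rw [h.charFun_eq, hR]⟩

variable [BorelSpace E] [TopologicalSpace.SeparableSpace E]

theorem conv (h : IsCenteredGaussian μ R) (h' : IsCenteredGaussian ν R') :
    IsCenteredGaussian (μ.conv ν) (R + R') := by
  have := h.isProbabilityMeasure
  have := h'.isProbabilityMeasure
  have : SecondCountableTopology E := UniformSpace.secondCountable_of_separable E
  refine ⟨inferInstance, fun x => ?_⟩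
  rw [charFun_conv, h.charFun_eq, h'.charFun_eq, ← Complex.exp_add,
    _root_.add_apply, inner_add_left]
  congr 1; push_cast; ring

theorem map_inner (h : IsCenteredGaussian μ R) (a : E) :
    μ.map (fun z => ⟪a, z⟫) = ProbabilityTheory.gaussianReal 0 (⟪R a, a⟫).toNNReal := by
  have := h.isProbabilityMeasure
  have : SecondCountableTopology E := UniformSpace.secondCountable_of_separable E
  refine map_eq_gaussianReal_of_integral_exp (by fun_prop) fun r => ?_
  have h1 := h.charFun_eq (r • a)
  rw [charFun_apply] at h1
  convert h1 using 1
  · refine integral_congr_ae (ae_of_all _ fun z => ?_)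
    simp only [real_inner_smul_right, real_inner_comm z a]
  · rw [map_smul, real_inner_smul_left, real_inner_smul_right, Real.coe_toNNReal _ (h.inner_nonneg a)]
    ring_nf

theorem memLp_inner (h : IsCenteredGaussian μ R) (a : E) : MemLp (fun z => ⟪a, z⟫) 2 μ := by
  have : SecondCountableTopology E := UniformSpace.secondCountable_of_separable E
  have h1 : MemLp id 2 (μ.map (fun z => ⟪a, z⟫)) := by
    rw [h.map_inner a]
    exact ProbabilityTheory.memLp_id_gaussianReal' 2 (by norm_num)
  exact h1.comp_of_map (by fun_prop)

theorem integral_inner_sq (h : IsCenteredGaussian μ R) (a : E) :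
    ∫ z, ⟪a, z⟫ ^ 2 ∂μ = ⟪R a, a⟫ := by
  have : SecondCountableTopology E := UniformSpace.secondCountable_of_separable E
  have h1 := ProbabilityTheory.variance_fun_id_gaussianReal (μ := 0) (v := (⟪R a, a⟫).toNNReal)
  rw [ProbabilityTheory.variance_of_integral_eq_zero (by fun_prop)
    ProbabilityTheory.integral_id_gaussianReal, ← h.map_inner a, integral_map (by fun_prop)
    (by fun_prop), Real.coe_toNNReal _ (h.inner_nonneg a)] at h1
  exact h1

theorem lintegral_inner_sq (h : IsCenteredGaussian μ R) (a : E) :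
    ∫⁻ z, ENNReal.ofReal (⟪a, z⟫ ^ 2) ∂μ = ENNReal.ofReal ⟪R a, a⟫ := by
  rw [← h.integral_inner_sq a, ofReal_integral_eq_lintegral_ofReal (h.memLp_inner a).integrable_sq
    (ae_of_all _ fun _ => sq_nonneg _)]

variable [CompleteSpace E]

theorem ext (h : IsCenteredGaussian μ R) (h' : IsCenteredGaussian ν R) : μ = ν := by
  have := h.isProbabilityMeasure
  have := h'.isProbabilityMeasure
  have : SecondCountableTopology E := UniformSpace.secondCountable_of_separable E
  exact Measure.ext_of_charFun (funext fun x => by rw [h.charFun_eq, h'.charFun_eq])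

theorem centeredGaussian_eq (h : IsCenteredGaussian μ R) : centeredGaussian R = μ := by
  have hex : ∃ μ : Measure E, IsProbabilityMeasure μ ∧
      ∀ x : E, charFun μ x = Complex.exp (-((⟪R x, x⟫ / 2 : ℝ) : ℂ)) :=
    ⟨μ, h.isProbabilityMeasure, h.charFun_eq⟩
  rw [centeredGaussian, dif_pos hex]
  exact ext ⟨hex.choose_spec.1, hex.choose_spec.2⟩ h

theorem map {F : Type*} [NormedAddCommGroup F] [InnerProductSpace ℝ F] [CompleteSpace F]
    [MeasurableSpace F] [BorelSpace F] (h : IsCenteredGaussian μ R) (L : E →L[ℝ] F) :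
    IsCenteredGaussian (μ.map L) (L.comp (R.comp (L†))) := by
  have := h.isProbabilityMeasure
  refine ⟨Measure.isProbabilityMeasure_map (by fun_prop), fun x => ?_⟩
  rw [charFun_apply, integral_map (by fun_prop) (by fun_prop)]
  have h1 := h.charFun_eq ((L†) x)
  rw [charFun_apply] at h1
  simp only [ContinuousLinearMap.adjoint_inner_right] at h1
  exact h1

/-- The second moment of a centered Gaussian measure is the trace of its covariance. -/
theorem lintegral_norm_sq (h : IsCenteredGaussian μ R) {w : Set E} (b : HilbertBasis w ℝ E)
    [Countable w] :
    ∫⁻ z, ENNReal.ofReal (‖z‖ ^ 2) ∂μ = ∑' i, ENNReal.ofReal ⟪R (b i), b i⟫ := by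
  have h1 : ∀ z : E, ENNReal.ofReal (‖z‖ ^ 2) = ∑' i, ENNReal.ofReal (⟪b i, z⟫ ^ 2) := fun z => by
    have h2 := b.hasSum_inner_mul_inner z z
    simp_rw [real_inner_comm _ (z : E), ← sq] at h2
    rw [← real_inner_self_eq_norm_sq, ← h2.tsum_eq,
      ENNReal.ofReal_tsum_of_nonneg (fun _ => sq_nonneg _) h2.summable]
  simp_rw [h1, ← h.lintegral_inner_sq]
  exact lintegral_tsum fun i => by fun_prop

end IsCenteredGaussian

theorem isCenteredGaussian_dirac_zero [BorelSpace E] :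
    IsCenteredGaussian (Measure.dirac (0 : E)) 0 :=
  ⟨inferInstance, fun x => by simp⟩

theorem HilbertBasis.countable {E : Type*} [NormedAddCommGroup E] [InnerProductSpace ℝ E]
    [TopologicalSpace.SeparableSpace E] {w : Type*} (b : HilbertBasis w ℝ E) : Countable w := by
  refine Pairwise.countable_of_isOpen_disjoint (s := fun i : w => Metric.ball (b i) (1 / 2)) ?_
    (fun _ => Metric.isOpen_ball) (fun i => ⟨b i, by simp⟩)
  intro i j hij
  refine Metric.ball_disjoint_ball ?_
  have h2 : ‖b i - b j‖ ^ 2 = 2 := by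
    rw [norm_sub_sq_real, b.orthonormal.norm_eq_one, b.orthonormal.norm_eq_one,
      b.orthonormal.inner_eq_zero hij]
    norm_num
  rw [dist_eq_norm]
  nlinarith [norm_nonneg (b i - b j)]

section Existence
variable [BorelSpace E] [TopologicalSpace.SeparableSpace E] [CompleteSpace E]

/-- The series `∑ ξᵢ vᵢ` with independent standard Gaussian `ξᵢ` and `∑ ‖vᵢ‖² < ∞` converges in
mean square. -/
theorem exists_gaussian_series {w : Type*} {v : w → E} (hv : Summable fun i => ‖v i‖ ^ 2) :
    ∃ μ : Measure E, IsProbabilityMeasure μ ∧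
      ∀ x : E, charFun μ x = Complex.exp (-((∑' i, ⟪v i, x⟫ ^ 2) / 2 : ℝ)) := by
  have : SecondCountableTopology E := UniformSpace.secondCountable_of_separable E
  classical
  obtain ⟨P, hP, hind, hev⟩ : ∃ P : Measure (w → ℝ), IsProbabilityMeasure P ∧
      ProbabilityTheory.iIndepFun (fun i (ω : w → ℝ) => ω i) P ∧
      ∀ i, P.map (fun ω => ω i) = ProbabilityTheory.gaussianReal 0 1 :=
    ⟨Measure.infinitePi fun _ => ProbabilityTheory.gaussianReal 0 1, inferInstance,
      ProbabilityTheory.iIndepFun_infinitePi (X := fun _ (x : ℝ) => x) fun _ => measurable_id,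
      fun i => Measure.infinitePi_map_eval _ i⟩
  have hme : ∀ i, Measurable fun ω : w → ℝ => ω i := fun i => measurable_pi_apply i
  have hmX : ∀ i, Measurable fun ω : w → ℝ => ω i • v i := fun i => (hme i).smul_const (v i)
  have hmS : ∀ s : Finset w, Measurable fun ω : w → ℝ => ∑ i ∈ s, ω i • v i := fun s =>
    Finset.measurable_fun_sum s fun i _ => hmX i
  have hL2 : ∀ i, MemLp (fun ω : w → ℝ => ω i) 2 P := fun i => by
    have h1 : MemLp id 2 (P.map (fun ω : w → ℝ => ω i)) := by
      rw [hev i]; exact ProbabilityTheory.memLp_id_gaussianReal' 2 (by norm_num)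
    exact h1.comp_of_map (hme i).aemeasurable
  have hmean : ∀ i, ∫ ω, ω i ∂P = 0 := fun i => by
    have h1 := ProbabilityTheory.integral_id_gaussianReal (μ := 0) (v := 1)
    rwa [← hev i, integral_map (hme i).aemeasurable (by fun_prop)] at h1
  have hvar : ∀ i, ∫ ω, ω i * ω i ∂P = 1 := fun i => by
    have h1 := ProbabilityTheory.variance_fun_id_gaussianReal (μ := 0) (v := 1)
    rw [ProbabilityTheory.variance_of_integral_eq_zero (by fun_prop)
      ProbabilityTheory.integral_id_gaussianReal, ← hev i,
      integral_map (hme i).aemeasurable (by fun_prop)] at h1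
    simpa [sq] using h1
  have hX2 : ∀ i, MemLp (fun ω : w → ℝ => ω i • v i) 2 P := fun i => by
    refine (hL2 i).of_le_mul (c := ‖v i‖) (hmX i).aestronglyMeasurable (ae_of_all _ fun ω => ?_)
    rw [norm_smul, mul_comm]
  let X : w → Lp E 2 P := fun i => (hX2 i).toLp
  have hinner : ∀ i j, ⟪X i, X j⟫ = (∫ ω, ω i * ω j ∂P) * ⟪v i, v j⟫ := fun i j => by
    rw [L2.inner_def, ← integral_mul_const]
    refine integral_congr_ae ?_
    filter_upwards [(hX2 i).coeFn_toLp, (hX2 j).coeFn_toLp] with ω h1 h2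
    rw [h1, h2, real_inner_smul_left, inner_smul_right]
    ring
  -- convergence in `L²(P; E)`: the terms of the series are orthogonal, with norms `‖v i‖`
  have horth : OrthogonalFamily ℝ (fun i => ↥(ℝ ∙ X i)) fun i => (ℝ ∙ X i).subtypeₗᵢ := by
    rintro i j hij ⟨x, hx⟩ ⟨y, hy⟩
    obtain ⟨a, rfl⟩ := Submodule.mem_span_singleton.1 hx
    obtain ⟨c, rfl⟩ := Submodule.mem_span_singleton.1 hy
    have h1 : ∫ ω, ω i * ω j ∂P = 0 := by
      rw [(hind.indepFun hij).integral_fun_mul_eq_mul_integral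
        (hme i).aestronglyMeasurable (hme j).aestronglyMeasurable,
        hmean i, zero_mul]
    simp [inner_smul_left, inner_smul_right, hinner, h1]
  have hsum : Summable X := by
    refine (horth.summable_iff_norm_sq_summable
      (fun i => ⟨X i, Submodule.mem_span_singleton_self _⟩)).2 ?_
    refine hv.congr fun i => ?_
    rw [Submodule.coe_norm, ← real_inner_self_eq_norm_sq (X i), hinner, hvar,
      real_inner_self_eq_norm_sq, one_mul]
  obtain ⟨Y, hY⟩ := hsum
  have hYm : AEStronglyMeasurable Y P := Lp.aestronglyMeasurable Y
  refine ⟨P.map Y, Measure.isProbabilityMeasure_map hYm.aemeasurable, fun x => ?_⟩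
  rw [charFun_apply, integral_map hYm.aemeasurable (by fun_prop)]
  -- the finite sums have the expected characteristic functions, which pass to the limit
  have hfin : ∀ s : Finset w, ∫ ω, Complex.exp ((⟪∑ i ∈ s, ω i • v i, x⟫ : ℝ) * Complex.I) ∂P =
      Complex.exp (-((∑ i ∈ s, ⟪v i, x⟫ ^ 2) / 2 : ℝ)) := fun s => by
    have h1 := ProbabilityTheory.iIndepFun.charFun_map_fun_finsetSum_eq_prod (s := s) (P := P)
      (X := fun i ω => ω i • v i) (fun i _ => (hmX i).aemeasurable)
      ((hind.comp (fun i r => r • v i) (fun i => by fun_prop)).restrict s)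
    have h2 := congrFun h1 x
    rw [charFun_apply, integral_map (hmS s).aemeasurable (by fun_prop), Finset.prod_apply] at h2
    rw [h2, Finset.sum_div, Complex.ofReal_sum, ← Finset.sum_neg_distrib, Complex.exp_sum]
    refine Finset.prod_congr rfl fun i _ => ?_
    have h3 := ProbabilityTheory.charFun_gaussianReal (μ := 0) (v := 1) ⟪v i, x⟫
    rw [← hev i, charFun_apply_real, integral_map (hme i).aemeasurable (by fun_prop)] at h3
    rw [charFun_apply, integral_map (hmX i).aemeasurable (by fun_prop)]
    convert h3 using 1
    · refine integral_congr_ae (ae_of_all _ fun ω => ?_)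
      simp only [real_inner_smul_left]
      push_cast; ring_nf
    · congr 1; push_cast; ring
  have hlim := tendsto_integral_exp_mul_I (P := P) (l := (atTop : Filter (Finset w)))
    (X := fun s ω => ⟪∑ i ∈ s, ω i • v i, x⟫) (Y := fun ω => ⟪Y ω, x⟫)
    (fun s => ((hmS s).inner (𝕜 := ℝ) measurable_const).aestronglyMeasurable)
    (hYm.inner (𝕜 := ℝ) aestronglyMeasurable_const) (by
      have h1 : Tendsto (fun s : Finset w => ‖∑ i ∈ s, X i - Y‖ₑ * ‖x‖ₑ) atTop (𝓝 0) := by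
        have h2 : Tendsto (fun s : Finset w => ‖∑ i ∈ s, X i - Y‖ₑ) atTop (𝓝 0) := by
          have h3 : Tendsto (fun s : Finset w => ∑ i ∈ s, X i - Y) atTop (𝓝 0) := by
            simpa using Tendsto.sub_const hY Y
          simpa using h3.enorm
        simpa using ENNReal.Tendsto.mul_const h2 (Or.inr enorm_ne_top)
      refine tendsto_of_tendsto_of_tendsto_of_le_of_le tendsto_const_nhds h1 (fun _ => zero_le)
        fun s => ?_
      rw [Lp.enorm_def, mul_comm]
      refine eLpNorm_le_mul_eLpNorm_of_ae_le_mul' ?_ 2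
      have hfs : ∀ s : Finset w, (∑ i ∈ s, X i : Lp E 2 P) =ᵐ[P] fun ω => ∑ i ∈ s, ω i • v i :=
        fun s => by
          refine (Lp.coeFn_finsetSum s X).trans ?_
          have h4 : ∀ᵐ ω ∂P, ∀ i ∈ s, X i ω = ω i • v i :=
            (ae_ball_iff s.countable_toSet).2 fun i _ => (hX2 i).coeFn_toLp
          filter_upwards [h4] with ω h4
          rw [Finset.sum_apply]
          exact Finset.sum_congr rfl h4
      filter_upwards [Lp.coeFn_sub (∑ i ∈ s, X i) Y, hfs s] with ω h5 h6
      rw [h5, Pi.sub_apply, h6, ← inner_sub_left, mul_comm]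
      rw [← enorm_eq_nnnorm x]
      simp only [← ofReal_norm]
      rw [← ENNReal.ofReal_mul (norm_nonneg _)]
      exact ENNReal.ofReal_le_ofReal (norm_inner_le_norm _ _))
  simp_rw [hfin] at hlim
  refine tendsto_nhds_unique hlim ?_
  have hs : Summable fun i => ⟪v i, x⟫ ^ 2 := by
    refine Summable.of_nonneg_of_le (fun _ => sq_nonneg _) (fun i => ?_) (hv.mul_right (‖x‖ ^ 2))
    rw [← mul_pow, ← sq_abs]
    exact pow_le_pow_left₀ (abs_nonneg _) (abs_real_inner_le_norm _ _) 2
  exact (by fun_prop : Continuous fun r : ℝ => Complex.exp (-(r / 2 : ℝ))).continuousAt.tendsto.comp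
    hs.hasSum

/-- A positive trace class operator is the covariance of a Gaussian measure. -/
theorem IsTraceClassPos.isCenteredGaussian {R : E →L[ℝ] E} (hR : IsTraceClassPos R) :
    IsCenteredGaussian (centeredGaussian R) R := by
  obtain ⟨hpos, w, b, hb⟩ := hR
  obtain ⟨μ, hμ, hc⟩ := exists_gaussian_series (v := fun i => opSqrt R (b i)) (by
    simpa only [norm_opSqrt_sq hpos] using hb)
  have h : IsCenteredGaussian μ R := by
    refine ⟨hμ, fun x => ?_⟩
    rw [hc, ← norm_opSqrt_sq hpos x, ← real_inner_self_eq_norm_sq,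
      ← b.tsum_inner_mul_inner (opSqrt R x) (opSqrt R x)]
    congr 5
    funext i
    have h1 : ⟪opSqrt R (b i), x⟫ = ⟪b i, opSqrt R x⟫ :=
      (isPositive_opSqrt hpos).inner_left_eq_inner_right _ _
    rw [h1, sq, real_inner_comm]
  rw [h.centeredGaussian_eq]
  exact h

end Existence

end CenteredGaussian

/-! ### Gaussian functionals and the Cameron-Martin formula -/

theorem abs_integral_mul_le_sqrt {α : Type*} [MeasurableSpace α] {μ : Measure α} {f g : α → ℝ}
    (hf : MemLp f 2 μ) (hg : MemLp g 2 μ) :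
    |∫ x, f x * g x ∂μ| ≤ √(∫ x, f x ^ 2 ∂μ) * √(∫ x, g x ^ 2 ∂μ) := by
  have hin : ∀ {f g : α → ℝ} (hf : MemLp f 2 μ) (hg : MemLp g 2 μ),
      ⟪hf.toLp, hg.toLp⟫ = ∫ x, f x * g x ∂μ := fun hf hg => by
    rw [L2.inner_def]
    refine integral_congr_ae ?_
    filter_upwards [hf.coeFn_toLp, hg.coeFn_toLp] with x h1 h2
    rw [h1, h2, real_inner_comm]
    rfl
  have hno : ∀ {f : α → ℝ} (hf : MemLp f 2 μ), ‖hf.toLp‖ = √(∫ x, f x ^ 2 ∂μ) := fun hf => by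
    rw [norm_eq_sqrt_real_inner, hin]
    simp_rw [sq]
  rw [← hin hf hg, ← hno hf, ← hno hg]
  exact abs_real_inner_le_norm _ _

theorem integral_abs_le_sqrt {α : Type*} [MeasurableSpace α] {μ : Measure α}
    [IsProbabilityMeasure μ] {f : α → ℝ} (hf : MemLp f 2 μ) :
    ∫ x, |f x| ∂μ ≤ √(∫ x, f x ^ 2 ∂μ) := by
  have h := abs_integral_mul_le_sqrt hf.abs (memLp_const (1 : ℝ))
  simp only [Pi.abs_apply, mul_one, sq_abs, one_pow, integral_const, probReal_univ, smul_eq_mul,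
    Real.sqrt_one] at h
  exact (le_abs_self _).trans h

/-- The second order remainder of the exponential martingale `e^{ξ - v/2}` in mean square. -/
theorem integral_exp_sub_one_sub_sq {α : Type*} [MeasurableSpace α] {μ : Measure α} {ξ : α → ℝ}
    (hm : AEMeasurable ξ μ) {v : ℝ≥0} (h : μ.map ξ = ProbabilityTheory.gaussianReal 0 v) :
    MemLp (fun z => Real.exp (ξ z - v / 2) - 1 - ξ z) 2 μ ∧
    ∫ z, (Real.exp (ξ z - v / 2) - 1 - ξ z) ^ 2 ∂μ = Real.exp v - 1 - v := by
  have hexp : ∀ t : ℝ, Integrable (fun x => Real.exp (t * x)) (μ.map ξ) := fun t => by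
    rw [h]; exact ProbabilityTheory.integrable_exp_mul_gaussianReal t
  have hiexp : ∀ t : ℝ, ∫ x, Real.exp (t * x) ∂μ.map ξ = Real.exp (v * t ^ 2 / 2) := fun t => by
    have := congrFun (ProbabilityTheory.mgf_id_gaussianReal (μ := 0) (v := v)) t
    rw [h]
    simpa [ProbabilityTheory.mgf] using this
  have hint : (1 : ℝ) ∈ interior (ProbabilityTheory.integrableExpSet id (μ.map ξ)) := by
    rw [h, ProbabilityTheory.integrableExpSet_id_gaussianReal, interior_univ]; trivial
  have hxe : Integrable (fun x => x * Real.exp (1 * x)) (μ.map ξ) := by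
    simpa using ProbabilityTheory.integrable_pow_mul_exp_of_mem_interior_integrableExpSet hint 1
  -- the derivative at `1` of the moment generating function
  have hixe : ∫ x, x * Real.exp (1 * x) ∂μ.map ξ = v * Real.exp (v / 2) := by
    have h1 := ProbabilityTheory.hasDerivAt_mgf hint
    have h2 : HasDerivAt (fun t : ℝ => Real.exp (0 * t + (v : ℝ) * t ^ 2 / 2))
        ((v : ℝ) * Real.exp (v / 2)) 1 := by
      have h3 : HasDerivAt (fun t : ℝ => 0 * t + (v : ℝ) * t ^ 2 / 2) (v : ℝ) 1 := by
        have := ((hasDerivAt_pow 2 (1 : ℝ)).const_mul (v : ℝ)).div_const 2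
        have h4 := ((hasDerivAt_id (1 : ℝ)).const_mul (0 : ℝ)).add this
        refine h4.congr_deriv ?_
        norm_num
      refine h3.exp.congr_deriv ?_
      ring_nf
    rw [h, ProbabilityTheory.mgf_id_gaussianReal, ← h] at h1
    exact h1.unique h2
  have hL2 : MemLp (fun x : ℝ => x) 2 (μ.map ξ) := by
    rw [h]; exact ProbabilityTheory.memLp_id_gaussianReal' 2 (by norm_num)
  have hpr : IsProbabilityMeasure (μ.map ξ) := by rw [h]; infer_instance
  have hx : Integrable (fun x : ℝ => x) (μ.map ξ) := hL2.integrable (by norm_num)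
  have hix : ∫ x, x ∂μ.map ξ = 0 := by rw [h]; exact ProbabilityTheory.integral_id_gaussianReal
  have hx2 : Integrable (fun x : ℝ => x ^ 2) (μ.map ξ) := hL2.integrable_sq
  have hix2 : ∫ x, x ^ 2 ∂μ.map ξ = v := by
    have h1 := ProbabilityTheory.variance_fun_id_gaussianReal (μ := 0) (v := v)
    rw [ProbabilityTheory.variance_of_integral_eq_zero (by fun_prop)
      ProbabilityTheory.integral_id_gaussianReal, ← h] at h1
    exact h1
  have hexpand : ∀ x : ℝ, (Real.exp (x - v / 2) - 1 - x) ^ 2 =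
      Real.exp (-v) * Real.exp (2 * x) + (1 + (x ^ 2 + (-2 * Real.exp (-(v / 2 : ℝ)) *
        Real.exp (1 * x) + (-2 * Real.exp (-(v / 2 : ℝ)) * (x * Real.exp (1 * x)) + 2 * x)))) := by
    intro x
    have e1 : Real.exp (x - v / 2) = Real.exp (-(v / 2 : ℝ)) * Real.exp x := by
      rw [← Real.exp_add]; ring_nf
    have e2 : Real.exp (-(v : ℝ)) = Real.exp (-(v / 2 : ℝ)) ^ 2 := by
      rw [← Real.exp_nat_mul]; push_cast; ring_nf
    have e3 : Real.exp (2 * x) = Real.exp x ^ 2 := by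
      rw [← Real.exp_nat_mul]; push_cast; ring_nf
    rw [e1, e2, e3, one_mul]
    ring
  have hI1 := (hexp 2).const_mul (Real.exp (-v))
  have hI4 := (hexp 1).const_mul (-2 * Real.exp (-(v / 2 : ℝ)))
  have hI5 := hxe.const_mul (-2 * Real.exp (-(v / 2 : ℝ)))
  have hI6 := hx.const_mul 2
  have hI56 := hI5.fun_add hI6
  have hI456 := hI4.fun_add hI56
  have hI3456 := hx2.fun_add hI456
  have hI23456 := (integrable_const (1 : ℝ)).fun_add hI3456
  have hsq : Integrable (fun x : ℝ => (Real.exp (x - v / 2) - 1 - x) ^ 2) (μ.map ξ) := by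
    simp_rw [hexpand]
    exact hI1.add hI23456
  constructor
  · refine MemLp.comp_of_map (g := fun x : ℝ => Real.exp (x - v / 2) - 1 - x) ?_ hm
    exact (memLp_two_iff_integrable_sq (by fun_prop)).2 hsq
  · have h0 : ∫ z, (Real.exp (ξ z - v / 2) - 1 - ξ z) ^ 2 ∂μ =
        ∫ x, (Real.exp (x - v / 2) - 1 - x) ^ 2 ∂μ.map ξ :=
      (integral_map hm (f := fun x : ℝ => (Real.exp (x - v / 2) - 1 - x) ^ 2) (by fun_prop)).symm
    rw [h0]
    simp_rw [hexpand]
    rw [integral_add hI1 hI23456, integral_add (integrable_const _) hI3456,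
      integral_add hx2 hI456, integral_add hI4 hI56, integral_add hI5 hI6, integral_const_mul,
      integral_const_mul, integral_const_mul, integral_const_mul, hiexp, hiexp, hixe, hix, hix2]
    have e1 : Real.exp (-(v : ℝ)) * Real.exp (v * 2 ^ 2 / 2) = Real.exp v := by
      rw [← Real.exp_add]; ring_nf
    have e2 : Real.exp (-(v / 2 : ℝ)) * Real.exp (v * 1 ^ 2 / 2) = 1 := by
      rw [← Real.exp_add]; ring_nf; simp
    have e3 : Real.exp (-(v / 2 : ℝ)) * Real.exp (v / 2) = 1 := by
      rw [← Real.exp_add]; ring_nf; simp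
    rw [e1]
    simp only [integral_const, probReal_univ, smul_eq_mul]
    linear_combination (-2 : ℝ) * e2 + (-2 * (v : ℝ)) * e3

theorem exp_sub_one_sub_le_sq {u : ℝ} (h0 : 0 ≤ u) (h1 : u ≤ 1) : Real.exp u - 1 - u ≤ u ^ 2 := by
  have := Real.abs_exp_sub_one_sub_id_le (x := u) (by rwa [abs_of_nonneg h0])
  exact (le_abs_self _).trans this

section Functional
variable {E : Type*} [NormedAddCommGroup E] [InnerProductSpace ℝ E] [CompleteSpace E]
  [MeasurableSpace E] [BorelSpace E] [TopologicalSpace.SeparableSpace E] {R : E →L[ℝ] E}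

theorem eLpNorm_inner_eq (hR : R.IsPositive) (hG : IsCenteredGaussian (centeredGaussian R) R)
    (a : E) : eLpNorm (fun z => ⟪a, z⟫) 2 (centeredGaussian R) = ENNReal.ofReal ‖opSqrt R a‖ := by
  rw [(hG.memLp_inner a).eLpNorm_eq_integral_rpow_norm (by norm_num) (by norm_num)]
  congr 1
  have h1 : ∫ z, ‖⟪a, z⟫‖ ^ (2 : ENNReal).toReal ∂centeredGaussian R = ‖opSqrt R a‖ ^ 2 := by
    rw [norm_opSqrt_sq hR, ← hG.integral_inner_sq]
    refine integral_congr_ae (ae_of_all _ fun z => ?_)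
    simp
  rw [h1]
  simp only [ENNReal.toReal_ofNat]
  rw [← one_div, ← Real.sqrt_eq_rpow, Real.sqrt_sq (norm_nonneg _)]

/-- The map `R^{1/2} a ↦ ⟨a, ·⟩` is an isometry into `L²(𝒩(0, R))`, so it extends to the closure of
the range of `R^{1/2}`. -/
theorem exists_isGaussianFunctional (hR : R.IsPositive)
    (hG : IsCenteredGaussian (centeredGaussian R) R) {h : E}
    (hh : h ∈ closure (range (opSqrt R))) : ∃ ξ, IsGaussianFunctional R h ξ := by
  have : SecondCountableTopology E := UniformSpace.secondCountable_of_separable E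
  obtain ⟨b, hb, hlim⟩ := mem_closure_iff_seq_limit.1 hh
  choose a ha using hb
  let J : E → Lp ℝ 2 (centeredGaussian R) := fun a => (hG.memLp_inner a).toLp
  have hdist : ∀ x y, dist (J x) (J y) = dist (opSqrt R x) (opSqrt R y) := fun x y => by
    rw [Lp.dist_def, dist_eq_norm, ← map_sub]
    have h1 : eLpNorm (⇑(J x) - ⇑(J y)) 2 (centeredGaussian R) =
        eLpNorm (fun z => ⟪x - y, z⟫) 2 (centeredGaussian R) := by
      refine eLpNorm_congr_ae ?_
      filter_upwards [(hG.memLp_inner x).coeFn_toLp, (hG.memLp_inner y).coeFn_toLp] with z h2 h3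
      rw [Pi.sub_apply, inner_sub_left, ← h2, ← h3]
    rw [h1, eLpNorm_inner_eq hR hG, ENNReal.toReal_ofReal (norm_nonneg _)]
  have hc : CauchySeq fun n => J (a n) := by
    have h1 : CauchySeq fun n => opSqrt R (a n) := by
      simp_rw [ha]; exact hlim.cauchySeq
    rw [Metric.cauchySeq_iff] at h1 ⊢
    simpa only [hdist] using h1
  obtain ⟨ξ, hξ⟩ := cauchySeq_tendsto_of_complete hc
  refine ⟨ξ, Lp.memLp ξ, a, by simpa only [ha] using hlim, ?_⟩
  rw [Lp.tendsto_Lp_iff_tendsto_eLpNorm'] at hξ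
  refine hξ.congr fun n => eLpNorm_congr_ae ?_
  filter_upwards [(hG.memLp_inner (a n)).coeFn_toLp] with z h1
  rw [Pi.sub_apply, h1]

namespace IsGaussianFunctional
variable {h h' : E} {ξ ξ' : E → ℝ}

theorem add (hG : IsCenteredGaussian (centeredGaussian R) R) (H : IsGaussianFunctional R h ξ)
    (H' : IsGaussianFunctional R h' ξ') :
    IsGaussianFunctional R (h + h') (fun z => ξ z + ξ' z) := by
  obtain ⟨hm, a, ha, hl⟩ := H
  obtain ⟨hm', a', ha', hl'⟩ := H'
  refine ⟨hm.add hm', fun n => a n + a' n, by simpa using ha.add ha', ?_⟩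
  have h1 := hl.add hl'
  rw [add_zero] at h1
  refine tendsto_of_tendsto_of_tendsto_of_le_of_le tendsto_const_nhds h1 (fun _ => zero_le)
    fun n => ?_
  refine le_trans (le_of_eq ?_) (eLpNorm_add_le
    ((hG.memLp_inner (a n)).aestronglyMeasurable.sub hm.aestronglyMeasurable)
    ((hG.memLp_inner (a' n)).aestronglyMeasurable.sub hm'.aestronglyMeasurable) (by norm_num))
  congr 1
  funext z
  simp only [Pi.add_apply, inner_add_left]
  ring

theorem const_smul (H : IsGaussianFunctional R h ξ) (c : ℝ) :
    IsGaussianFunctional R (c • h) (fun z => c * ξ z) := by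
  obtain ⟨hm, a, ha, hl⟩ := H
  refine ⟨hm.const_mul c, fun n => c • a n, by simpa using ha.const_smul c, ?_⟩
  have h1 : Tendsto (fun n => ‖c‖ₑ * eLpNorm (fun z => ⟪a n, z⟫ - ξ z) 2 (centeredGaussian R))
      atTop (𝓝 0) := by
    simpa using ENNReal.Tendsto.const_mul hl (Or.inr enorm_ne_top)
  refine h1.congr fun n => ?_
  rw [← eLpNorm_const_smul]
  congr 1
  funext z
  simp only [Pi.smul_apply, smul_eq_mul, real_inner_smul_left]
  ring

/-- The joint characteristic function of a Gaussian functional and a linear functional. -/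
theorem integral_exp (hR : R.IsPositive) (hG : IsCenteredGaussian (centeredGaussian R) R)
    (H : IsGaussianFunctional R h ξ) (r : ℝ) (x : E) :
    ∫ z, Complex.exp ((r * ξ z + ⟪x, z⟫ : ℝ) * Complex.I) ∂centeredGaussian R =
      Complex.exp (-((‖r • h + opSqrt R x‖ ^ 2 / 2 : ℝ) : ℂ)) := by
  have : SecondCountableTopology E := UniformSpace.secondCountable_of_separable E
  have := hG.isProbabilityMeasure
  obtain ⟨hm, a, ha, hl⟩ := H
  have h1 := tendsto_integral_exp_mul_I (P := centeredGaussian R) (l := atTop)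
    (X := fun n z => ⟪r • a n + x, z⟫) (Y := fun z => r * ξ z + ⟪x, z⟫)
    (fun n => (hG.memLp_inner _).aestronglyMeasurable)
    ((hm.aestronglyMeasurable.const_mul r).add (hG.memLp_inner _).aestronglyMeasurable) (by
      have h1 : Tendsto (fun n => ‖r‖ₑ * eLpNorm (fun z => ⟪a n, z⟫ - ξ z) 2
          (centeredGaussian R)) atTop (𝓝 0) := by
        simpa using ENNReal.Tendsto.const_mul hl (Or.inr enorm_ne_top)
      refine h1.congr fun n => ?_
      rw [← eLpNorm_const_smul]
      congr 1
      funext z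
      simp only [Pi.smul_apply, smul_eq_mul, real_inner_smul_left, inner_add_left]
      ring)
  refine tendsto_nhds_unique h1 ?_
  have h2 : ∀ n, ∫ z, Complex.exp ((⟪r • a n + x, z⟫ : ℝ) * Complex.I) ∂centeredGaussian R =
      Complex.exp (-((‖r • opSqrt R (a n) + opSqrt R x‖ ^ 2 / 2 : ℝ) : ℂ)) := fun n => by
    have h3 := hG.charFun_eq (r • a n + x)
    rw [charFun_apply, ← norm_opSqrt_sq hR, map_add, map_smul] at h3
    rw [← h3]
    simp_rw [real_inner_comm _ (r • a n + x)]
  simp_rw [h2]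
  exact (by fun_prop : Continuous fun y : E => Complex.exp
    (-((‖r • y + opSqrt R x‖ ^ 2 / 2 : ℝ) : ℂ))).continuousAt.tendsto.comp ha

theorem map_eq (hR : R.IsPositive) (hG : IsCenteredGaussian (centeredGaussian R) R)
    (H : IsGaussianFunctional R h ξ) :
    (centeredGaussian R).map ξ = ProbabilityTheory.gaussianReal 0 (‖h‖₊ ^ 2) := by
  have := hG.isProbabilityMeasure
  refine map_eq_gaussianReal_of_integral_exp H.1.aestronglyMeasurable.aemeasurable fun r => ?_
  have h1 := H.integral_exp hR hG r 0
  simp only [inner_zero_left, add_zero, map_zero, norm_smul, mul_pow, Real.norm_eq_abs,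
    sq_abs] at h1
  rw [h1]
  push_cast
  ring_nf

theorem integral_sq (hR : R.IsPositive) (hG : IsCenteredGaussian (centeredGaussian R) R)
    (H : IsGaussianFunctional R h ξ) : ∫ z, ξ z ^ 2 ∂centeredGaussian R = ‖h‖ ^ 2 := by
  have h1 := ProbabilityTheory.variance_fun_id_gaussianReal (μ := 0) (v := ‖h‖₊ ^ 2)
  rw [ProbabilityTheory.variance_of_integral_eq_zero (by fun_prop)
    ProbabilityTheory.integral_id_gaussianReal, ← H.map_eq hR hG,
    integral_map H.1.aestronglyMeasurable.aemeasurable (by fun_prop)] at h1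
  simpa using h1

theorem ae_eq (hR : R.IsPositive) (hG : IsCenteredGaussian (centeredGaussian R) R)
    (H : IsGaussianFunctional R h ξ) (H' : IsGaussianFunctional R h ξ') :
    ξ =ᵐ[centeredGaussian R] ξ' := by
  have h1 := H.add hG (H'.const_smul (-1))
  have h2 := h1.integral_sq hR hG
  rw [neg_one_smul, add_neg_cancel, norm_zero, zero_pow two_ne_zero,
    integral_eq_zero_iff_of_nonneg (fun _ => sq_nonneg _) h1.1.integrable_sq] at h2
  filter_upwards [h2] with z hz
  have := pow_eq_zero_iff (two_ne_zero) |>.1 hz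
  linarith

/-- **Cameron-Martin formula** on the side of characteristic functions. The functional `⟨x, ·⟩` is
split into a multiple of `ξ` and a part independent of `ξ`. -/
theorem integral_exp_mul (hR : R.IsPositive) (hG : IsCenteredGaussian (centeredGaussian R) R)
    (H : IsGaussianFunctional R h ξ) (x : E) :
    ∫ z, Complex.exp (⟪z, x⟫ * Complex.I) * (Real.exp (ξ z - ‖h‖ ^ 2 / 2) : ℝ)
      ∂centeredGaussian R =
      Complex.exp (-((⟪R x, x⟫ / 2 : ℝ) : ℂ)) * Complex.exp (⟪opSqrt R x, h⟫ * Complex.I) := by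
  have : SecondCountableTopology E := UniformSpace.secondCountable_of_separable E
  have := hG.isProbabilityMeasure
  set c : ℝ := ⟪opSqrt R x, h⟫ / ‖h‖ ^ 2 with hc
  have hch : c * ‖h‖ ^ 2 = ⟪opSqrt R x, h⟫ := by
    rcases eq_or_ne h 0 with h0 | h0
    · simp [h0]
    · rw [hc, div_mul_cancel₀]
      exact pow_ne_zero _ (norm_ne_zero_iff.2 h0)
  have hmξ : AEMeasurable ξ (centeredGaussian R) := H.1.aestronglyMeasurable.aemeasurable
  let η : E → ℝ := fun z => ⟪x, z⟫ - c * ξ z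
  have hmη : AEMeasurable η (centeredGaussian R) := by fun_prop
  have horth : ⟪opSqrt R x - c • h, h⟫ = 0 := by
    rw [inner_sub_left, real_inner_smul_left, real_inner_self_eq_norm_sq, hch, sub_self]
  have hη : ∀ s r : ℝ, ∫ z, Complex.exp ((s * η z + r * ξ z : ℝ) * Complex.I) ∂centeredGaussian R =
      Complex.exp (-((s ^ 2 * ‖opSqrt R x - c • h‖ ^ 2 / 2 : ℝ) : ℂ)) *
        Complex.exp (-((r ^ 2 * ‖h‖ ^ 2 / 2 : ℝ) : ℂ)) := fun s r => by
    have h1 := H.integral_exp hR hG (r - s * c) (s • x)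
    have h2 : (r - s * c) • h + opSqrt R (s • x) = s • (opSqrt R x - c • h) + r • h := by
      rw [map_smul]; module
    rw [h2, norm_add_sq_real, real_inner_smul_left, inner_smul_right, horth, norm_smul,
      norm_smul] at h1
    rw [← Complex.exp_add]
    convert h1 using 1
    · refine integral_congr_ae (ae_of_all _ fun z => ?_)
      simp only [η, real_inner_smul_left]
      congr 3
      ring
    · simp only [mul_pow, Real.norm_eq_abs, sq_abs]
      congr 1
      push_cast
      ring
  have hcη : ∀ s : ℝ, charFun ((centeredGaussian R).map η) s =
      Complex.exp (-((s ^ 2 * ‖opSqrt R x - c • h‖ ^ 2 / 2 : ℝ) : ℂ)) := fun s => by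
    have h1 := hη s 0
    rw [charFun_apply_real, integral_map hmη (by fun_prop)]
    simpa using h1
  have hcξ : ∀ r : ℝ, charFun ((centeredGaussian R).map ξ) r =
      Complex.exp (-((r ^ 2 * ‖h‖ ^ 2 / 2 : ℝ) : ℂ)) := fun r => by
    have h1 := hη 0 r
    rw [charFun_apply_real, integral_map hmξ (by fun_prop)]
    simpa using h1
  have hind : ProbabilityTheory.IndepFun η ξ (centeredGaussian R) := by
    rw [ProbabilityTheory.indepFun_iff_charFun_prod hmη hmξ]
    intro t
    rw [hcη, hcξ, ← hη, charFun_apply, integral_map (by fun_prop) (by fun_prop)]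
    refine integral_congr_ae (ae_of_all _ fun z => ?_)
    simp only [WithLp.prod_inner_apply]
    simp [mul_comm]
  have hprod := hind.comp (φ := fun y : ℝ => Complex.exp (y * Complex.I))
    (ψ := fun y : ℝ => Complex.exp ((1 + c * Complex.I) * y)) (by fun_prop) (by fun_prop)
  have h1 := hprod.integral_fun_smul_eq_smul_integral
    ((by fun_prop : Measurable fun y : ℝ => Complex.exp (y * Complex.I)).comp_aemeasurable
      hmη).aestronglyMeasurable
    ((by fun_prop : Measurable fun y : ℝ => Complex.exp ((1 + c * Complex.I) * y)).comp_aemeasurable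
      hmξ).aestronglyMeasurable
  have h2 := ProbabilityTheory.complexMGF_gaussianReal (H.map_eq hR hG) (1 + c * Complex.I)
  have h3 := hcη 1
  rw [charFun_apply_real, integral_map hmη (by fun_prop)] at h3
  rw [ProbabilityTheory.complexMGF] at h2
  simp only [Function.comp_apply, smul_eq_mul] at h1
  rw [h2] at h1
  simp only [Complex.ofReal_one, one_mul] at h3
  rw [h3] at h1
  have h4 : ∀ z, Complex.exp (⟪z, x⟫ * Complex.I) * (Real.exp (ξ z - ‖h‖ ^ 2 / 2) : ℝ) =
      Complex.exp (η z * Complex.I) * Complex.exp ((1 + c * Complex.I) * ξ z) *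
        Complex.exp (-(‖h‖ ^ 2 / 2 : ℝ)) := fun z => by
    rw [Complex.ofReal_exp, ← Complex.exp_add, ← Complex.exp_add, ← Complex.exp_add,
      real_inner_comm]
    congr 1
    simp only [η]
    push_cast
    ring
  simp_rw [h4]
  rw [integral_mul_const, h1, ← Complex.exp_add, ← Complex.exp_add, ← Complex.exp_add]
  congr 1
  have h5 : ‖opSqrt R x - c • h‖ ^ 2 = ⟪R x, x⟫ - c ^ 2 * ‖h‖ ^ 2 := by
    rw [norm_sub_sq_real, norm_opSqrt_sq hR, inner_smul_right, ← hch, norm_smul, mul_pow,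
      Real.norm_eq_abs, sq_abs]
    ring
  rw [h5, ← hch]
  push_cast
  linear_combination (‖h‖ ^ 2 * c ^ 2 / 2 : ℂ) * Complex.I_sq

/-- **Cameron-Martin formula**: translation by `R^{1/2} h` has density `e^{ξ - ‖h‖² / 2}`. -/
theorem integral_translate (hR : R.IsPositive) (hG : IsCenteredGaussian (centeredGaussian R) R)
    (H : IsGaussianFunctional R h ξ) {ψ : E → ℝ} (hψ : Measurable ψ) :
    ∫ z, ψ (z + opSqrt R h) ∂centeredGaussian R =
      ∫ z, ψ z * Real.exp (ξ z - ‖h‖ ^ 2 / 2) ∂centeredGaussian R := by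
  have : SecondCountableTopology E := UniformSpace.secondCountable_of_separable E
  have := hG.isProbabilityMeasure
  have hmξ : AEMeasurable ξ (centeredGaussian R) := H.1.aestronglyMeasurable.aemeasurable
  have hmd : AEMeasurable (fun z => Real.exp (ξ z - ‖h‖ ^ 2 / 2)) (centeredGaussian R) := by
    fun_prop
  have hint : Integrable (fun z => Real.exp (ξ z - ‖h‖ ^ 2 / 2)) (centeredGaussian R) := by
    have h1 : Integrable (fun x : ℝ => Real.exp (1 * x)) ((centeredGaussian R).map ξ) := by
      rw [H.map_eq hR hG]; exact ProbabilityTheory.integrable_exp_mul_gaussianReal 1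
    have h2 := (h1.comp_aemeasurable hmξ).mul_const (Real.exp (-(‖h‖ ^ 2 / 2)))
    refine h2.congr (ae_of_all _ fun z => ?_)
    simp only [Function.comp_apply, one_mul]
    rw [← Real.exp_add]; ring_nf
  let d : E → ENNReal := fun z => ENNReal.ofReal (Real.exp (ξ z - ‖h‖ ^ 2 / 2))
  have hdm : AEMeasurable d (centeredGaussian R) := hmd.ennreal_ofReal
  have hfin : IsFiniteMeasure ((centeredGaussian R).withDensity d) :=
    isFiniteMeasure_withDensity_ofReal hint.2
  have hdi : ∀ {F : Type _} [NormedAddCommGroup F] [NormedSpace ℝ F] (g : E → F),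
      ∫ z, g z ∂(centeredGaussian R).withDensity d =
        ∫ z, Real.exp (ξ z - ‖h‖ ^ 2 / 2) • g z ∂centeredGaussian R := fun g => by
    rw [integral_withDensity_eq_integral_toReal_smul₀ hdm (ae_of_all _ fun z => by simp [d])]
    refine integral_congr_ae (ae_of_all _ fun z => ?_)
    simp only [d]
    rw [ENNReal.toReal_ofReal (Real.exp_pos _).le]
  have hmeas : (centeredGaussian R).map (fun z => z + opSqrt R h) =
      (centeredGaussian R).withDensity d := by
    have : IsProbabilityMeasure ((centeredGaussian R).map (fun z => z + opSqrt R h)) :=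
      Measure.isProbabilityMeasure_map (by fun_prop)
    refine Measure.ext_of_charFun (funext fun x => ?_)
    rw [charFun_map_add_const, hG.charFun_eq, charFun_apply, hdi]
    have h1 := H.integral_exp_mul hR hG x
    have h2 : ⟪opSqrt R h, x⟫ = ⟪opSqrt R x, h⟫ := by
      rw [real_inner_comm]
      exact ((isPositive_opSqrt hR).inner_left_eq_inner_right _ _).symm
    rw [h2, ← h1]
    refine integral_congr_ae (ae_of_all _ fun z => ?_)
    simp only [Complex.real_smul]
    rw [mul_comm]
  rw [← integral_map (φ := fun z => z + opSqrt R h) (by fun_prop) hψ.aestronglyMeasurable, hmeas,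
    hdi]
  simp_rw [smul_eq_mul, mul_comm]

/-- First order Taylor expansion of a Gaussian average in a Cameron-Martin direction. -/
theorem abs_integral_translate_sub_le (hR : R.IsPositive)
    (hG : IsCenteredGaussian (centeredGaussian R) R) (H : IsGaussianFunctional R h ξ)
    (hh : ‖h‖ ≤ 1) {ψ : E → ℝ} (hψ : Measurable ψ) {M : ℝ} (hM : ∀ z, |ψ z| ≤ M) :
    |∫ z, ψ (z + opSqrt R h) ∂centeredGaussian R - ∫ z, ψ z ∂centeredGaussian R -
      ∫ z, ψ z * ξ z ∂centeredGaussian R| ≤ M * ‖h‖ ^ 2 := by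
  have := hG.isProbabilityMeasure
  have hM0 : 0 ≤ M := (abs_nonneg _).trans (hM 0)
  obtain ⟨hL2, hI⟩ := integral_exp_sub_one_sub_sq H.1.aestronglyMeasurable.aemeasurable
    (H.map_eq hR hG)
  simp only [NNReal.coe_pow, coe_nnnorm] at hL2 hI
  have hb : ∀ {g : E → ℝ}, Integrable g (centeredGaussian R) →
      Integrable (fun z => ψ z * g z) (centeredGaussian R) := fun hg =>
    hg.bdd_mul hψ.aestronglyMeasurable (ae_of_all _ fun z => by
      rw [Real.norm_eq_abs]; exact hM z)
  have hξi : Integrable ξ (centeredGaussian R) := H.1.integrable (by norm_num)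
  have hri := hL2.integrable (by norm_num)
  have hei : Integrable (fun z => Real.exp (ξ z - ‖h‖ ^ 2 / 2)) (centeredGaussian R) := by
    refine ((hri.add hξi).add (integrable_const 1)).congr (ae_of_all _ fun z => ?_)
    simp only [Pi.add_apply]
    ring
  have hψi : Integrable ψ (centeredGaussian R) := by
    simpa using hb (integrable_const (1 : ℝ))
  have h1 : ∫ z, ψ (z + opSqrt R h) ∂centeredGaussian R - ∫ z, ψ z ∂centeredGaussian R -
      ∫ z, ψ z * ξ z ∂centeredGaussian R =
      ∫ z, ψ z * (Real.exp (ξ z - ‖h‖ ^ 2 / 2) - 1 - ξ z) ∂centeredGaussian R := by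
    have h2 : Integrable (fun z => ψ z * Real.exp (ξ z - ‖h‖ ^ 2 / 2) - ψ z)
        (centeredGaussian R) := (hb hei).sub hψi
    rw [H.integral_translate hR hG hψ, ← integral_sub (hb hei) hψi, ← integral_sub h2 (hb hξi)]
    refine integral_congr_ae (ae_of_all _ fun z => ?_)
    simp only
    ring
  rw [h1]
  have h2 : |∫ z, ψ z * (Real.exp (ξ z - ‖h‖ ^ 2 / 2) - 1 - ξ z) ∂centeredGaussian R| ≤
      ∫ z, M * |Real.exp (ξ z - ‖h‖ ^ 2 / 2) - 1 - ξ z| ∂centeredGaussian R := by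
    refine abs_integral_le_integral_abs.trans (integral_mono (hb hri).abs
      (hri.abs.const_mul M) fun z => ?_)
    simp only [abs_mul]
    exact mul_le_mul_of_nonneg_right (hM z) (abs_nonneg _)
  refine h2.trans ?_
  rw [integral_const_mul]
  refine mul_le_mul_of_nonneg_left ((integral_abs_le_sqrt hL2).trans ?_) hM0
  rw [hI]
  have h3 := exp_sub_one_sub_le_sq (sq_nonneg ‖h‖) (pow_le_one₀ (norm_nonneg h) hh)
  exact Real.sqrt_le_iff.2 ⟨sq_nonneg _, h3⟩

theorem abs_integral_mul_le (hR : R.IsPositive)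
    (hG : IsCenteredGaussian (centeredGaussian R) R) (H : IsGaussianFunctional R h ξ)
    {ψ : E → ℝ} (hψ : MemLp ψ 2 (centeredGaussian R)) :
    |∫ z, ψ z * ξ z ∂centeredGaussian R| ≤ √(∫ z, ψ z ^ 2 ∂centeredGaussian R) * ‖h‖ := by
  have h1 := abs_integral_mul_le_sqrt hψ H.1
  rwa [H.integral_sq hR hG, Real.sqrt_sq (norm_nonneg _)] at h1

end IsGaussianFunctional

/-! ### Differentiability of Gaussian averages -/

section CDerivative
variable {K X : Type*} [NormedAddCommGroup K] [InnerProductSpace ℝ K] [CompleteSpace K]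
  [NormedAddCommGroup X] [NormedSpace ℝ X] {C : K →L[ℝ] X}

theorem HasCFDerivAt.unique {f : X → ℝ} {L L' : K →L[ℝ] ℝ} {x : X} (h : HasCFDerivAt C f L x)
    (h' : HasCFDerivAt C f L' x) : L = L' :=
  ContinuousLinearMap.ext fun k => tendsto_nhds_unique (h.1 k) (h'.1 k)

theorem HasCFDerivAt.inner_cGrad {f : X → ℝ} {L : K →L[ℝ] ℝ} {x : X} (h : HasCFDerivAt C f L x)
    (k : K) : ⟪cGrad C f x, k⟫ = L k := by
  have hex : CFDifferentiableAt C f x := ⟨L, h⟩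
  rw [cGrad, dif_pos hex, InnerProductSpace.toDual_symm_apply, hex.choose_spec.unique h]

/-- Averages against `𝒩(0, R)` are Fréchet differentiable in the directions of the range of
`R^{1/2}`; the derivative is the average against the Gaussian functional of the direction. -/
theorem exists_hasCFDerivAt (hR : R.IsPositive) (hG : IsCenteredGaussian (centeredGaussian R) R)
    {Λ : K →L[ℝ] E} (hΛ : ∀ k, Λ k ∈ ((opSqrt R).ker)ᗮ) {ψ : E → ℝ} (hψ : Measurable ψ) {M : ℝ}
    (hM : ∀ z, |ψ z| ≤ M) {f : X → ℝ} {x : X} {e : E}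
    (hf : ∀ (s : ℝ) k, f (x + s • C k) =
      ∫ z, ψ (z + e + s • opSqrt R (Λ k)) ∂centeredGaussian R) :
    ∃ L : K →L[ℝ] ℝ, HasCFDerivAt C f L x ∧ (∀ k, |L k| ≤ M * ‖Λ k‖) ∧
      ∀ k ξ, IsGaussianFunctional R (Λ k) ξ →
        L k = ∫ z, ψ (z + e) * ξ z ∂centeredGaussian R := by
  have := hG.isProbabilityMeasure
  have hM0 : 0 ≤ M := (abs_nonneg _).trans (hM 0)
  choose ξ hξ using fun k => exists_isGaussianFunctional hR hG (mem_closure_range_opSqrt hR (hΛ k))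
  have hψe : Measurable fun z => ψ (z + e) := hψ.comp (measurable_id.add_const e)
  have hL2 : MemLp (fun z => ψ (z + e)) 2 (centeredGaussian R) :=
    MemLp.of_bound hψe.aestronglyMeasurable M (ae_of_all _ fun z => by
      rw [Real.norm_eq_abs]; exact hM _)
  have hint : ∀ k, Integrable (fun z => ψ (z + e) * ξ k z) (centeredGaussian R) := fun k =>
    hL2.integrable_mul (hξ k).1
  have hbd : ∀ k, |∫ z, ψ (z + e) * ξ k z ∂centeredGaussian R| ≤ M * ‖Λ k‖ := fun k => by
    refine ((hξ k).abs_integral_mul_le hR hG hL2).trans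
      (mul_le_mul_of_nonneg_right ?_ (norm_nonneg _))
    refine Real.sqrt_le_iff.2 ⟨hM0, ?_⟩
    calc ∫ z, ψ (z + e) ^ 2 ∂centeredGaussian R ≤ ∫ _, M ^ 2 ∂centeredGaussian R :=
          integral_mono hL2.integrable_sq (integrable_const _) fun z =>
            sq_le_sq' (abs_le.1 (hM _)).1 (abs_le.1 (hM _)).2
      _ = M ^ 2 := by simp
  have hae : ∀ k ξ', IsGaussianFunctional R (Λ k) ξ' →
      ∫ z, ψ (z + e) * ξ k z ∂centeredGaussian R = ∫ z, ψ (z + e) * ξ' z ∂centeredGaussian R :=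
    fun k ξ' h' => integral_congr_ae (by
      filter_upwards [(hξ k).ae_eq hR hG h'] with z hz
      rw [hz])
  let L : K →L[ℝ] ℝ := LinearMap.mkContinuous
    { toFun := fun k => ∫ z, ψ (z + e) * ξ k z ∂centeredGaussian R
      map_add' := fun k l => by
        have h1 := (hξ k).add hG (hξ l)
        rw [← map_add] at h1
        rw [hae _ _ h1, ← integral_add (hint k) (hint l)]
        simp_rw [mul_add]
      map_smul' := fun c k => by
        have h1 := (hξ k).const_smul c
        rw [← map_smul] at h1
        rw [hae _ _ h1, RingHom.id_apply, smul_eq_mul, ← integral_const_mul]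
        simp_rw [mul_left_comm] }
    (M * ‖Λ‖) (fun k => by
      rw [mul_assoc]
      exact (hbd k).trans (mul_le_mul_of_nonneg_left (Λ.le_opNorm k) hM0))
  have hL : ∀ k, L k = ∫ z, ψ (z + e) * ξ k z ∂centeredGaussian R := fun k => rfl
  -- the difference quotient is estimated by the Taylor expansion in the direction `s • Λ k`
  have hest : ∀ k (s : ℝ), s ≠ 0 → |s| * ‖Λ k‖ ≤ 1 →
      |(f (x + s • C k) - f x) / s - L k| ≤ |s| * (M * ‖Λ k‖ ^ 2) := fun k s hs hsk => by
    have h1 := ((hξ k).const_smul s).abs_integral_translate_sub_le hR hG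
      (by rwa [norm_smul, Real.norm_eq_abs]) hψe (fun z => hM (z + e))
    have hs0 : 0 < |s| := abs_pos.2 hs
    have h2 : f x = ∫ z, ψ (z + e) ∂centeredGaussian R := by
      have := hf 0 k
      simpa using this
    have h3 : f (x + s • C k) =
        ∫ z, ψ (z + opSqrt R (s • Λ k) + e) ∂centeredGaussian R := by
      rw [hf, map_smul]
      simp_rw [add_right_comm]
    have h4 : ∫ z, ψ (z + e) * (s * ξ k z) ∂centeredGaussian R = s * L k := by
      rw [hL, ← integral_const_mul]
      simp_rw [mul_left_comm]
    rw [h4, ← h2, ← h3, norm_smul, Real.norm_eq_abs] at h1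
    have h5 : (f (x + s • C k) - f x) / s - L k = (f (x + s • C k) - f x - s * L k) / s := by
      field_simp
    rw [h5, abs_div, div_le_iff₀ hs0]
    refine h1.trans (le_of_eq ?_)
    ring
  have hnhds : ∀ δ : ℝ, 0 < δ → ∀ᶠ s : ℝ in 𝓝[≠] 0, s ≠ 0 ∧ |s| < δ := fun δ hδ => by
    filter_upwards [self_mem_nhdsWithin, mem_nhdsWithin_of_mem_nhds (Metric.ball_mem_nhds 0 hδ)]
      with s h1 h2
    exact ⟨h1, by simpa using h2⟩
  have hunif : ∀ c : ℝ, 0 ≤ c → ∀ ε : ℝ, 0 < ε → ∀ᶠ s : ℝ in 𝓝[≠] 0, ∀ k, ‖Λ k‖ ≤ c →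
      dist (L k) ((f (x + s • C k) - f x) / s) < ε := fun c hc ε hε => by
    have hD : 0 < c + M * c ^ 2 / ε + 1 := by positivity
    filter_upwards [hnhds (c + M * c ^ 2 / ε + 1)⁻¹ (inv_pos.2 hD)] with s hs k hk
    have h1 : |s| * (c + M * c ^ 2 / ε + 1) < 1 := by
      have h := mul_lt_mul_of_pos_right hs.2 hD
      rwa [inv_mul_cancel₀ hD.ne'] at h
    have hs0 := abs_nonneg s
    have h2 : |s| * c ≤ 1 := by
      have : 0 ≤ |s| * (M * c ^ 2 / ε) := by positivity
      nlinarith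
    have h3 : |s| * (M * c ^ 2) < ε := by
      have : |s| * (M * c ^ 2 / ε) < 1 := by
        have : 0 ≤ |s| * c := by positivity
        nlinarith
      have h4 := mul_lt_mul_of_pos_right this hε
      rwa [one_mul, mul_assoc, div_mul_cancel₀ _ hε.ne'] at h4
    rw [dist_comm, Real.dist_eq]
    refine lt_of_le_of_lt (hest k s hs.1 ((mul_le_mul_of_nonneg_left hk hs0).trans h2))
      (lt_of_le_of_lt ?_ h3)
    gcongr
  refine ⟨L, ⟨fun k => ?_, ?_⟩, hbd, fun k ξ' h' => hae k ξ' h'⟩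
  · refine Metric.tendsto_nhds.2 fun ε hε => ?_
    filter_upwards [hunif ‖Λ k‖ (norm_nonneg _) ε hε] with s hs
    rw [dist_comm]
    exact hs k le_rfl
  · refine Metric.tendstoUniformlyOn_iff.2 fun ε hε => ?_
    filter_upwards [hunif ‖Λ‖ (norm_nonneg _) ε hε] with s hs k hk
    refine hs k ((Λ.le_opNorm k).trans ?_)
    exact mul_le_of_le_one_right (norm_nonneg _) (by simpa using hk)

end CDerivative
end Functional

/-! ### The covariance operators `Q_t` -/

section GramianProperties
variable {H Ξ : Type*} [NormedAddCommGroup H] [InnerProductSpace ℝ H] [CompleteSpace H]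
  [TopologicalSpace.SeparableSpace H] [NormedAddCommGroup Ξ] [InnerProductSpace ℝ Ξ]
  [CompleteSpace Ξ] [TopologicalSpace.SeparableSpace Ξ] (S : C0Semigroup H) (G : Ξ →L[ℝ] H)

theorem gramian_apply (t : ℝ) (x : H) :
    gramian S G t x = ∫ s in Ioc 0 t, gramianIntegrand S G s x := rfl

theorem inner_gramianIntegrand (s : ℝ) (x y : H) :
    ⟪gramianIntegrand S G s x, y⟫ = ⟪(G†) (((S s)†) x), (G†) (((S s)†) y)⟫ := by
  rw [ContinuousLinearMap.adjoint_inner_right, ContinuousLinearMap.adjoint_inner_right]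
  rfl

theorem inner_gramian (t : ℝ) (x y : H) :
    ⟪gramian S G t x, y⟫ = ∫ s in Ioc 0 t, ⟪(G†) (((S s)†) x), (G†) (((S s)†) y)⟫ := by
  rw [gramian_apply, real_inner_comm, ← integral_inner (integrableOn_gramianIntegrand S G t x)]
  refine integral_congr_ae (ae_of_all _ fun s => ?_)
  simp only
  rw [real_inner_comm, inner_gramianIntegrand]

theorem inner_gramian_self (t : ℝ) (x : H) :
    ⟪gramian S G t x, x⟫ = ∫ s in Ioc 0 t, ‖(G†) (((S s)†) x)‖ ^ 2 := by
  simp_rw [inner_gramian, real_inner_self_eq_norm_sq]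

theorem integrableOn_norm_adjoint_sq (t : ℝ) (x : H) :
    IntegrableOn (fun s => ‖(G†) (((S s)†) x)‖ ^ 2) (Ioc 0 t) := by
  refine ((integrableOn_gramianIntegrand S G t x).const_inner x).congr (ae_of_all _ fun s => ?_)
  simp only
  rw [real_inner_comm, inner_gramianIntegrand, real_inner_self_eq_norm_sq]

theorem gramian_isSymmetric (t : ℝ) : (gramian S G t).IsSymmetric := fun x y => by
  have h := inner_gramian S G t x y
  have h' := inner_gramian S G t y x
  rw [ContinuousLinearMap.coe_coe, h, ← real_inner_comm, h']
  refine integral_congr_ae (ae_of_all _ fun s => ?_)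
  simp only
  rw [real_inner_comm]

theorem gramian_of_nonpos {t : ℝ} (ht : t ≤ 0) : gramian S G t = 0 := by
  refine ContinuousLinearMap.ext fun x => ?_
  rw [gramian_apply, Ioc_eq_empty (not_lt.2 ht)]
  simp

theorem gramian_max_zero (t : ℝ) : gramian S G (max t 0) = gramian S G t := by
  rcases le_total t 0 with h | h
  · rw [max_eq_right h, gramian_of_nonpos S G h, gramian_of_nonpos S G le_rfl]
  · rw [max_eq_left h]

theorem gramian_sub_isPositive {s t : ℝ} (h : s ≤ t) :
    (gramian S G t - gramian S G s).IsPositive := by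
  refine (ContinuousLinearMap.isPositive_iff _).2 ⟨?_, fun x => ?_⟩
  · exact (gramian_isSymmetric S G t).sub (gramian_isSymmetric S G s)
  · rw [_root_.sub_apply, inner_sub_left, sub_nonneg, inner_gramian_self, inner_gramian_self]
    exact setIntegral_mono_set (integrableOn_norm_adjoint_sq S G t x)
      (ae_of_all _ fun _ => sq_nonneg _) (Ioc_subset_Ioc_right h).eventuallyLE

theorem gramian_isPositive (t : ℝ) : (gramian S G t).IsPositive := by
  rw [← gramian_max_zero]
  have := gramian_sub_isPositive S G (le_max_right t 0)
  rwa [gramian_of_nonpos S G le_rfl, sub_zero] at this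

theorem continuous_inner_gramian (x : H) : Continuous fun t => ⟪gramian S G t x, x⟫ := by
  have h1 : ∀ T, ContinuousOn (fun t => ⟪gramian S G t x, x⟫) (Icc 0 T) := fun T => by
    simp_rw [inner_gramian_self]
    refine intervalIntegral.continuousOn_primitive ?_
    exact (integrableOn_Icc_iff_integrableOn_Ioc).2 (integrableOn_norm_adjoint_sq S G T x)
  have h2 : ContinuousOn (fun t => ⟪gramian S G t x, x⟫) (Ici 0) := fun t ht => by
    refine ((h1 (t + 1)) t ⟨ht, by linarith⟩).mono_of_mem_nhdsWithin ?_
    exact mem_nhdsWithin.2 ⟨Iio (t + 1), isOpen_Iio, by simp, fun u hu => ⟨hu.2, hu.1.le⟩⟩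
  have h3 : (fun t => ⟪gramian S G t x, x⟫) = fun t => ⟪gramian S G (max t 0) x, x⟫ := by
    simp_rw [gramian_max_zero]
  rw [h3]
  exact h2.comp_continuous (by fun_prop) fun t => le_max_right t 0

/-- `Q_{r+s} = Q_r + S(r) Q_s S(r)*`, on the level of quadratic forms. -/
theorem inner_gramian_add {r s : ℝ} (hr : 0 ≤ r) (hs : 0 ≤ s) (x : H) :
    ⟪gramian S G (r + s) x, x⟫ =
      ⟪gramian S G r x, x⟫ + ⟪gramian S G s (((S r)†) x), ((S r)†) x⟫ := by
  have hq : ∀ y : H, ∀ a b, 0 ≤ a → 0 ≤ b → IntervalIntegrable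
      (fun u => ‖(G†) (((S u)†) y)‖ ^ 2) volume a b := fun y a b ha hb => by
    have h0 : ∀ c, 0 ≤ c → IntervalIntegrable (fun u => ‖(G†) (((S u)†) y)‖ ^ 2) volume 0 c :=
      fun c hc => (intervalIntegrable_iff_integrableOn_Ioc_of_le hc).2
        (integrableOn_norm_adjoint_sq S G c y)
    exact (h0 a ha).symm.trans (h0 b hb)
  simp_rw [inner_gramian_self]
  rw [← intervalIntegral.integral_of_le (add_nonneg hr hs), ← intervalIntegral.integral_of_le hr,
    ← intervalIntegral.integral_of_le hs,
    ← intervalIntegral.integral_add_adjacent_intervals (hq x 0 r le_rfl hr)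
      (hq x r (r + s) hr (add_nonneg hr hs))]
  congr 1
  have h1 := intervalIntegral.integral_comp_add_left (a := 0) (b := s)
    (fun u => ‖(G†) (((S u)†) x)‖ ^ 2) r
  rw [add_zero] at h1
  rw [← h1]
  refine intervalIntegral.integral_congr fun u hu => ?_
  rw [uIcc_of_le hs] at hu
  rw [S.map_add r u hr hu.1, ContinuousLinearMap.adjoint_comp]
  rfl

variable [MeasurableSpace H] [BorelSpace H]

theorem isCenteredGaussian_gramian (hT : ∀ t, 0 < t → IsTraceClassPos (gramian S G t)) (t : ℝ) :
    IsCenteredGaussian (centeredGaussian (gramian S G t)) (gramian S G t) := by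
  rcases le_or_gt t 0 with h | h
  · rw [gramian_of_nonpos S G h, (isCenteredGaussian_dirac_zero).centeredGaussian_eq]
    exact isCenteredGaussian_dirac_zero
  · exact (hT t h).isCenteredGaussian

theorem centeredGaussian_gramian_of_nonpos {t : ℝ} (ht : t ≤ 0) :
    centeredGaussian (gramian S G t) = Measure.dirac 0 := by
  rw [gramian_of_nonpos S G ht, (isCenteredGaussian_dirac_zero).centeredGaussian_eq]

/-- `𝒩(0, Q_{r+s})` is the law of `w + S(r) z` for independent `w ∼ 𝒩(0, Q_r)`, `z ∼ 𝒩(0, Q_s)`. -/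
theorem centeredGaussian_gramian_add (hT : ∀ t, 0 < t → IsTraceClassPos (gramian S G t))
    {r s : ℝ} (hr : 0 ≤ r) (hs : 0 ≤ s) :
    centeredGaussian (gramian S G (r + s)) =
      (centeredGaussian (gramian S G r)).conv ((centeredGaussian (gramian S G s)).map (S r)) := by
  have h1 := (isCenteredGaussian_gramian S G hT r).conv
    ((isCenteredGaussian_gramian S G hT s).map (S r))
  refine (h1.congr (R' := gramian S G (r + s)) fun x => ?_).centeredGaussian_eq
  rw [inner_gramian_add S G hr hs, _root_.add_apply, inner_add_left,
    ContinuousLinearMap.adjoint_inner_right]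
  rfl

/-- The increment `Q_t - Q_s` is the covariance of a Gaussian measure whose second moment is the
increment of the continuous trace function. -/
theorem exists_gaussian_increment (hT : ∀ t, 0 < t → IsTraceClassPos (gramian S G t)) {T : ℝ}
    (hT0 : 0 < T) : ∃ τ : ℝ → ℝ, ContinuousOn τ (Iic T) ∧ ∀ s t, s ≤ t → t ≤ T →
      ∃ l : Measure H, IsProbabilityMeasure l ∧ centeredGaussian (gramian S G t) =
        (centeredGaussian (gramian S G s)).conv l ∧
        ∫⁻ z, ENNReal.ofReal (‖z‖ ^ 2) ∂l = ENNReal.ofReal (τ t - τ s) := by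
  obtain ⟨-, w, b, hb⟩ := hT T hT0
  have hw : Countable w := b.countable
  have hle : ∀ s t, s ≤ t → ∀ i, ⟪gramian S G s (b i), b i⟫ ≤ ⟪gramian S G t (b i), b i⟫ :=
    fun s t hst i => by
      have := (gramian_sub_isPositive S G hst).inner_nonneg_left (b i)
      rwa [_root_.sub_apply, inner_sub_left, sub_nonneg] at this
  have hnn : ∀ t i, 0 ≤ ⟪gramian S G t (b i), b i⟫ := fun t i =>
    (gramian_isPositive S G t).inner_nonneg_left (b i)
  have hsum : ∀ t, t ≤ T → Summable fun i => ⟪gramian S G t (b i), b i⟫ := fun t ht =>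
    Summable.of_nonneg_of_le (hnn t) (hle t T ht) hb
  refine ⟨fun t => ∑' i, ⟪gramian S G t (b i), b i⟫, ?_, fun s t hst htT => ?_⟩
  · refine continuousOn_tsum (fun i => (continuous_inner_gramian S G (b i)).continuousOn) hb
      fun i t ht => ?_
    rw [Real.norm_of_nonneg (hnn t i)]
    exact hle t T ht i
  · have hs := (hsum t htT).sub (hsum s (hst.trans htT))
    have htc : IsTraceClassPos (gramian S G t - gramian S G s) :=
      ⟨gramian_sub_isPositive S G hst, w, b, by
        simpa only [_root_.sub_apply, inner_sub_left] using hs⟩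
    have hg := htc.isCenteredGaussian
    refine ⟨_, hg.isProbabilityMeasure, ?_, ?_⟩
    · have h1 := (isCenteredGaussian_gramian S G hT s).conv hg
      rw [add_sub_cancel] at h1
      exact h1.centeredGaussian_eq
    · rw [hg.lintegral_norm_sq b, ← (hsum t htT).tsum_sub (hsum s (hst.trans htT)),
        ENNReal.ofReal_tsum_of_nonneg (fun i => sub_nonneg.2 (hle s t hst i)) hs]
      simp only [_root_.sub_apply, inner_sub_left]

theorem integral_norm_le_sqrt_of_lintegral_sq {l : Measure H} [IsProbabilityMeasure l] {c : ℝ}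
    (hc : 0 ≤ c) (h : ∫⁻ z, ENNReal.ofReal (‖z‖ ^ 2) ∂l = ENNReal.ofReal c) :
    Integrable (fun z => ‖z‖) l ∧ ∫ z, ‖z‖ ∂l ≤ √c := by
  have : SecondCountableTopology H := UniformSpace.secondCountable_of_separable H
  have hi : Integrable (fun z : H => ‖z‖ ^ 2) l := by
    refine ⟨by fun_prop, ?_⟩
    rw [hasFiniteIntegral_iff_ofReal (ae_of_all _ fun _ => sq_nonneg _), h]
    exact ENNReal.ofReal_lt_top
  have hL2 : MemLp (fun z : H => ‖z‖) 2 l := (memLp_two_iff_integrable_sq (by fun_prop)).2 hi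
  refine ⟨hL2.integrable (by norm_num), ?_⟩
  have h1 := integral_abs_le_sqrt hL2
  simp only [abs_norm] at h1
  have h2 : ∫ z, ‖z‖ ^ 2 ∂l = c := by
    rw [integral_eq_lintegral_of_nonneg_ae (ae_of_all _ fun _ => sq_nonneg _) (by fun_prop), h,
      ENNReal.toReal_ofReal hc]
  rwa [h2] at h1

theorem abs_integral_le_of_abs_le_const {α : Type*} [MeasurableSpace α] {m : Measure α}
    [IsProbabilityMeasure m] {f : α → ℝ} {c : ℝ} (h : ∀ z, |f z| ≤ c) : |∫ z, f z ∂m| ≤ c := by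
  have := norm_integral_le_of_norm_le_const (μ := m) (f := f) (ae_of_all _ h)
  rwa [probReal_univ, mul_one] at this

/-- Averages against `𝒩(0, Q_t)` depend continuously on `t` and on the translation. For Lipschitz
functions this follows from the second moment of the increment; bounded continuous functions are
reached by the Portmanteau theorem. -/
theorem continuous_integral_gramian (hT : ∀ t, 0 < t → IsTraceClassPos (gramian S G t))
    {Y : Type*} [NormedAddCommGroup Y] [NormedSpace ℝ Y] (J : H →L[ℝ] Y) {Φ : Y → ℝ}
    (hΦ : Continuous Φ) {M : ℝ} (hM : ∀ y, |Φ y| ≤ M) :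
    Continuous fun p : ℝ × Y => ∫ z, Φ (J z + p.2) ∂centeredGaussian (gramian S G p.1) := by
  have : SecondCountableTopology H := UniformSpace.secondCountable_of_separable H
  borelize Y
  have hprob : ∀ t, IsProbabilityMeasure (centeredGaussian (gramian S G t)) := fun t =>
    (isCenteredGaussian_gramian S G hT t).isProbabilityMeasure
  have hcont : ∀ y, Continuous fun z => J z + y := fun y => by fun_prop
  let ν : ℝ × Y → ProbabilityMeasure Y := fun p =>
    ⟨(centeredGaussian (gramian S G p.1)).map (fun z => J z + p.2),
      Measure.isProbabilityMeasure_map (hcont p.2).measurable.aemeasurable⟩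
  have hν : ∀ (p : ℝ × Y) (f : Y → ℝ), Continuous f → ∫ y, f y ∂(ν p : Measure Y) =
      ∫ z, f (J z + p.2) ∂centeredGaussian (gramian S G p.1) := fun p f hf => by
    exact integral_map_of_stronglyMeasurable (hcont p.2).measurable hf.measurable.stronglyMeasurable
  have hlip : ∀ (f : Y → ℝ) (B : ℝ), (∀ y, |f y| ≤ B) → ∀ L : ℝ≥0, LipschitzWith L f →
      Continuous fun p : ℝ × Y => ∫ z, f (J z + p.2) ∂centeredGaussian (gramian S G p.1) := by
    intro f B hB L hL
    have hint : ∀ (m : Measure H) [IsProbabilityMeasure m] (y : Y),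
        Integrable (fun z => f (J z + y)) m := fun m _ y =>
      Integrable.of_bound (hL.continuous.comp (hcont y)).aestronglyMeasurable B
        (ae_of_all _ fun z => hB _)
    have hest0 : ∀ x y, |f x - f y| ≤ L * ‖x - y‖ := fun x y => by
      have := hL.dist_le_mul x y
      rwa [Real.dist_eq, dist_eq_norm] at this
    rw [continuous_iff_continuousAt]
    intro p₀
    obtain ⟨τ, hτ, hinc⟩ := exists_gaussian_increment S G hT
      (T := max (p₀.1 + 1) 1) (lt_max_of_lt_right one_pos)
    -- `𝒩(0, Q_t)` is the law of `z + w` with `z ∼ 𝒩(0, Q_s)` and an independent small `w`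
    have hinc' : ∀ s t, s ≤ t → t ≤ max (p₀.1 + 1) 1 → ∀ y,
        |∫ z, f (J z + y) ∂centeredGaussian (gramian S G t) -
          ∫ z, f (J z + y) ∂centeredGaussian (gramian S G s)| ≤ L * (‖J‖ * √|τ t - τ s|) := by
      intro s t hst ht y
      obtain ⟨l, hl, hconv, hmom⟩ := hinc s t hst ht
      have hmom2 : ∫⁻ z, ENNReal.ofReal (‖z‖ ^ 2) ∂l = ENNReal.ofReal (max (τ t - τ s) 0) := by
        rw [hmom, ENNReal.ofReal_max, ENNReal.ofReal_zero, max_eq_left zero_le]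
      obtain ⟨hi, hb⟩ := integral_norm_le_sqrt_of_lintegral_sq (le_max_right _ _) hmom2
      have hb' : ∫ z, ‖z‖ ∂l ≤ √|τ t - τ s| :=
        hb.trans (Real.sqrt_le_sqrt (max_le (le_abs_self _) (abs_nonneg _)))
      have h1 : ∫ z, f (J z + y) ∂centeredGaussian (gramian S G t) =
          ∫ z, ∫ w, f (J (z + w) + y) ∂l ∂centeredGaussian (gramian S G s) := by
        rw [hconv]
        exact integral_conv (by rw [← hconv]; exact hint _ y)
      have hint2 : Integrable (fun z => ∫ w, f (J (z + w) + y) ∂l)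
          (centeredGaussian (gramian S G s)) := by
        have h2 : Integrable (fun p : H × H => f (J (p.1 + p.2) + y))
            ((centeredGaussian (gramian S G s)).prod l) :=
          Integrable.of_bound (hL.continuous.comp
            (by fun_prop : Continuous fun p : H × H => J (p.1 + p.2) + y)).aestronglyMeasurable B
            (ae_of_all _ fun z => hB _)
        exact h2.integral_prod_left
      rw [h1, ← integral_sub hint2 (hint _ y)]
      refine (abs_integral_le_of_abs_le_const (c := L * (‖J‖ * √|τ t - τ s|))
        fun z => ?_)
      have h3 : ∫ w, f (J (z + w) + y) ∂l - f (J z + y) =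
          ∫ w, (f (J w + (J z + y)) - f (J z + y)) ∂l := by
        rw [integral_sub (hint l _) (integrable_const _), integral_const, probReal_univ, one_smul]
        congr 1
        refine integral_congr_ae (ae_of_all _ fun w => ?_)
        simp only [map_add]
        congr 1
        abel
      rw [h3, ← Real.norm_eq_abs]
      refine (norm_integral_le_of_norm_le (hi.const_mul (L * ‖J‖))
        (ae_of_all _ fun w => ?_)).trans ?_
      · rw [Real.norm_eq_abs]
        refine (hest0 _ _).trans ?_
        rw [add_sub_cancel_right, mul_assoc]
        exact mul_le_mul_of_nonneg_left (J.le_opNorm w) L.2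
      · rw [integral_const_mul, mul_assoc]
        gcongr
    have hsym : ∀ s t, s ≤ max (p₀.1 + 1) 1 → t ≤ max (p₀.1 + 1) 1 → ∀ y,
        |∫ z, f (J z + y) ∂centeredGaussian (gramian S G t) -
          ∫ z, f (J z + y) ∂centeredGaussian (gramian S G s)| ≤ L * (‖J‖ * √|τ t - τ s|) := by
      intro s t hs ht y
      rcases le_total s t with h | h
      · exact hinc' s t h ht y
      · rw [abs_sub_comm, abs_sub_comm (τ t)]
        exact hinc' t s h hs y
    have hbound : ∀ᶠ p : ℝ × Y in 𝓝 p₀,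
        |∫ z, f (J z + p.2) ∂centeredGaussian (gramian S G p.1) -
          ∫ z, f (J z + p₀.2) ∂centeredGaussian (gramian S G p₀.1)| ≤
          L * ‖p.2 - p₀.2‖ + L * (‖J‖ * √|τ p.1 - τ p₀.1|) := by
      have h1 : ∀ᶠ p : ℝ × Y in 𝓝 p₀, p.1 < p₀.1 + 1 :=
        continuous_fst.continuousAt.eventually_lt continuousAt_const (by linarith)
      filter_upwards [h1] with p hp
      have h2 := hsym p₀.1 p.1 (le_max_of_le_left (by linarith)) (le_max_of_le_left hp.le) p₀.2
      have h3 : |∫ z, f (J z + p.2) ∂centeredGaussian (gramian S G p.1) -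
          ∫ z, f (J z + p₀.2) ∂centeredGaussian (gramian S G p.1)| ≤ L * ‖p.2 - p₀.2‖ := by
        rw [← integral_sub (hint _ _) (hint _ _)]
        refine (abs_integral_le_of_abs_le_const (c := L * ‖p.2 - p₀.2‖)
          fun z => ?_)
        have := hest0 (J z + p.2) (J z + p₀.2)
        rwa [add_sub_add_left_eq_sub] at this
      exact (abs_sub_le _ _ _).trans (add_le_add h3 h2)
    have hτc : ContinuousAt τ p₀.1 := (hτ p₀.1
      (mem_Iic.2 (le_max_of_le_left (by linarith)))).continuousAt
      (Iic_mem_nhds (lt_max_of_lt_left (by linarith : p₀.1 < p₀.1 + 1)))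
    have hlim : Tendsto (fun p : ℝ × Y => L * ‖p.2 - p₀.2‖ + L * (‖J‖ * √|τ p.1 - τ p₀.1|))
        (𝓝 p₀) (𝓝 0) := by
      have h1 : ContinuousAt (fun p : ℝ × Y => τ p.1) p₀ :=
        ContinuousAt.comp (f := Prod.fst) hτc continuousAt_fst
      have h2 : ContinuousAt (fun p : ℝ × Y => L * ‖p.2 - p₀.2‖ + L * (‖J‖ * √|τ p.1 - τ p₀.1|))
          p₀ := by fun_prop
      have h3 := h2.tendsto
      simpa using h3
    rw [ContinuousAt, tendsto_iff_dist_tendsto_zero]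
    exact squeeze_zero' (Eventually.of_forall fun _ => dist_nonneg) hbound hlim
  rw [continuous_iff_continuousAt]
  intro p₀
  have hw : Tendsto ν (𝓝 p₀) (𝓝 (ν p₀)) := by
    rw [tendsto_iff_forall_lipschitz_integral_tendsto]
    rintro f ⟨B, hB⟩ ⟨L, hL⟩
    have hB' : ∀ y, |f y| ≤ B + |f 0| := fun y => by
      have h1 := hB y 0
      rw [Real.dist_eq] at h1
      have := abs_sub_abs_le_abs_sub (f y) (f 0)
      linarith
    simp_rw [hν _ f hL.continuous]
    exact (hlip f _ hB' L hL).continuousAt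
  rw [ProbabilityMeasure.tendsto_iff_forall_integral_tendsto] at hw
  have h1 := hw (BoundedContinuousFunction.ofNormedAddCommGroup Φ hΦ M hM)
  simp only [BoundedContinuousFunction.coe_ofNormedAddCommGroup] at h1
  simp_rw [hν _ Φ hΦ] at h1
  exact h1

end GramianProperties

/-! ### The law of the stochastic convolution -/

section AdjointSemigroup
variable {H : Type*} [NormedAddCommGroup H] [InnerProductSpace ℝ H] [CompleteSpace H]
  [TopologicalSpace.SeparableSpace H] (S : C0Semigroup H)

theorem integrableOn_adjoint_apply (t : ℝ) (x : H) :
    IntegrableOn (fun s => ((S s)†) x) (Ioc 0 t) := by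
  obtain ⟨M, hM0, hM⟩ := S.exists_bound t
  refine IntegrableOn.of_bound (C := M * ‖x‖) (by simp) ?_ ?_
  · refine aestronglyMeasurable_of_inner fun y => ?_
    simp_rw [ContinuousLinearMap.adjoint_inner_right]
    exact (((S.continuousOn y).mono (Ioc_subset_Icc_self.trans Icc_subset_Ici_self)).inner
      continuousOn_const).aestronglyMeasurable measurableSet_Ioc
  · refine (ae_restrict_iff' measurableSet_Ioc).2 (ae_of_all _ fun s hs => ?_)
    refine (ContinuousLinearMap.le_opNorm _ x).trans ?_
    rw [LinearIsometryEquiv.norm_map]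
    exact mul_le_mul_of_nonneg_right (hM s (Ioc_subset_Icc_self hs)) (norm_nonneg _)

theorem adjoint_map_add {r s : ℝ} (hr : 0 ≤ r) (hs : 0 ≤ s) (x : H) :
    ((S (r + s))†) x = ((S r)†) (((S s)†) x) := by
  rw [add_comm, S.map_add s r hs hr, ContinuousLinearMap.adjoint_comp]
  rfl

/-- Averages of an orbit of the adjoint semigroup have continuous orbits. -/
theorem continuousOn_adjoint_average (t : ℝ) {δ : ℝ} (hδ : 0 ≤ δ) (y : H) :
    ContinuousOn (fun s => ((S s)†) (∫ r in (0 : ℝ)..δ, ((S r)†) y)) (Icc 0 t) := by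
  have hi : ∀ a b, 0 ≤ a → 0 ≤ b → IntervalIntegrable (fun u => ((S u)†) y) volume a b :=
      fun a b ha hb => by
    have h0 : ∀ c, 0 ≤ c → IntervalIntegrable (fun u => ((S u)†) y) volume 0 c :=
      fun c hc => (intervalIntegrable_iff_integrableOn_Ioc_of_le hc).2
        (integrableOn_adjoint_apply S c y)
    exact (h0 a ha).symm.trans (h0 b hb)
  have hF : ContinuousOn (fun s => ∫ r in (0 : ℝ)..s, ((S r)†) y) (Icc 0 (t + δ)) := by
    refine (intervalIntegral.continuousOn_primitive
      ((integrableOn_Icc_iff_integrableOn_Ioc).2 (integrableOn_adjoint_apply S _ y))).congr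
      fun s hs => ?_
    exact intervalIntegral.integral_of_le hs.1
  have h1 : ContinuousOn (fun s => (∫ r in (0 : ℝ)..(s + δ), ((S r)†) y) -
      ∫ r in (0 : ℝ)..s, ((S r)†) y) (Icc 0 t) := by
    refine ContinuousOn.sub ?_ (hF.mono (Icc_subset_Icc_right (by linarith)))
    refine hF.comp (f := fun s : ℝ => s + δ) (by fun_prop) fun s hs => ?_
    exact ⟨by linarith [hs.1], by linarith [hs.2]⟩
  refine h1.congr fun s hs => ?_
  have hs0 : 0 ≤ s := hs.1
  have h2 : ∫ u in (0 : ℝ)..δ, ((S (s + u))†) y = ∫ u in s..(s + δ), ((S u)†) y := by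
    have := intervalIntegral.integral_comp_add_left (a := 0) (b := δ)
      (fun u => ((S u)†) y) s
    rwa [add_zero] at this
  have h3 : ((S s)†) (∫ r in (0 : ℝ)..δ, ((S r)†) y) =
      ∫ r in (0 : ℝ)..δ, ((S s)†) (((S r)†) y) :=
    (ContinuousLinearMap.intervalIntegral_comp_comm ((S s)†) (hi 0 δ le_rfl hδ)).symm
  have h4 : ∫ r in (0 : ℝ)..δ, ((S s)†) (((S r)†) y) =
      ∫ u in (0 : ℝ)..δ, ((S (s + u))†) y := by
    refine intervalIntegral.integral_congr fun u hu => ?_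
    rw [uIcc_of_le hδ] at hu
    exact (adjoint_map_add S hs0 hu.1 y).symm
  exact (h3.trans (h4.trans h2)).trans (intervalIntegral.integral_interval_sub_left
    (hi _ _ le_rfl (by linarith)) (hi _ _ le_rfl hs0)).symm

/-- The adjoint semigroup is strongly continuous: the vectors with continuous orbits form a closed
subspace, which contains all averages of orbits and is therefore dense. -/
theorem continuousOn_adjoint_apply (t : ℝ) (x : H) :
    ContinuousOn (fun s => ((S s)†) x) (Icc 0 t) := by
  let V : Submodule ℝ H :=
    { carrier := {x | ContinuousOn (fun s => ((S s)†) x) (Icc 0 t)}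
      add_mem' := fun {x y} hx hy => by
        exact (ContinuousOn.add hx hy).congr fun s _ => map_add ((S s)†) x y
      zero_mem' := (continuousOn_const (c := (0 : H))).congr fun s _ => map_zero ((S s)†)
      smul_mem' := fun c x hx => by
        exact (ContinuousOn.const_smul hx c).congr fun s _ => map_smul ((S s)†) c x }
  have hV : IsClosed (V : Set H) := by
    obtain ⟨M, hM0, hM⟩ := S.exists_bound t
    refine isClosed_of_closure_subset fun x hx => ?_
    change ContinuousOn _ _
    refine continuousOn_of_uniform_approx_of_continuousOn fun u hu => ?_
    obtain ⟨ε, hε, hεu⟩ := Metric.mem_uniformity_dist.1 hu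
    obtain ⟨y, hy, hxy⟩ := Metric.mem_closure_iff.1 hx (ε / (M + 1)) (by positivity)
    refine ⟨fun s => ((S s)†) y, hy, fun s hs => hεu ?_⟩
    rw [dist_eq_norm, ← map_sub]
    refine (ContinuousLinearMap.le_opNorm _ _).trans_lt ?_
    rw [LinearIsometryEquiv.norm_map]
    rw [dist_eq_norm, lt_div_iff₀ (by positivity)] at hxy
    have := mul_le_mul_of_nonneg_right (hM s hs) (norm_nonneg (x - y))
    nlinarith [norm_nonneg (x - y)]
  have hbot : Vᗮ = ⊥ := by
    refine (Submodule.eq_bot_iff _).2 fun u hu => ?_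
    by_contra hne
    have hpos : 0 < ⟪S 0 u, u⟫ := by
      rw [S.map_zero]
      exact real_inner_self_pos.2 hne
    have hc : ContinuousOn (fun r => ⟪S r u, u⟫) (Ici 0) :=
      (S.continuousOn u).inner continuousOn_const
    have h1 : ∀ᶠ r in 𝓝[≥] (0 : ℝ), 0 < ⟪S r u, u⟫ :=
      (hc 0 self_mem_Ici).eventually_const_lt hpos
    obtain ⟨δ, hδ, hδ'⟩ := mem_nhdsGE_iff_exists_Icc_subset.1 h1
    have hδ0 : (0 : ℝ) < δ := hδ
    have h2 := Submodule.inner_right_of_mem_orthogonal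
      (show (∫ r in (0 : ℝ)..δ, ((S r)†) u) ∈ V from
        continuousOn_adjoint_average S t hδ0.le u) hu
    rw [intervalIntegral.integral_of_le hδ0.le, real_inner_comm,
      ← integral_inner (integrableOn_adjoint_apply S δ u)] at h2
    simp_rw [ContinuousLinearMap.adjoint_inner_right] at h2
    rw [← intervalIntegral.integral_of_le hδ0.le] at h2
    have h3 : 0 < ∫ r in (0 : ℝ)..δ, ⟪S r u, u⟫ := by
      refine intervalIntegral.intervalIntegral_pos_of_pos_on ?_ (fun r hr => ?_) hδ0
      · exact (hc.mono (by rw [uIcc_of_le hδ0.le]; exact Icc_subset_Ici_self)).intervalIntegrable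
      · exact hδ' (Ioo_subset_Icc_self hr)
    exact h3.ne' h2
  have : CompleteSpace V := hV.completeSpace_coe
  have htop := Submodule.orthogonal_eq_bot_iff.1 hbot
  have : x ∈ V := htop ▸ Submodule.mem_top
  exact this

end AdjointSemigroup

/-- Left Riemann sums of a continuous function converge to the integral. -/
theorem tendsto_riemann_sum {f : ℝ → ℝ} {t : ℝ} (ht : 0 ≤ t) (hf : ContinuousOn f (Icc 0 t)) :
    Tendsto (fun n : ℕ => ∑ i ∈ Finset.range n, t / n * f (i * t / n)) atTop
      (𝓝 (∫ s in (0 : ℝ)..t, f s)) := by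
  have hu := isCompact_Icc.uniformContinuousOn_of_continuous hf
  rw [Metric.uniformContinuousOn_iff_le] at hu
  rw [Metric.tendsto_atTop]
  intro ε hε
  obtain ⟨δ, hδ, hδ'⟩ := hu (ε / (t + 1)) (by positivity)
  obtain ⟨N, hN⟩ := exists_nat_gt (t / δ)
  refine ⟨N + 1, fun n hn => ?_⟩
  have hn0 : (0 : ℝ) < n := by
    have : 0 < n := by omega
    exact_mod_cast this
  have hnN : t / n ≤ δ := by
    have h1 : (N : ℝ) ≤ n := by
      have : N ≤ n := by omega
      exact_mod_cast this
    rw [div_le_iff₀ hn0]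
    rw [div_lt_iff₀ hδ] at hN
    nlinarith
  have hle : ∀ i : ℕ, (i : ℝ) * t / n ≤ (i + 1) * t / n := fun i => by
    gcongr; linarith
  have hmem : ∀ i ∈ Finset.range n, Icc ((i : ℝ) * t / n) ((i + 1) * t / n) ⊆ Icc 0 t :=
      fun i hi => by
    refine Icc_subset_Icc (by positivity) ?_
    have h1 : ((i + 1 : ℕ) : ℝ) ≤ n := by
      exact_mod_cast Finset.mem_range.1 hi
    push_cast at h1
    rw [div_le_iff₀ hn0]
    nlinarith
  have hint : ∀ i ∈ Finset.range n,
      IntervalIntegrable f volume ((i : ℝ) * t / n) ((i + 1) * t / n) := fun i hi =>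
    (hf.mono ((uIcc_of_le (hle i)).subset.trans (hmem i hi))).intervalIntegrable
  have hsum : ∫ s in (0 : ℝ)..t, f s =
      ∑ i ∈ Finset.range n, ∫ s in ((i : ℝ) * t / n)..((i + 1) * t / n), f s := by
    have h1 := intervalIntegral.sum_integral_adjacent_intervals (μ := volume) (f := f)
      (a := fun i : ℕ => (i : ℝ) * t / n) (n := n) fun i hi => by
        have := hint i (Finset.mem_range.2 hi)
        push_cast
        exact this
    push_cast at h1
    rw [h1, zero_mul, zero_div, mul_div_cancel_left₀ _ hn0.ne']
  rw [hsum, dist_eq_norm, ← Finset.sum_sub_distrib]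
  have hlen : ∀ i : ℕ, ((i : ℝ) + 1) * t / n - i * t / n = t / n := fun i => by ring
  calc ‖∑ i ∈ Finset.range n, (t / n * f (i * t / n) -
        ∫ s in ((i : ℝ) * t / n)..((i + 1) * t / n), f s)‖
      ≤ ∑ i ∈ Finset.range n, ε / (t + 1) * (t / n) := by
        refine norm_sum_le_of_le _ fun i hi => ?_
        have h1 : t / n * f (i * t / n) =
            ∫ s in ((i : ℝ) * t / n)..((i + 1) * t / n), f (i * t / n) := by
          rw [intervalIntegral.integral_const, hlen, smul_eq_mul]
        rw [h1, ← intervalIntegral.integral_sub (by simp) (hint i hi)]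
        refine (intervalIntegral.norm_integral_le_of_norm_le_const (C := ε / (t + 1))
          fun s hs => ?_).trans (le_of_eq ?_)
        · rw [uIoc_of_le (hle i)] at hs
          refine hδ' _ (hmem i hi ⟨le_rfl, hle i⟩) s (hmem i hi ⟨hs.1.le, hs.2⟩) ?_
          rw [Real.dist_eq, abs_sub_comm, abs_of_nonneg (sub_nonneg.2 hs.1.le)]
          linarith [hs.2, hlen i]
        · rw [hlen, abs_of_nonneg (by positivity)]
    _ = ε * (t / (t + 1)) := by
        rw [Finset.sum_const, Finset.card_range, nsmul_eq_mul]
        field_simp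
    _ < ε := by
        have : t / (t + 1) < 1 := (div_lt_one (by positivity)).2 (by linarith)
        nlinarith

section StochasticConvolution
variable {Ω H Ξ : Type*} [MeasurableSpace Ω] {ℙ : Measure Ω} [IsProbabilityMeasure ℙ]
  [NormedAddCommGroup H] [InnerProductSpace ℝ H] [CompleteSpace H]
  [TopologicalSpace.SeparableSpace H] [MeasurableSpace H] [BorelSpace H]
  [NormedAddCommGroup Ξ] [InnerProductSpace ℝ Ξ] [CompleteSpace Ξ]
  [TopologicalSpace.SeparableSpace Ξ] {W : ℝ≥0 → Ξ → Ω → ℝ}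

/-- Sums `∑ ⟨W(b i) - W(a i), ξ i⟩` over successive intervals `[a i, a (i + 1)]` are centered
Gaussian with variance `∑ (a (i + 1) - a i) |ξ i|²`. -/
theorem IsCylindricalWiener.integral_exp_sum_increments (hW : IsCylindricalWiener W ℙ)
    {a : ℕ → ℝ≥0} (ha : Monotone a) (ξ : ℕ → Ξ) (n : ℕ) :
    AEMeasurable (fun ω => ∑ i ∈ Finset.range n, (W (a (i + 1)) (ξ i) ω - W (a i) (ξ i) ω)) ℙ ∧
    ∫ ω, Complex.exp ((∑ i ∈ Finset.range n, (W (a (i + 1)) (ξ i) ω - W (a i) (ξ i) ω) : ℝ)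
      * Complex.I) ∂ℙ =
      Complex.exp (-(((∑ i ∈ Finset.range n, ((a (i + 1) : ℝ) - a i) * ‖ξ i‖ ^ 2) / 2 : ℝ) : ℂ)) := by
  have hL2 : ∀ s η, MemLp (W s η) 2 ℙ := fun s η =>
    (hW.gaussian.hasGaussianLaw_eval (s, η)).memLp_two
  have hZ : ProbabilityTheory.IsGaussianProcess
      (fun (i : ℕ) ω => W (a (i + 1)) (ξ i) ω - W (a i) (ξ i) ω) ℙ := by
    classical
    exact hW.gaussian.of_isGaussianProcess fun i => ⟨{(a (i + 1), ξ i), (a i, ξ i)},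
      { toFun := fun x => x ⟨(a (i + 1), ξ i), by simp⟩ - x ⟨(a i, ξ i), by simp⟩
        map_add' := fun x y => by simp only [Pi.add_apply]; ring
        map_smul' := fun c x => by simp only [Pi.smul_apply, smul_eq_mul, RingHom.id_apply]; ring
        cont := by fun_prop }, fun ω => rfl⟩
  have hg := hZ.hasGaussianLaw_fun_sum (I := Finset.range n)
  have hmemZ : ∀ i, MemLp (fun ω => W (a (i + 1)) (ξ i) ω - W (a i) (ξ i) ω) 2 ℙ := fun i =>
    (hL2 _ _).sub (hL2 _ _)
  have hmean : ∫ ω, ∑ i ∈ Finset.range n, (W (a (i + 1)) (ξ i) ω - W (a i) (ξ i) ω) ∂ℙ = 0 := by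
    rw [integral_finsetSum _ fun i _ => (hmemZ i).integrable (by norm_num)]
    refine Finset.sum_eq_zero fun i _ => ?_
    rw [integral_sub ((hL2 _ _).integrable (by norm_num)) ((hL2 _ _).integrable (by norm_num)),
      hW.mean, hW.mean, sub_zero]
  have hvar : ProbabilityTheory.variance
      (fun ω => ∑ i ∈ Finset.range n, (W (a (i + 1)) (ξ i) ω - W (a i) (ξ i) ω)) ℙ =
      ∑ i ∈ Finset.range n, ((a (i + 1) : ℝ) - a i) * ‖ξ i‖ ^ 2 := by
    rw [← ProbabilityTheory.covariance_self hg.aemeasurable,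
      ProbabilityTheory.covariance_fun_sum_fun_sum' (fun i _ => hmemZ i) (fun i _ => hmemZ i)]
    refine Finset.sum_congr rfl fun i hi => ?_
    have hcov : ∀ j, ProbabilityTheory.covariance
        (fun ω => W (a (i + 1)) (ξ i) ω - W (a i) (ξ i) ω)
        (fun ω => W (a (j + 1)) (ξ j) ω - W (a j) (ξ j) ω) ℙ =
        (min (a (i + 1) : ℝ) (a (j + 1)) - min (a (i + 1) : ℝ) (a j)
          - min (a i : ℝ) (a (j + 1)) + min (a i : ℝ) (a j)) * ⟪ξ i, ξ j⟫ := fun j => by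
      rw [ProbabilityTheory.covariance_fun_sub_fun_sub (hL2 _ _) (hL2 _ _) (hL2 _ _) (hL2 _ _)]
      simp only [hW.cov]
      ring
    have hmono : ∀ {p q : ℕ}, p ≤ q → (a p : ℝ) ≤ a q := fun h => by exact_mod_cast ha h
    rw [Finset.sum_eq_single_of_mem i hi]
    · rw [hcov, min_self, min_self, min_eq_right (hmono i.le_succ), min_eq_left (hmono i.le_succ),
        real_inner_self_eq_norm_sq]
      ring
    · intro j _ hj
      rw [hcov]
      rcases lt_or_gt_of_ne hj with h | h
      · rw [min_eq_right (hmono (by omega)), min_eq_right (hmono (by omega)),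
          min_eq_right (hmono (by omega)), min_eq_right (hmono (by omega))]
        ring
      · rw [min_eq_left (hmono (by omega)), min_eq_left (hmono (by omega)),
          min_eq_left (hmono (by omega)), min_eq_left (hmono (by omega))]
        ring
  refine ⟨hg.aemeasurable, ?_⟩
  have h1 := hg.charFun_map_eq 1
  rw [charFun_apply_real, integral_map hg.aemeasurable (by fun_prop)] at h1
  simp only [RCLike.inner_apply, conj_trivial, mul_one, Complex.ofReal_one, one_mul] at h1
  rw [hmean, hvar] at h1
  rw [h1]
  congr 1
  push_cast
  ring

/-- The stochastic convolution at time `t` has law `𝒩(0, Q_t)`: its Riemann-Itô sums are centered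
Gaussian, with variances the Riemann sums of `∫₀ᵗ |G* e^{sA*} h|² ds`. -/
theorem IsStochasticConvolution.map_eq {S : C0Semigroup H} {G : Ξ →L[ℝ] H}
    (hW : IsCylindricalWiener W ℙ) {t : ℝ} (ht : 0 ≤ t) {Y : Ω → H}
    (hY : IsStochasticConvolution S G W ℙ t Y) :
    ℙ.map Y = centeredGaussian (gramian S G t) := by
  have hsc : SecondCountableTopology H := UniformSpace.secondCountable_of_separable H
  refine (IsCenteredGaussian.centeredGaussian_eq (R := gramian S G t)
    ⟨Measure.isProbabilityMeasure_map hY.1, fun h => ?_⟩).symm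
  rw [charFun_apply, integral_map hY.1 (by fun_prop)]
  have hg : ContinuousOn (fun s => ‖(G†) (((S (t - s))†) h)‖ ^ 2) (Icc 0 t) := by
    have h1 := (continuousOn_adjoint_apply S t h).comp (f := fun s : ℝ => t - s)
      (s := Icc 0 t) (by fun_prop) fun s hs => ⟨by linarith [hs.2], by linarith [hs.1]⟩
    exact (((G†).continuous.comp_continuousOn h1).norm).pow 2
  have hinc : ∀ n : ℕ, _ := fun n => hW.integral_exp_sum_increments
    (a := fun i : ℕ => Real.toNNReal (i * t / n))
    (fun i j hij => Real.toNNReal_le_toNNReal (by gcongr))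
    (fun i : ℕ => (G†) (((S (t - i * t / n))†) h)) n
  simp only [Nat.cast_add, Nat.cast_one] at hinc
  have hlim := tendsto_integral_exp_mul_I (P := ℙ) (l := atTop)
    (fun n => (hinc n).1.aestronglyMeasurable)
    (Y := fun ω => ⟪h, Y ω⟫) ((hY.1.const_inner (c := h)).aestronglyMeasurable) (by
      refine (hY.2 h).congr fun n => ?_
      rw [← eLpNorm_neg]
      congr 1
      funext ω
      simp)
  have hriem := tendsto_riemann_sum ht hg
  rw [intervalIntegral.integral_comp_sub_left (fun s => ‖(G†) (((S s)†) h)‖ ^ 2) t, sub_self,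
    sub_zero, intervalIntegral.integral_of_le ht, ← inner_gramian_self] at hriem
  have hexp : Tendsto (fun n : ℕ => Complex.exp (-(((∑ i ∈ Finset.range n,
      t / n * ‖(G†) (((S (t - i * t / n))†) h)‖ ^ 2) / 2 : ℝ) : ℂ))) atTop
      (𝓝 (Complex.exp (-((⟪gramian S G t h, h⟫ / 2 : ℝ) : ℂ)))) :=
    ((by fun_prop : Continuous fun r : ℝ => Complex.exp (-((r / 2 : ℝ) : ℂ))).tendsto _).comp hriem
  have heq := tendsto_nhds_unique hlim (hexp.congr fun n => ?_)
  · rw [← heq]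
    simp_rw [real_inner_comm h]
  · rw [(hinc n).2]
    congr 4
    refine Finset.sum_congr rfl fun i _ => ?_
    rw [Real.coe_toNNReal _ (by positivity), Real.coe_toNNReal _ (by positivity)]
    ring

end StochasticConvolution

/-! ### Borel factorization -/

/-- A bounded Borel function on a standard Borel space that is constant on the fibres of a Borel
map `e` is a bounded Borel function of `e`. -/
theorem exists_measurable_factor {A B Z : Type*} [MeasurableSpace A] [StandardBorelSpace A]
    [TopologicalSpace B] [T2Space B] [SecondCountableTopology B] [NormedAddCommGroup Z]
    [CompleteSpace Z] [SecondCountableTopology Z] {e : A → B} (he : Measurable[_, borel B] e)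
    {F : A → Z} (hF : Measurable[_, borel Z] F) (hfib : ∀ a a', e a = e a' → F a = F a') {M : ℝ}
    (hM : ∀ a, ‖F a‖ ≤ M) :
    ∃ h : B → Z, Measurable[borel B, borel Z] h ∧ (∀ b, ‖h b‖ ≤ max M 0) ∧ ∀ a, F a = h (e a) := by
  borelize B
  borelize Z
  have hr : Measurable (rangeFactorization e) := he.subtype_mk
  choose a ha using fun b : range e => b.2
  have hg : ∀ x, F (a (rangeFactorization e x)) = F x := fun x => hfib _ _ (ha _)
  -- Lusin-Souslin: the factor is Borel on the range of `e`, which is only analytic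
  have hg' : Measurable fun b => F (a b) := by
    refine (hr.measurable_comp_iff_of_surjective rangeFactorization_surjective).1 ?_
    have : (fun b => F (a b)) ∘ rangeFactorization e = F := funext hg
    rwa [this]
  -- so `F` is measurable for the σ-algebra of `e`, and the Doob-Dynkin lemma applies
  have hF' : Measurable[MeasurableSpace.comap e inferInstance] F := by
    intro s hs
    obtain ⟨t, ht, hts⟩ := hg' hs
    refine ⟨t, ht, ?_⟩
    ext x
    have := Set.ext_iff.1 hts (rangeFactorization e x)
    simp only [mem_preimage] at this
    rw [hg x] at this
    exact this
  obtain ⟨h, hm, hh⟩ := hF'.exists_eq_measurable_comp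
  classical
  refine ⟨fun b => if ‖h b‖ ≤ M then h b else 0,
    Measurable.ite (measurableSet_le hm.norm measurable_const) hm measurable_const,
    fun b => ?_, fun x => ?_⟩
  · simp only
    split_ifs with hb
    · exact hb.trans (le_max_left _ _)
    · simp
  · have hx : F x = h (e x) := congrFun hh x
    simp only
    rw [← hx, if_pos (hM x)]

/-- The range of a bounded operator between separable Banach spaces is Borel: the operator induces
an injective one on the quotient by its kernel. -/
theorem ContinuousLinearMap.measurableSet_range_of_separable {E F : Type*} [NormedAddCommGroup E]
    [NormedSpace ℝ E] [CompleteSpace E] [TopologicalSpace.SeparableSpace E]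
    [NormedAddCommGroup F] [NormedSpace ℝ F] [MeasurableSpace F] [BorelSpace F]
    (L : E →L[ℝ] F) : MeasurableSet (range L) := by
  have hcl : IsClosed (L.ker : Set E) := L.isClosed_ker
  have : IsClosed ((L.ker).toAddSubgroup : Set E) := hcl
  have : TopologicalSpace.SeparableSpace (E ⧸ L.ker) :=
    (Submodule.mkQ_surjective L.ker).denseRange.separableSpace
      (Submodule.isQuotientMap_mkQ L.ker).continuous
  have : SecondCountableTopology (E ⧸ L.ker) := UniformSpace.secondCountable_of_separable _
  have hinj : Function.Injective (Submodule.liftQL L.ker L le_rfl) := by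
    rw [Submodule.coe_liftQL]
    exact LinearMap.ker_eq_bot.1 (Submodule.ker_liftQ_eq_bot _ _ _ le_rfl)
  have h := measurableSet_range_of_continuous_injective
    (Submodule.liftQL L.ker L le_rfl).continuous hinj
  convert h using 1
  ext y
  simp only [mem_range]
  constructor
  · rintro ⟨x, rfl⟩
    exact ⟨Submodule.Quotient.mk x, rfl⟩
  · rintro ⟨q, rfl⟩
    obtain ⟨x, rfl⟩ := Submodule.Quotient.mk_surjective _ q
    exact ⟨x, rfl⟩

theorem norm_le_of_forall_abs_inner_le {E : Type*} [NormedAddCommGroup E] [InnerProductSpace ℝ E]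
    {v : E} {c : ℝ} (hc : 0 ≤ c) (h : ∀ k, |⟪v, k⟫| ≤ c * ‖k‖) : ‖v‖ ≤ c := by
  have h1 := h v
  rw [real_inner_self_eq_norm_sq, abs_of_nonneg (sq_nonneg _), sq] at h1
  by_contra hlt
  push Not at hlt
  nlinarith [norm_nonneg v]

/-- A `C₀`-semigroup is jointly continuous in time and space. -/
theorem C0Semigroup.continuousOn_uncurry {E : Type*} [NormedAddCommGroup E] [NormedSpace ℝ E]
    [CompleteSpace E] (S : C0Semigroup E) :
    ContinuousOn (fun p : ℝ × E => S p.1 p.2) (Ici 0 ×ˢ univ) := by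
  rintro ⟨t, x⟩ ⟨ht, -⟩
  have ht0 : 0 ≤ t := ht
  obtain ⟨M, hM0, hM⟩ := S.exists_bound (t + 1)
  have h1 : ContinuousOn (fun p : ℝ × E => S p.1 p.2) (Icc 0 (t + 1) ×ˢ univ) :=
    continuousOn_prod_of_continuousOn_lipschitzOnWith' _ M.toNNReal
      (fun s hs => ((LipschitzWith.of_dist_le_mul fun x y => by
        rw [dist_eq_norm, dist_eq_norm, ← map_sub, Real.coe_toNNReal _ hM0]
        exact ((S s).le_opNorm _).trans
          (mul_le_mul_of_nonneg_right (hM s hs) (norm_nonneg _))).lipschitzOnWith))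
      (fun y _ => (S.continuousOn y).mono Icc_subset_Ici_self)
  refine (h1 (t, x) ⟨⟨ht0, by linarith⟩, mem_univ _⟩).mono_of_mem_nhdsWithin ?_
  refine mem_nhdsWithin.2 ⟨Iio (t + 1) ×ˢ univ, isOpen_Iio.prod isOpen_univ,
    ⟨by simp, mem_univ _⟩, ?_⟩
  rintro ⟨s, y⟩ ⟨⟨hs, -⟩, hs', -⟩
  exact ⟨⟨hs', le_of_lt hs⟩, mem_univ _⟩

/-- The `C`-gradient only depends on the increments of the function. -/
theorem cGrad_congr {K E : Type*} [NormedAddCommGroup K] [InnerProductSpace ℝ K] [CompleteSpace K]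
    [NormedAddCommGroup E] [NormedSpace ℝ E] {C : K →L[ℝ] E} {f : E → ℝ} {x x' : E}
    (h : ∀ v, f (x + v) = f (x' + v)) : cGrad C f x = cGrad C f x' := by
  have h0 : f x = f x' := by simpa using h 0
  have h1 : (fun L => HasCFDerivAt C f L x) = fun L => HasCFDerivAt C f L x' := by
    funext L
    simp only [HasCFDerivAt, h, h0]
  unfold cGrad CFDifferentiableAt
  congr!

namespace OUSetting

variable {H K Ξ Hb : Type*}
    [NormedAddCommGroup H] [InnerProductSpace ℝ H] [CompleteSpace H]
    [TopologicalSpace.SeparableSpace H]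
    [NormedAddCommGroup K] [InnerProductSpace ℝ K]
    [NormedAddCommGroup Ξ] [InnerProductSpace ℝ Ξ] [CompleteSpace Ξ]
    [TopologicalSpace.SeparableSpace Ξ]
    [NormedAddCommGroup Hb] [NormedSpace ℝ Hb]
    (D : OUSetting H K Ξ Hb)

/-! ### Paths -/

theorem secondCountableTopology_Hb (D : OUSetting H K Ξ Hb) : SecondCountableTopology Hb := by
  have : TopologicalSpace.SeparableSpace Hb := D.ι_dense.separableSpace D.ι.continuous
  exact UniformSpace.secondCountable_of_separable _

theorem PS_Sb {t s : ℝ} (ht : 0 < t) (hs : 0 ≤ s) (x : Hb) :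
    D.PS t (D.Sb s x) = D.PS (t + s) x := by
  have := D.PS_eq ht (le_add_of_nonneg_right hs : t ≤ t + s) x
  rw [this, add_sub_cancel_left]

theorem path_add (x v : Hb) : D.path (x + v) = D.path x + D.path v :=
  ContinuousMap.ext fun t => map_add (D.PS t) x v

theorem path_eq_iff {x x' : Hb} : D.path x = D.path x' ↔ ∀ t, 0 < t → D.PS t x = D.PS t x' :=
  ⟨fun h t ht => DFunLike.congr_fun h (⟨t, ht⟩ : Ioi (0 : ℝ)),
    fun h => ContinuousMap.ext fun t => h t t.2⟩

theorem toPath_eq_iff {x x' : Hb} : D.toPath x = D.toPath x' ↔ D.path x = D.path x' :=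
  Subtype.ext_iff

theorem toPath_surjective : Function.Surjective D.toPath := by
  rintro ⟨_, x, rfl⟩
  exact ⟨x, rfl⟩

/-- The path of `z + e^{tA} x` depends on `x` only through the path of `x`, shifted by `t`. -/
theorem path_add_Sb {x x' : Hb} (h : D.path x = D.path x') {t : ℝ} (ht : 0 ≤ t) (z : Hb) :
    D.path (z + D.Sb t x) = D.path (z + D.Sb t x') := by
  rw [path_eq_iff] at h ⊢
  intro s hs
  rw [map_add, map_add, D.PS_Sb hs ht, D.PS_Sb hs ht, h _ (by linarith)]

theorem secondCountableTopology_L2w : SecondCountableTopology (L2w H D.ρ) := by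
  have : SFinite (weightMeasure D.ρ) := by unfold weightMeasure; infer_instance
  have : Fact ((2 : ENNReal) ≠ ⊤) := ⟨by norm_num⟩
  infer_instance

variable [CompleteSpace Hb]

theorem continuousOn_PS_uncurry :
    ContinuousOn (fun p : ℝ × Hb => D.PS p.1 p.2) (Ioi 0 ×ˢ univ) := by
  rintro ⟨t, x⟩ ⟨ht, -⟩
  have ht0 : 0 < t := ht
  refine ContinuousAt.continuousWithinAt ?_
  have h1 : ContinuousAt (fun p : ℝ × Hb => D.Sb (p.1 - t / 2) p.2) (t, x) := by
    refine ContinuousAt.comp (f := fun p : ℝ × Hb => (p.1 - t / 2, p.2))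
      (g := fun p => D.Sb p.1 p.2) ?_ (by fun_prop)
    exact D.Sb.continuousOn_uncurry.continuousAt
      (prod_mem_nhds (Ici_mem_nhds (by simp only; linarith)) univ_mem)
  refine ((D.PS (t / 2)).continuous.continuousAt.comp h1).congr ?_
  have h2 : ∀ᶠ p : ℝ × Hb in 𝓝 (t, x), t / 2 < p.1 :=
    continuousAt_const.eventually_lt continuousAt_fst (by simp only; linarith)
  filter_upwards [h2] with p hp
  exact (D.PS_eq (by linarith) (le_of_lt hp) p.2).symm

theorem continuous_path : Continuous D.path := by
  refine ContinuousMap.continuous_of_continuous_uncurry _ ?_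
  exact D.continuousOn_PS_uncurry.comp_continuous
    (f := fun p : Hb × Ioi (0 : ℝ) => ((p.2 : ℝ), p.1)) (by fun_prop) fun p => ⟨p.2.2, mem_univ _⟩

theorem continuous_toPath : Continuous D.toPath := D.continuous_path.subtype_mk _

theorem extendL2_upsilon (φhat : D.PathSpace → ℝ) (x : Hb) :
    D.extendL2 φhat (D.upsilon x) = φhat (D.toPath x) := by
  rw [← D.pathToL2_toPath, extendL2, D.pathToL2_injective.extend_apply]

theorem range_pathToL2 : range D.pathToL2 = range D.upsilon := by
  ext y
  constructor
  · rintro ⟨p, rfl⟩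
    obtain ⟨x, rfl⟩ := D.toPath_surjective p
    exact ⟨x, (D.pathToL2_toPath x).symm⟩
  · rintro ⟨x, rfl⟩
    exact ⟨_, D.pathToL2_toPath x⟩

theorem extendL2_of_notMem (φhat : D.PathSpace → ℝ) {z : L2w H D.ρ}
    (hz : z ∉ range D.upsilon) : D.extendL2 φhat z = 0 := by
  rw [extendL2, Function.extend_apply' _ _ _ (by rwa [← D.range_pathToL2] at hz)]
  rfl

/-- A Borel function of the path is Borel on `L²_ρ`, because the image of `Υ` is Borel. -/
theorem measurable_extendL2 {φhat : D.PathSpace → ℝ} (h : Measurable[borel _, borel _] φhat) :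
    Measurable (D.extendL2 φhat) := by
  have := D.secondCountableTopology_Hb
  have := D.secondCountableTopology_L2w
  borelize Hb
  have h1 : Measurable (D.extendL2 φhat ∘ D.upsilon) := by
    have h2 : D.extendL2 φhat ∘ D.upsilon = φhat ∘ D.toPath :=
      funext fun x => D.extendL2_upsilon φhat x
    rw [h2]
    borelize D.PathSpace
    have hb : borel ℝ = Real.measurableSpace := (BorelSpace.measurable_eq).symm
    rw [hb] at h
    exact h.comp D.continuous_toPath.measurable
  rw [D.upsilon.continuous.measurable.measurable_comp_iff_restrict] at h1
  refine measurable_of_restrict_of_restrict_compl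
    D.upsilon.measurableSet_range_of_separable h1 ?_
  have h3 : (range D.upsilon)ᶜ.domRestrict (D.extendL2 φhat) = fun _ => 0 :=
    funext fun z => D.extendL2_of_notMem φhat z.2
  rw [h3]
  exact measurable_const

end OUSetting

namespace OUSetting

variable {H K Ξ Hb : Type*}
    [NormedAddCommGroup H] [InnerProductSpace ℝ H] [CompleteSpace H]
    [TopologicalSpace.SeparableSpace H] [MeasurableSpace H] [BorelSpace H]
    [NormedAddCommGroup K] [InnerProductSpace ℝ K]
    [NormedAddCommGroup Ξ] [InnerProductSpace ℝ Ξ] [CompleteSpace Ξ]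
    [TopologicalSpace.SeparableSpace Ξ]
    [NormedAddCommGroup Hb] [NormedSpace ℝ Hb]
    (D : OUSetting H K Ξ Hb)

/-! ### Lifted and projected Gaussian measures -/

theorem isCenteredGaussian_Q (t : ℝ) : IsCenteredGaussian (centeredGaussian (D.Q t)) (D.Q t) :=
  isCenteredGaussian_gramian D.S D.G D.traceClass t

theorem isProbabilityMeasure_Q (t : ℝ) : IsProbabilityMeasure (centeredGaussian (D.Q t)) :=
  (D.isCenteredGaussian_Q t).isProbabilityMeasure

theorem centeredGaussian_liftedCov (t : ℝ) : centeredGaussian (D.liftedCov t) =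
    (centeredGaussian (D.Q t)).map (D.upsilon.comp D.ι) :=
  have := D.secondCountableTopology_L2w
  ((D.isCenteredGaussian_Q t).map (D.upsilon.comp D.ι)).centeredGaussian_eq

theorem isCenteredGaussian_liftedCov (t : ℝ) :
    IsCenteredGaussian (centeredGaussian (D.liftedCov t)) (D.liftedCov t) := by
  rw [D.centeredGaussian_liftedCov]
  exact (D.isCenteredGaussian_Q t).map (D.upsilon.comp D.ι)

theorem liftedCov_isPositive (t : ℝ) : (D.liftedCov t).IsPositive :=
  (gramian_isPositive D.S D.G t).conj_adjoint (D.upsilon.comp D.ι)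

theorem centeredGaussian_projCov (t : ℝ) : centeredGaussian (D.projCov t) =
    (centeredGaussian (D.Q t)).map D.P :=
  ((D.isCenteredGaussian_Q t).map D.P).centeredGaussian_eq

theorem isCenteredGaussian_projCov (t : ℝ) :
    IsCenteredGaussian (centeredGaussian (D.projCov t)) (D.projCov t) := by
  rw [D.centeredGaussian_projCov]
  exact (D.isCenteredGaussian_Q t).map D.P

theorem projCov_isPositive (t : ℝ) : (D.projCov t).IsPositive :=
  (gramian_isPositive D.S D.G t).conj_adjoint D.P

theorem integral_liftedCov (t : ℝ) {f : L2w H D.ρ → ℝ}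
    (hf : AEStronglyMeasurable f (centeredGaussian (D.liftedCov t))) :
    ∫ z, f z ∂centeredGaussian (D.liftedCov t) =
      ∫ z, f (D.upsilon (D.ι z)) ∂centeredGaussian (D.Q t) := by
  rw [D.centeredGaussian_liftedCov] at hf ⊢
  exact integral_map (by fun_prop) hf

variable [CompleteSpace K] [CompleteSpace Hb]

theorem IsPathRep.extendL2_add {D : OUSetting H K Ξ Hb} {φ : Hb → ℝ} {φhat : D.PathSpace → ℝ}
    (h : D.IsPathRep φ φhat) (x y : Hb) :
    D.extendL2 φhat (D.upsilon x + D.upsilon y) = φ (x + y) := by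
  rw [← map_add, extendL2_upsilon, h.2.2]

theorem IsPathRep.abs_extendL2_le {D : OUSetting H K Ξ Hb} {φ : Hb → ℝ} {φhat : D.PathSpace → ℝ}
    (h : D.IsPathRep φ φhat) (z : L2w H D.ρ) : |D.extendL2 φhat z| ≤ ⨆ y, |φ y| := by
  obtain ⟨-, ⟨M, hM⟩, hφ⟩ := h
  by_cases hz : z ∈ range D.upsilon
  · obtain ⟨x, rfl⟩ := hz
    rw [extendL2_upsilon, ← hφ]
    refine le_ciSup (f := fun y => |φ y|) ⟨M, ?_⟩ x
    rintro _ ⟨y, rfl⟩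
    simp only [hφ]
    exact hM _
  · rw [D.extendL2_of_notMem φhat hz, abs_zero]
    exact Real.iSup_nonneg fun y => abs_nonneg _

theorem IsPathRep.measurable_extendL2_add {D : OUSetting H K Ξ Hb} {φ : Hb → ℝ}
    {φhat : D.PathSpace → ℝ} (h : D.IsPathRep φ φhat) (e : L2w H D.ρ) :
    Measurable fun z => D.extendL2 φhat (z + e) :=
  (D.measurable_extendL2 h.1).comp (measurable_id.add_const e)

theorem IsPathRep.memLp_extendL2_add {D : OUSetting H K Ξ Hb} {φ : Hb → ℝ}
    {φhat : D.PathSpace → ℝ} (h : D.IsPathRep φ φhat) (t : ℝ) (e : L2w H D.ρ) :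
    MemLp (fun z => D.extendL2 φhat (z + e)) 2 (centeredGaussian (D.liftedCov t)) := by
  have := (D.isCenteredGaussian_liftedCov t).isProbabilityMeasure
  exact MemLp.of_bound (h.measurable_extendL2_add e).aestronglyMeasurable (⨆ y, |φ y|)
    (ae_of_all _ fun z => h.abs_extendL2_le _)

theorem IsPathRep.R_eq {D : OUSetting H K Ξ Hb} {φ : Hb → ℝ} {φhat : D.PathSpace → ℝ}
    (h : D.IsPathRep φ φhat) (t : ℝ) (x : Hb) :
    D.R t φ x = ∫ z, D.extendL2 φhat (z + D.upsilon (D.Sb t x))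
      ∂centeredGaussian (D.liftedCov t) := by
  rw [D.integral_liftedCov t (h.measurable_extendL2_add _).aestronglyMeasurable]
  simp_rw [h.extendL2_add]
  rfl

theorem liftedLambda_mem (hΛ : D.LiftedControllable) {t : ℝ} (ht : 0 < t) (k : K) :
    D.liftedLambda hΛ t ht k ∈ ((opSqrt (D.liftedCov t)).ker)ᗮ :=
  pinv_mem _ (hΛ t ht k)

theorem opSqrt_liftedLambda (hΛ : D.LiftedControllable) {t : ℝ} (ht : 0 < t) (k : K) :
    opSqrt (D.liftedCov t) (D.liftedLambda hΛ t ht k) = D.upsilon (D.Sb t (D.C k)) :=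
  apply_pinv _ (hΛ t ht k)

/-- `R_t[φ]` is `C`-Fréchet differentiable, and its derivative is an average of `φ` against a
Gaussian functional. -/
theorem IsPathRep.exists_hasCFDerivAt_R {D : OUSetting H K Ξ Hb} {φ : Hb → ℝ}
    {φhat : D.PathSpace → ℝ} (h : D.IsPathRep φ φhat) (hΛ : D.LiftedControllable) {t : ℝ}
    (ht : 0 < t) (x : Hb) : ∃ L : K →L[ℝ] ℝ, HasCFDerivAt D.C (D.R t φ) L x ∧
      (∀ k, |L k| ≤ (⨆ y, |φ y|) * ‖D.liftedLambda hΛ t ht k‖) ∧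
      ∀ k ξ, IsGaussianFunctional (D.liftedCov t) (D.liftedLambda hΛ t ht k) ξ →
        L k = ∫ z, D.extendL2 φhat (z + D.upsilon (D.Sb t x)) * ξ z
          ∂centeredGaussian (D.liftedCov t) := by
  have := D.secondCountableTopology_L2w
  refine exists_hasCFDerivAt (D.liftedCov_isPositive t) (D.isCenteredGaussian_liftedCov t)
    (D.liftedLambda_mem hΛ ht) (D.measurable_extendL2 h.1) h.abs_extendL2_le fun s k => ?_
  rw [h.R_eq, D.opSqrt_liftedLambda hΛ ht]
  simp only [map_add, map_smul, add_assoc]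

theorem exists_isGaussianFunctional_liftedLambda (hΛ : D.LiftedControllable) {t : ℝ} (ht : 0 < t)
    (k : K) : ∃ ξ, IsGaussianFunctional (D.liftedCov t) (D.liftedLambda hΛ t ht k) ξ := by
  have := D.secondCountableTopology_L2w
  exact exists_isGaussianFunctional (D.liftedCov_isPositive t) (D.isCenteredGaussian_liftedCov t)
    (mem_closure_range_opSqrt (D.liftedCov_isPositive t) (D.liftedLambda_mem hΛ ht k))

/-- The `C`-gradient of `R_s[φ]` at `x` depends on `φ` and `x` in a Lipschitz way, measured by the
`L²(𝒩(0, Q_s))`-distance of the functions `z ↦ φ (z + e^{sA} x)`. -/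
theorem norm_cGrad_R_sub_le (hΛ : D.LiftedControllable) {φ φ' : Hb → ℝ}
    {φhat φhat' : D.PathSpace → ℝ} (h : D.IsPathRep φ φhat) (h' : D.IsPathRep φ' φhat') {s : ℝ}
    (hs : 0 < s) (x x' : Hb) :
    ‖cGrad D.C (D.R s φ) x - cGrad D.C (D.R s φ') x'‖ ≤
      √(∫ z, (φ (D.ι z + D.Sb s x) - φ' (D.ι z + D.Sb s x')) ^ 2 ∂centeredGaussian (D.Q s)) *
        ‖D.liftedLambda hΛ s hs‖ := by
  have := D.secondCountableTopology_L2w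
  refine norm_le_of_forall_abs_inner_le (by positivity) fun k => ?_
  obtain ⟨L, hL, -, hL'⟩ := h.exists_hasCFDerivAt_R hΛ hs x
  obtain ⟨N, hN, -, hN'⟩ := h'.exists_hasCFDerivAt_R hΛ hs x'
  obtain ⟨ξ, hξ⟩ := D.exists_isGaussianFunctional_liftedLambda hΛ hs k
  have hG := D.isCenteredGaussian_liftedCov s
  have hm := h.memLp_extendL2_add s (D.upsilon (D.Sb s x))
  have hm' := h'.memLp_extendL2_add s (D.upsilon (D.Sb s x'))
  have hi : Integrable (fun z => D.extendL2 φhat (z + D.upsilon (D.Sb s x)) * ξ z)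
      (centeredGaussian (D.liftedCov s)) := hm.integrable_mul hξ.1
  have hi' : Integrable (fun z => D.extendL2 φhat' (z + D.upsilon (D.Sb s x')) * ξ z)
      (centeredGaussian (D.liftedCov s)) := hm'.integrable_mul hξ.1
  rw [inner_sub_left, hL.inner_cGrad, hN.inner_cGrad, hL' k ξ hξ, hN' k ξ hξ,
    ← integral_sub hi hi']
  simp_rw [← sub_mul]
  refine (hξ.abs_integral_mul_le (D.liftedCov_isPositive s) hG (hm.sub hm')).trans ?_
  rw [mul_assoc]
  refine mul_le_mul (le_of_eq ?_) ((D.liftedLambda hΛ s hs).le_opNorm k) (norm_nonneg _)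
    (Real.sqrt_nonneg _)
  have hsq : AEStronglyMeasurable (fun z => (D.extendL2 φhat (z + D.upsilon (D.Sb s x)) -
      D.extendL2 φhat' (z + D.upsilon (D.Sb s x'))) ^ 2) (centeredGaussian (D.liftedCov s)) :=
    (hm.1.sub hm'.1).pow 2
  simp only [Pi.sub_apply]
  rw [D.integral_liftedCov s hsq]
  simp only [h.extendL2_add, h'.extendL2_add]

/-- If `f (r + s) = R_s[f r]`, then `f t` is `C`-Fréchet differentiable for `t > 0`, with jointly
continuous gradient: near `t₀`, the gradient of `f t = R_{t₀ / 2}[f (t - t₀ / 2)]` is given by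
averages against a fixed Gaussian functional. -/
theorem continuousOn_cGrad_of_semigroup (hΛ : D.LiftedControllable) {f : ℝ → Hb → ℝ} {M : ℝ}
    (hM : ∀ t, 0 < t → ∀ x, |f t x| ≤ M)
    (hf : ContinuousOn (fun p : ℝ × Hb => f p.1 p.2) (Ioi 0 ×ˢ univ))
    (hrep : ∀ t, 0 < t → ∃ φhat, D.IsPathRep (f t) φhat)
    (hsg : ∀ r s, 0 < r → 0 < s → f (r + s) = D.R s (f r)) :
    (∀ t, 0 < t → ∀ x, CFDifferentiableAt D.C (f t) x) ∧
    ContinuousOn (fun p : ℝ × Hb => cGrad D.C (f p.1) p.2) (Ioi 0 ×ˢ univ) := by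
  have hsc := D.secondCountableTopology_Hb
  have hscH : SecondCountableTopology H := UniformSpace.secondCountable_of_separable H
  constructor
  · intro t ht x
    obtain ⟨φhat, h⟩ := hrep (t / 2) (by linarith)
    obtain ⟨L, hL, -⟩ := h.exists_hasCFDerivAt_R hΛ (half_pos ht) x
    rw [← hsg _ _ (half_pos ht) (half_pos ht), add_halves] at hL
    exact ⟨L, hL⟩
  · rintro ⟨t₀, x₀⟩ ⟨ht₀, -⟩
    have ht₀ : 0 < t₀ := ht₀
    refine ContinuousAt.continuousWithinAt ?_
    set s := t₀ / 2 with hs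
    have hs0 : 0 < s := half_pos ht₀
    have hst : s < t₀ := by linarith
    have hprob := D.isProbabilityMeasure_Q s
    have hnear : ∀ᶠ p : ℝ × Hb in 𝓝 (t₀, x₀), s < p.1 :=
      continuousAt_const.eventually_lt continuousAt_fst hst
    -- the gradient at time `t` is that of `R_s[f (t - s)]`
    have heq : ∀ t, s < t → f t = D.R s (f (t - s)) := fun t ht => by
      rw [← hsg _ _ (sub_pos.2 ht) hs0, sub_add_cancel]
    have hcz : ∀ t, 0 < t → Continuous (f t) := fun t ht =>
      hf.comp_continuous (f := fun x => (t, x)) (by fun_prop) fun x => ⟨ht, mem_univ _⟩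
    have hbound : ∀ᶠ p : ℝ × Hb in 𝓝 (t₀, x₀),
        dist (cGrad D.C (f p.1) p.2) (cGrad D.C (f t₀) x₀) ≤
        √(∫ z, (f (p.1 - s) (D.ι z + D.Sb s p.2) - f (t₀ - s) (D.ι z + D.Sb s x₀)) ^ 2
          ∂centeredGaussian (D.Q s)) * ‖D.liftedLambda hΛ s hs0‖ := by
      filter_upwards [hnear] with p hp
      obtain ⟨φhat, h⟩ := hrep (p.1 - s) (sub_pos.2 hp)
      obtain ⟨φhat', h'⟩ := hrep (t₀ - s) (sub_pos.2 hst)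
      rw [dist_eq_norm, heq p.1 hp, heq t₀ hst]
      exact D.norm_cGrad_R_sub_le hΛ h h' hs0 _ _
    have hlim : Tendsto (fun p : ℝ × Hb =>
        ∫ z, (f (p.1 - s) (D.ι z + D.Sb s p.2) - f (t₀ - s) (D.ι z + D.Sb s x₀)) ^ 2
          ∂centeredGaussian (D.Q s)) (𝓝 (t₀, x₀)) (𝓝 0) := by
      have hdom := tendsto_integral_filter_of_dominated_convergence
        (μ := centeredGaussian (D.Q s)) (l := 𝓝 (t₀, x₀))
        (F := fun (p : ℝ × Hb) z =>
          (f (p.1 - s) (D.ι z + D.Sb s p.2) - f (t₀ - s) (D.ι z + D.Sb s x₀)) ^ 2)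
        (f := fun _ => 0) (fun _ => (2 * M) ^ 2) ?_ ?_ (integrable_const _) ?_
      · simpa using hdom
      · filter_upwards [hnear] with p hp
        have h1 := hcz _ (sub_pos.2 hp)
        have h2 := hcz _ (sub_pos.2 hst)
        exact (by fun_prop : Continuous fun z => (f (p.1 - s) (D.ι z + D.Sb s p.2) -
          f (t₀ - s) (D.ι z + D.Sb s x₀)) ^ 2).aestronglyMeasurable
      · filter_upwards [hnear] with p hp
        refine ae_of_all _ fun z => ?_
        rw [Real.norm_of_nonneg (sq_nonneg _), sq_le_sq, abs_of_nonneg (a := 2 * M)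
          (by linarith [(abs_nonneg _).trans (hM _ ht₀ x₀)])]
        refine (abs_sub _ _).trans ?_
        linarith [hM _ (sub_pos.2 hp) (D.ι z + D.Sb s p.2), hM _ (sub_pos.2 hst)
          (D.ι z + D.Sb s x₀)]
      · refine ae_of_all _ fun z => ?_
        have h1 : ContinuousAt (fun p : ℝ × Hb => f p.1 p.2) (t₀ - s, D.ι z + D.Sb s x₀) :=
          hf.continuousAt (prod_mem_nhds (Ioi_mem_nhds (sub_pos.2 hst)) univ_mem)
        have h2 : ContinuousAt (fun p : ℝ × Hb => f (p.1 - s) (D.ι z + D.Sb s p.2)) (t₀, x₀) :=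
          ContinuousAt.comp (f := fun p : ℝ × Hb => (p.1 - s, D.ι z + D.Sb s p.2))
            (g := fun p : ℝ × Hb => f p.1 p.2) h1 (by fun_prop)
        have h3 : ContinuousAt (fun p : ℝ × Hb =>
            (f (p.1 - s) (D.ι z + D.Sb s p.2) - f (t₀ - s) (D.ι z + D.Sb s x₀)) ^ 2) (t₀, x₀) :=
          (h2.sub continuousAt_const).pow 2
        have h4 := h3.tendsto
        simpa using h4
    rw [ContinuousAt, tendsto_iff_dist_tendsto_zero]
    refine squeeze_zero' (Eventually.of_forall fun _ => dist_nonneg) hbound ?_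
    have := (hlim.sqrt).mul_const ‖D.liftedLambda hΛ s hs0‖
    simpa using this

end OUSetting

namespace OUSetting

variable {H K Ξ Hb : Type*}
    [NormedAddCommGroup H] [InnerProductSpace ℝ H] [CompleteSpace H]
    [TopologicalSpace.SeparableSpace H] [MeasurableSpace H] [BorelSpace H]
    [NormedAddCommGroup K] [InnerProductSpace ℝ K]
    [NormedAddCommGroup Ξ] [InnerProductSpace ℝ Ξ] [CompleteSpace Ξ]
    [TopologicalSpace.SeparableSpace Ξ]
    [NormedAddCommGroup Hb] [NormedSpace ℝ Hb]
    (D : OUSetting H K Ξ Hb)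

/-! ### Representation by paths -/

section Representation
variable [CompleteSpace Hb]

theorem secondCountableTopology_paths : SecondCountableTopology C(Ioi (0 : ℝ), H) := by
  have : SecondCountableTopology H := UniformSpace.secondCountable_of_separable H
  have : LocallyCompactSpace (Ioi (0 : ℝ)) := isOpen_Ioi.locallyCompactSpace
  infer_instance

theorem exists_isPathRep {g : Hb → ℝ} (hg : Continuous g)
    (hfib : ∀ x x', D.path x = D.path x' → g x = g x') {M : ℝ} (hM : ∀ x, |g x| ≤ M) :
    ∃ φhat, D.IsPathRep g φhat := by
  have := D.secondCountableTopology_Hb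
  have : SecondCountableTopology C(Ioi (0 : ℝ), H) := secondCountableTopology_paths
  borelize Hb
  obtain ⟨h, hm, hb, hh⟩ := exists_measurable_factor (A := Hb) (e := D.toPath) (F := g)
    (by borelize D.PathSpace; exact D.continuous_toPath.measurable)
    (by borelize ℝ; exact hg.measurable)
    (fun a a' haa => hfib a a' (D.toPath_eq_iff.1 haa)) hM
  exact ⟨h, hm, ⟨_, hb⟩, hh⟩

variable {Z : Type*} [NormedAddCommGroup Z] [NormedSpace ℝ Z] [CompleteSpace Z]
  [SecondCountableTopology Z]

theorem continuous_Ioc_restrict {T : ℝ} {f : ℝ → Hb → Z}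
    (hf : ContinuousOn (fun p : ℝ × Hb => f p.1 p.2) (Ioi 0 ×ˢ univ)) :
    Continuous fun p : Ioc 0 T × Hb => f p.1 p.2 :=
  hf.comp_continuous (f := fun p : Ioc 0 T × Hb => ((p.1 : ℝ), p.2)) (by fun_prop)
    fun p => ⟨p.1.2.1, mem_univ _⟩

theorem memS_of_continuousOn {T : ℝ} {f : ℝ → Hb → Z}
    (hf : ContinuousOn (fun p : ℝ × Hb => f p.1 p.2) (Ioi 0 ×ˢ univ))
    (hfib : ∀ t ∈ Ioc 0 T, ∀ x x', D.path x = D.path x' → f t x = f t x') {M : ℝ}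
    (hM : ∀ t ∈ Ioc 0 T, ∀ x, ‖f t x‖ ≤ M) : D.MemS T 0 f := by
  have := D.secondCountableTopology_Hb
  have : SecondCountableTopology C(Ioi (0 : ℝ), H) := secondCountableTopology_paths
  have : StandardBorelSpace (Ioc 0 T) := measurableSet_Ioc.standardBorel
  borelize Hb
  have he : Continuous fun p : Ioc 0 T × Hb => (p.1, D.toPath p.2) :=
    continuous_fst.prodMk (D.continuous_toPath.comp continuous_snd)
  obtain ⟨h, hm, hb, hh⟩ := exists_measurable_factor (A := Ioc 0 T × Hb)
    (e := fun p => (p.1, D.toPath p.2)) (F := fun p => f p.1 p.2)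
    (by borelize (Ioc 0 T × D.PathSpace); exact he.measurable)
    (by borelize Z; exact (continuous_Ioc_restrict hf).measurable)
    (fun a a' haa => by
      obtain ⟨t, x⟩ := a
      obtain ⟨t', x'⟩ := a'
      rw [Prod.mk.injEq] at haa
      obtain ⟨rfl, h2⟩ := haa
      exact hfib t t.2 x x' (D.toPath_eq_iff.1 h2)) (fun p => hM p.1 p.1.2 p.2)
  exact ⟨h, hm, ⟨max M 0, fun p => by rw [Real.rpow_zero, one_smul]; exact hb p⟩,
    fun t x => hh (t, x)⟩

/-- The representing function evaluates the path at time `t`, where stopping at `t` changes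
nothing. -/
theorem memSProg_of_continuousOn {T : ℝ} {f : ℝ → Hb → Z}
    (hf : ContinuousOn (fun p : ℝ × Hb => f p.1 p.2) (Ioi 0 ×ˢ univ))
    (hfib : ∀ t ∈ Ioc 0 T, ∀ x x', D.PS t x = D.PS t x' → f t x = f t x') {M : ℝ}
    (hM : ∀ t ∈ Ioc 0 T, ∀ x, ‖f t x‖ ≤ M) : D.MemSProg T 0 f := by
  have := D.secondCountableTopology_Hb
  have : SecondCountableTopology H := UniformSpace.secondCountable_of_separable H
  have : StandardBorelSpace (Ioc 0 T) := measurableSet_Ioc.standardBorel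
  have : LocallyCompactSpace (Ioi (0 : ℝ)) := isOpen_Ioi.locallyCompactSpace
  borelize Hb
  have he : Continuous fun p : Ioc 0 T × Hb => (p.1, D.PS p.1 p.2) :=
    continuous_fst.prodMk (continuous_Ioc_restrict (f := fun t x => D.PS t x)
      D.continuousOn_PS_uncurry)
  obtain ⟨h, hm, hb, hh⟩ := exists_measurable_factor (A := Ioc 0 T × Hb)
    (e := fun p => (p.1, D.PS p.1 p.2)) (F := fun p => f p.1 p.2)
    (by borelize (Ioc 0 T × H); exact he.measurable)
    (by borelize Z; exact (continuous_Ioc_restrict hf).measurable)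
    (fun a a' haa => by
      obtain ⟨t, x⟩ := a
      obtain ⟨t', x'⟩ := a'
      rw [Prod.mk.injEq] at haa
      obtain ⟨rfl, h2⟩ := haa
      exact hfib t t.2 x x' h2) (fun p => hM p.1 p.1.2 p.2)
  have hev : Continuous fun p : Ioc 0 T × C(Ioi (0 : ℝ), H) =>
      (p.1, p.2 (⟨p.1, p.1.2.1⟩ : Ioi (0 : ℝ))) := by
    refine continuous_fst.prodMk ?_
    have h1 : Continuous fun p : Ioc 0 T × C(Ioi (0 : ℝ), H) =>
        (⟨p.1, p.1.2.1⟩ : Ioi (0 : ℝ)) := by fun_prop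
    exact continuous_eval.comp (continuous_snd.prodMk h1)
  refine ⟨fun p => h (p.1, p.2 (⟨p.1, p.1.2.1⟩ : Ioi (0 : ℝ))), ?_,
    ⟨max M 0, fun p => by rw [Real.rpow_zero, one_smul]; exact hb _⟩, fun t x => ⟨hh (t, x), ?_⟩⟩
  · borelize (Ioc 0 T × C(Ioi (0 : ℝ), H))
    borelize (Ioc 0 T × H)
    exact hm.comp hev.measurable
  · refine (hh (t, x)).trans ?_
    simp [stopPath, path]
    rfl

end Representation

/-! ### Continuity and the semigroup property -/

/-- Averages against `𝒩(0, Q_{r+s})`, computed in two steps. -/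
theorem integral_Q_add {r s : ℝ} (hr : 0 ≤ r) (hs : 0 ≤ s) {Φ : H → ℝ} (hΦ : Continuous Φ) {M : ℝ}
    (hM : ∀ z, |Φ z| ≤ M) : ∫ z, Φ z ∂centeredGaussian (D.Q (r + s)) =
      ∫ z, ∫ w, Φ (w + D.S r z) ∂centeredGaussian (D.Q r) ∂centeredGaussian (D.Q s) := by
  have hsc : SecondCountableTopology H := UniformSpace.secondCountable_of_separable H
  have h1 : IsProbabilityMeasure (centeredGaussian (gramian D.S D.G r)) :=
    D.isProbabilityMeasure_Q r
  have h2 : IsProbabilityMeasure (centeredGaussian (gramian D.S D.G s)) :=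
    D.isProbabilityMeasure_Q s
  unfold Q
  have h3 : IsProbabilityMeasure ((centeredGaussian (gramian D.S D.G s)).map (D.S r)) :=
    Measure.isProbabilityMeasure_map (by fun_prop)
  have hadd : centeredGaussian (gramian D.S D.G (r + s)) =
      ((centeredGaussian (gramian D.S D.G s)).map (D.S r)).conv
        (centeredGaussian (gramian D.S D.G r)) :=
    (centeredGaussian_gramian_add D.S D.G D.traceClass hr hs).trans (Measure.conv_comm _ _)
  rw [hadd, integral_conv (Integrable.of_bound hΦ.aestronglyMeasurable M (ae_of_all _ hM))]
  have hm : StronglyMeasurable fun x => ∫ w, Φ (x + w) ∂centeredGaussian (gramian D.S D.G r) := by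
    have : Continuous fun p : H × H => Φ (p.1 + p.2) := by fun_prop
    exact this.stronglyMeasurable.integral_prod_right'
  rw [integral_map (by fun_prop) hm.aestronglyMeasurable]
  simp_rw [add_comm]

section Continuity
variable [CompleteSpace K] [CompleteSpace Hb]

theorem continuousOn_R {φ : Hb → ℝ} (hφ : Continuous φ) {M : ℝ} (hM : ∀ x, |φ x| ≤ M) :
    ContinuousOn (fun p : ℝ × Hb => D.R p.1 φ p.2) (Ici 0 ×ˢ univ) :=
  (continuous_integral_gramian D.S D.G D.traceClass D.ι hφ hM).comp_continuousOn
    (f := fun p : ℝ × Hb => (p.1, D.Sb p.1 p.2))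
    (continuousOn_fst.prodMk D.Sb.continuousOn_uncurry)

theorem abs_R_le {φ : Hb → ℝ} {M : ℝ} (hM : ∀ x, |φ x| ≤ M) (t : ℝ) (x : Hb) :
    |D.R t φ x| ≤ M :=
  have := D.isProbabilityMeasure_Q t
  abs_integral_le_of_abs_le_const fun _ => hM _

/-- The semigroup property of `R_t`. -/
theorem R_add {φ : Hb → ℝ} (hφ : Continuous φ) {M : ℝ} (hM : ∀ x, |φ x| ≤ M) {r s : ℝ}
    (hr : 0 ≤ r) (hs : 0 ≤ s) : D.R (r + s) φ = D.R s (D.R r φ) := by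
  funext x
  rw [R, D.integral_Q_add hr hs (Φ := fun z => φ (D.ι z + D.Sb (r + s) x)) (by fun_prop)
    fun z => hM _]
  simp only [R, map_add, D.Sb_ι r hr, D.Sb.map_add r s hr hs, ContinuousLinearMap.comp_apply,
    add_assoc]

theorem R_congr {φ : Hb → ℝ} (hφ : ∀ x x', D.path x = D.path x' → φ x = φ x') {t : ℝ}
    (ht : 0 ≤ t) {x x' : Hb} (h : D.path x = D.path x') : D.R t φ x = D.R t φ x' :=
  integral_congr_ae (ae_of_all _ fun z => hφ _ _ (D.path_add_Sb h ht (D.ι z)))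

theorem rpow_mul_max_le {t T γ : ℝ} (ht : 0 < t) (htT : t ≤ T) (hγ : 0 < γ) :
    t ^ γ * max (t ^ (-γ)) 1 ≤ 1 + T ^ γ := by
  have h1 : t ^ γ * t ^ (-γ) = 1 := by
    rw [← Real.rpow_add ht, add_neg_cancel, Real.rpow_zero]
  have h2 : t ^ γ ≤ T ^ γ := Real.rpow_le_rpow ht.le htT hγ.le
  have h3 : 0 ≤ t ^ γ := Real.rpow_nonneg ht.le _
  rw [mul_max_of_nonneg _ _ h3, h1, mul_one]
  exact max_le (by linarith) (by linarith)

theorem continuousOn_rpow_smul_cGrad {f : ℝ → Hb → ℝ} (γ : ℝ)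
    (h : ContinuousOn (fun p : ℝ × Hb => cGrad D.C (f p.1) p.2) (Ioi 0 ×ˢ univ)) :
    ContinuousOn (fun p : ℝ × Hb => p.1 ^ γ • cGrad D.C (f p.1) p.2) (Ioi 0 ×ˢ univ) :=
  (continuousOn_fst.rpow_const fun _ hp => Or.inl (ne_of_gt hp.1)).smul h

theorem norm_rpow_smul_cGrad_le {f : ℝ → Hb → ℝ} {T γ B : ℝ} (hγ : 0 < γ) (hB0 : 0 ≤ B)
    (hB : ∀ t ∈ Ioc 0 T, ∀ x, ‖cGrad D.C (f t) x‖ ≤ B * max (t ^ (-γ)) 1) {t : ℝ}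
    (ht : t ∈ Ioc 0 T) (x : Hb) : ‖t ^ γ • cGrad D.C (f t) x‖ ≤ B * (1 + T ^ γ) := by
  have h0 : 0 ≤ t ^ γ := Real.rpow_nonneg ht.1.le _
  rw [norm_smul, Real.norm_of_nonneg h0]
  calc t ^ γ * ‖cGrad D.C (f t) x‖ ≤ t ^ γ * (B * max (t ^ (-γ)) 1) :=
        mul_le_mul_of_nonneg_left (hB t ht x) h0
    _ = B * (t ^ γ * max (t ^ (-γ)) 1) := by ring
    _ ≤ _ := mul_le_mul_of_nonneg_left (rpow_mul_max_le ht.1 ht.2 hγ) hB0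

theorem memC01C_of_continuousOn {f : ℝ → Hb → ℝ} {T γ B M : ℝ} (hγ : 0 < γ) (hB0 : 0 ≤ B)
    (hH : ContinuousOn (fun p : ℝ × H => f p.1 (D.ι p.2)) (Ici 0 ×ˢ univ))
    (hMH : ∀ t, 0 ≤ t → ∀ x, |f t (D.ι x)| ≤ M) (hM : ∀ t, 0 < t → ∀ x, |f t x| ≤ M)
    (hf : ContinuousOn (fun p : ℝ × Hb => f p.1 p.2) (Ioi 0 ×ˢ univ))
    (hd : ∀ t, 0 < t → ∀ x, CFDifferentiableAt D.C (f t) x)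
    (hg : ContinuousOn (fun p : ℝ × Hb => cGrad D.C (f p.1) p.2) (Ioi 0 ×ˢ univ))
    (hB : ∀ t ∈ Ioc 0 T, ∀ x, ‖cGrad D.C (f t) x‖ ≤ B * max (t ^ (-γ)) 1) : D.MemC01C T γ f where
  continuousOn_H := hH.mono (prod_mono Icc_subset_Ici_self Subset.rfl)
  bounded_H := ⟨M, fun t ht => hMH t ht.1⟩
  continuousOn := hf.mono (prod_mono Ioc_subset_Ioi_self Subset.rfl)
  bounded := ⟨M, fun t ht => hM t ht.1⟩
  differentiable := fun t ht => hd t ht.1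
  continuousOn_cGrad := (D.continuousOn_rpow_smul_cGrad γ hg).mono
    (prod_mono Ioc_subset_Ioi_self Subset.rfl)
  bounded_cGrad := ⟨_, fun _ ht x => D.norm_rpow_smul_cGrad_le hγ hB0 hB ht x⟩

end Continuity

/-! ### Bounded continuous functions of the path -/

section PathFunctions
variable [CompleteSpace K] [CompleteSpace Hb] {D}
  {φ : Hb → ℝ} {φhat : D.PathSpace → ℝ}

theorem IsPathRep.continuous (h : D.IsPathRep φ φhat) (hc : Continuous φhat) : Continuous φ :=
  (hc.comp D.continuous_toPath).congr fun x => (h.2.2 x).symm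

theorem IsPathRep.congr (h : D.IsPathRep φ φhat) {x x' : Hb} (hx : D.path x = D.path x') :
    φ x = φ x' := by
  rw [h.2.2, h.2.2, D.toPath_eq_iff.2 hx]

theorem IsPathRep.abs_le (h : D.IsPathRep φ φhat) (x : Hb) : |φ x| ≤ ⨆ y, |φ y| := by
  have := h.abs_extendL2_le (D.upsilon x)
  rwa [D.extendL2_upsilon, ← h.2.2] at this

theorem IsPathRep.abs_inner_cGrad_R_le (h : D.IsPathRep φ φhat) (hΛ : D.LiftedControllable) {t : ℝ}
    (ht : 0 < t) (x : Hb) (k : K) : |⟪cGrad D.C (D.R t φ) x, k⟫| ≤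
      ‖D.liftedLambda hΛ t ht‖ * (⨆ y, |φ y|) * ‖k‖ := by
  obtain ⟨L, hL, hb, -⟩ := h.exists_hasCFDerivAt_R hΛ ht x
  rw [hL.inner_cGrad]
  refine (hb k).trans ?_
  rw [mul_comm ‖_‖ (⨆ y, |φ y|), mul_assoc]
  exact mul_le_mul_of_nonneg_left ((D.liftedLambda hΛ t ht).le_opNorm k)
    (Real.iSup_nonneg fun _ => abs_nonneg _)

/-- The derivative, as an average over the noise: `W_A(t)` has law `𝒩(0, Q_t)`. -/
theorem IsPathRep.integral_liftedCov_eq_integral_stochasticConvolution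
    {Ω : Type*} [MeasurableSpace Ω] {ℙ : Measure Ω} [IsProbabilityMeasure ℙ]
    {W : ℝ≥0 → Ξ → Ω → ℝ} (hW : IsCylindricalWiener W ℙ) (h : D.IsPathRep φ φhat)
    {t : ℝ} (ht : 0 ≤ t) {Y : Ω → H} (hY : IsStochasticConvolution D.S D.G W ℙ t Y) (x : Hb)
    {ξ : L2w H D.ρ → ℝ} (hξ : AEStronglyMeasurable ξ (centeredGaussian (D.liftedCov t))) :
    ∫ z, D.extendL2 φhat (z + D.upsilon (D.Sb t x)) * ξ z ∂centeredGaussian (D.liftedCov t) =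
      ∫ ω, φhat (D.toPath (D.Sb t x + D.ι (Y ω))) * ξ (D.upsilon (D.ι (Y ω))) ∂ℙ := by
  have hm : AEStronglyMeasurable
      (fun z => D.extendL2 φhat (z + D.upsilon (D.Sb t x)) * ξ z)
      (centeredGaussian (D.liftedCov t)) := (h.memLp_extendL2_add t _).1.mul hξ
  have hmH : AEStronglyMeasurable (fun z : H => D.extendL2 φhat (D.upsilon (D.ι z) +
      D.upsilon (D.Sb t x)) * ξ (D.upsilon (D.ι z))) (centeredGaussian (D.Q t)) := by
    rw [D.centeredGaussian_liftedCov] at hm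
    exact hm.comp_measurable (by fun_prop)
  have hlaw : ℙ.map Y = centeredGaussian (D.Q t) := hY.map_eq hW ht
  rw [D.integral_liftedCov t hm]
  rw [← hlaw] at hmH ⊢
  rw [integral_map hY.1 hmH]
  refine integral_congr_ae (ae_of_all _ fun ω => ?_)
  simp only
  rw [h.extendL2_add, h.2.2, add_comm]

theorem IsPathRep.continuousOn_cGrad_R (h : D.IsPathRep φ φhat) (hΛ : D.LiftedControllable)
    (hc : Continuous φhat) : (∀ t, 0 < t → ∀ x, CFDifferentiableAt D.C (D.R t φ) x) ∧
    ContinuousOn (fun p : ℝ × Hb => cGrad D.C (D.R p.1 φ) p.2) (Ioi 0 ×ˢ univ) := by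
  have hφ := h.continuous hc
  have hR := D.continuousOn_R hφ h.abs_le
  refine D.continuousOn_cGrad_of_semigroup hΛ (f := fun t => D.R t φ)
    (fun t _ => D.abs_R_le h.abs_le t)
    (hR.mono (prod_mono Ioi_subset_Ici_self Subset.rfl)) (fun t ht => ?_)
    fun r s hr hs => D.R_add hφ h.abs_le hr.le hs.le
  exact D.exists_isPathRep
    (hR.comp_continuous (f := fun x => (t, x)) (by fun_prop) fun x => ⟨ht.le, mem_univ _⟩)
    (fun x x' hx => D.R_congr (fun _ _ => h.congr) ht.le hx) (D.abs_R_le h.abs_le t)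

theorem IsPathRep.memS1_R [TopologicalSpace.SeparableSpace K] (h : D.IsPathRep φ φhat)
    (hΛ : D.LiftedControllable) (hc : Continuous φhat) {γ κ T : ℝ} (hγ : 0 < γ) (hκ : 0 ≤ κ)
    (hbd : ∀ t (ht : 0 < t), ‖D.liftedLambda hΛ t ht‖ ≤ κ * max (t ^ (-γ)) 1) :
    D.MemS1 T γ fun t => D.R t φ := by
  have hsc : SecondCountableTopology K := UniformSpace.secondCountable_of_separable K
  have hφ := h.continuous hc
  have hR := D.continuousOn_R hφ h.abs_le
  have hR' := hR.mono (prod_mono Ioi_subset_Ici_self (Subset.refl univ))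
  obtain ⟨hd, hg⟩ := h.continuousOn_cGrad_R hΛ hc
  have hM0 : 0 ≤ ⨆ y, |φ y| := Real.iSup_nonneg fun _ => abs_nonneg _
  have hB0 : 0 ≤ κ * ⨆ y, |φ y| := mul_nonneg hκ hM0
  have hB : ∀ t ∈ Ioc 0 T, ∀ x, ‖cGrad D.C (D.R t φ) x‖ ≤
      κ * (⨆ y, |φ y|) * max (t ^ (-γ)) 1 := fun t ht x => by
    have h1 := norm_le_of_forall_abs_inner_le (by positivity)
      (h.abs_inner_cGrad_R_le hΛ ht.1 x)
    refine h1.trans ((mul_le_mul_of_nonneg_right (hbd t ht.1) hM0).trans (le_of_eq (by ring)))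
  have hcg : ∀ t ∈ Ioc 0 T, ∀ x x', D.path x = D.path x' →
      cGrad D.C (D.R t φ) x = cGrad D.C (D.R t φ) x' := fun t ht x x' hx =>
    cGrad_congr fun v => D.R_congr (fun _ _ => h.congr) ht.1.le (by rw [path_add, path_add, hx])
  have hRH : ContinuousOn (fun p : ℝ × H => D.R p.1 φ (D.ι p.2)) (Ici 0 ×ˢ univ) :=
    hR.comp (f := fun p : ℝ × H => (p.1, D.ι p.2)) (by fun_prop) fun p hp => ⟨hp.1, mem_univ _⟩
  refine ⟨D.memC01C_of_continuousOn (f := fun t => D.R t φ) hγ hB0 hRH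
      (fun t _ x => D.abs_R_le h.abs_le t _) (fun t _ => D.abs_R_le h.abs_le t) hR' hd hg hB,
    D.memS_of_continuousOn (f := fun t => D.R t φ) hR'
      (fun t ht x x' hx => D.R_congr (fun _ _ => h.congr) ht.1.le hx)
      (fun t _ => D.abs_R_le h.abs_le t),
    D.memS_of_continuousOn (f := fun t x => t ^ γ • cGrad D.C (D.R t φ) x)
      (D.continuousOn_rpow_smul_cGrad (f := fun t => D.R t φ) γ hg)
      (fun t ht x x' hx => congrArg (t ^ γ • ·) (hcg t ht x x' hx))
      fun t ht x => D.norm_rpow_smul_cGrad_le (f := fun t => D.R t φ) hγ hB0 hB ht x⟩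

end PathFunctions

end OUSetting

namespace OUSetting

variable {H K Ξ Hb : Type*}
    [NormedAddCommGroup H] [InnerProductSpace ℝ H] [CompleteSpace H]
    [TopologicalSpace.SeparableSpace H] [MeasurableSpace H] [BorelSpace H]
    [NormedAddCommGroup K] [InnerProductSpace ℝ K] [CompleteSpace K]
    [NormedAddCommGroup Ξ] [InnerProductSpace ℝ Ξ] [CompleteSpace Ξ]
    [TopologicalSpace.SeparableSpace Ξ]
    [NormedAddCommGroup Hb] [NormedSpace ℝ Hb] [CompleteSpace Hb]
    (D : OUSetting H K Ξ Hb)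

/-! ### Bounded continuous functions of `P x` -/

theorem RP_of_pos (φbar : H → ℝ) {t : ℝ} (ht : 0 < t) (x : Hb) :
    D.RP φbar t x = ∫ z, φbar (D.P z + D.PS t x) ∂centeredGaussian (D.Q t) := by
  rw [RP, if_neg ht.ne']

/-- On `H`, `R_t[φ](x) = ∫ φbar(P z + P e^{tA} x) 𝒩(0, Q_t)(dz)` also for `t = 0`, where `𝒩(0, Q_t)`
is the Dirac mass at `0`. -/
theorem RP_ι (φbar : H → ℝ) {t : ℝ} (ht : 0 ≤ t) (x : H) :
    D.RP φbar t (D.ι x) = ∫ z, φbar (D.P z + D.P (D.S t x)) ∂centeredGaussian (D.Q t) := by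
  rcases ht.eq_or_lt with rfl | h
  · have h0 : centeredGaussian (D.Q 0) = Measure.dirac 0 :=
      centeredGaussian_gramian_of_nonpos D.S D.G le_rfl
    have : SecondCountableTopology H := UniformSpace.secondCountable_of_separable H
    rw [RP, if_pos rfl, D.ι_injective.extend_apply, h0, integral_dirac, map_zero, zero_add,
      D.S.map_zero, ContinuousLinearMap.id_apply]
  · rw [D.RP_of_pos φbar h, D.PS_ι t h]

variable {φbar : H → ℝ}

theorem RP_congr {t : ℝ} (ht : 0 < t) {x x' : Hb} (h : D.PS t x = D.PS t x') :
    D.RP φbar t x = D.RP φbar t x' := by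
  rw [D.RP_of_pos φbar ht, D.RP_of_pos φbar ht, h]

variable (hP : ∀ t, 0 < t → range (D.PS t) ⊆ range D.P) (hφ : ContinuousOn φbar (range D.P))
  {M : ℝ} (hM : ∀ z ∈ range D.P, |φbar z| ≤ M)

include hP in
theorem add_PS_mem_range {t : ℝ} (ht : 0 < t) (z : H) (x : Hb) :
    D.P z + D.PS t x ∈ range D.P := by
  obtain ⟨u, hu⟩ := hP t ht ⟨x, rfl⟩
  exact ⟨z + u, by rw [map_add, hu]⟩

include hP hM in
theorem abs_RP_le {t : ℝ} (ht : 0 < t) (x : Hb) : |D.RP φbar t x| ≤ M := by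
  have := D.isProbabilityMeasure_Q t
  rw [D.RP_of_pos φbar ht]
  exact abs_integral_le_of_abs_le_const fun z => hM _ (D.add_PS_mem_range hP ht z x)

include hM in
theorem abs_RP_ι_le {t : ℝ} (ht : 0 ≤ t) (x : H) : |D.RP φbar t (D.ι x)| ≤ M := by
  have := D.isProbabilityMeasure_Q t
  rw [D.RP_ι φbar ht]
  exact abs_integral_le_of_abs_le_const fun z => hM _ ⟨z + D.S t x, map_add _ _ _⟩

include hφ hM in
/-- Averages of `φbar` against `𝒩(0, Q_t)`, as a function of `t` and of a shift in `Im P`, are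
jointly continuous. -/
theorem continuous_integral_range : Continuous fun p : ℝ × D.P.range =>
    ∫ z, φbar (D.P z + p.2) ∂centeredGaussian (D.Q p.1) := by
  have hc : Continuous fun y : D.P.range => φbar y :=
    hφ.comp_continuous continuous_subtype_val fun y => y.2
  exact continuous_integral_gramian D.S D.G D.traceClass
    (D.P.codRestrict D.P.range fun z => ⟨z, rfl⟩) hc fun y => hM _ y.2

include hP hφ hM in
theorem continuousOn_RP :
    ContinuousOn (fun p : ℝ × Hb => D.RP φbar p.1 p.2) (Ioi 0 ×ˢ univ) := by
  rw [continuousOn_iff_continuous_domRestrict]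
  have h1 : Continuous fun p : (Ioi (0 : ℝ) ×ˢ (univ : Set Hb) : Set (ℝ × Hb)) =>
      (p.1.1, (⟨D.PS p.1.1 p.1.2, hP _ p.2.1 ⟨_, rfl⟩⟩ : D.P.range)) :=
    (continuous_fst.comp continuous_subtype_val).prodMk (Continuous.subtype_mk
      (continuousOn_iff_continuous_domRestrict.1 D.continuousOn_PS_uncurry) _)
  refine ((D.continuous_integral_range hφ hM).comp h1).congr fun p => ?_
  exact (D.RP_of_pos φbar p.2.1 _).symm

include hφ hM in
theorem continuousOn_RP_ι :
    ContinuousOn (fun p : ℝ × H => D.RP φbar p.1 (D.ι p.2)) (Ici 0 ×ˢ univ) := by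
  have h1 : Continuous fun x : H => (⟨D.P x, x, rfl⟩ : D.P.range) := by fun_prop
  refine ((D.continuous_integral_range hφ hM).comp_continuousOn
    (f := fun p : ℝ × H => (p.1, (⟨D.P (D.S p.1 p.2), _, rfl⟩ : D.P.range)))
    (continuousOn_fst.prodMk (h1.comp_continuousOn D.S.continuousOn_uncurry))).congr
    fun p hp => ?_
  exact D.RP_ι φbar hp.1 _

include hP hφ hM in
theorem RP_add {r s : ℝ} (hr : 0 < r) (hs : 0 < s) :
    D.RP φbar (r + s) = D.R s (D.RP φbar r) := by
  funext x
  have hrs : 0 < r + s := add_pos hr hs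
  have hc : Continuous fun z => φbar (D.P z + D.PS (r + s) x) :=
    hφ.comp_continuous (by fun_prop) fun z => D.add_PS_mem_range hP hrs z x
  rw [D.RP_of_pos φbar hrs, D.integral_Q_add hr.le hs.le hc
    fun z => hM _ (D.add_PS_mem_range hP hrs z x)]
  simp only [R, D.RP_of_pos φbar hr, map_add, D.PS_ι r hr, D.PS_Sb hr hs.le, add_assoc]

include hP hφ hM in
/-- The `C`-gradient of `R_t[φ]` is bounded through the smoothing of the projected process: `R_t[φ]`
is an average against `𝒩(0, P Q_t P*)` of a Borel function on `H`. -/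
theorem norm_cGrad_RP_le (hC : D.Controllable) (hM0 : 0 ≤ M) {t : ℝ} (ht : 0 < t) (x : Hb) :
    ‖cGrad D.C (D.RP φbar t) x‖ ≤ M * ‖D.lambda hC t ht‖ := by
  have hsc : SecondCountableTopology H := UniformSpace.secondCountable_of_separable H
  -- a Borel function agreeing with `φbar` on the range of `P`
  obtain ⟨ψ, hψ, hψM, hψP⟩ := exists_measurable_factor (A := H) (e := D.P)
    (F := fun z => φbar (D.P z)) (M := M)
    (by rw [← BorelSpace.measurable_eq (α := H)]; exact D.P.continuous.measurable)
    (by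
      borelize ℝ
      exact (hφ.comp_continuous D.P.continuous fun z => ⟨z, rfl⟩).measurable)
    (fun a a' h => congrArg φbar h) fun a => hM _ ⟨a, rfl⟩
  have hψ' : Measurable ψ := by
    rwa [← BorelSpace.measurable_eq (α := H), ← BorelSpace.measurable_eq (α := ℝ)] at hψ
  rw [max_eq_left hM0] at hψM
  have hψr : ∀ z ∈ range D.P, φbar z = ψ z := by
    rintro _ ⟨z, rfl⟩
    exact hψP z
  obtain ⟨L, hL, hLb, -⟩ := exists_hasCFDerivAt (C := D.C) (D.projCov_isPositive t)
    (D.isCenteredGaussian_projCov t) (Λ := D.lambda hC t ht) (fun k => pinv_mem _ (hC t ht k))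
    hψ' hψM (f := D.RP φbar t) (x := x) (e := D.PS t x) fun s k => by
      have hs : opSqrt (D.projCov t) (D.lambda hC t ht k) = D.PS t (D.C k) :=
        apply_pinv _ (hC t ht k)
      rw [hs, D.centeredGaussian_projCov, integral_map (by fun_prop) (by
        exact (hψ'.comp (by fun_prop)).aestronglyMeasurable), D.RP_of_pos φbar ht]
      refine integral_congr_ae (ae_of_all _ fun z => ?_)
      simp only
      rw [hψr _ (D.add_PS_mem_range hP ht z _), map_add, map_smul, add_assoc]
  refine norm_le_of_forall_abs_inner_le (by positivity) fun k => ?_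
  rw [hL.inner_cGrad, mul_assoc]
  exact (hLb k).trans (mul_le_mul_of_nonneg_left ((D.lambda hC t ht).le_opNorm k) hM0)

include hP hφ hM in
theorem memS1Prog_RP [TopologicalSpace.SeparableSpace K] (hΛ : D.LiftedControllable)
    (hC : D.Controllable) {γ κ T : ℝ} (hγ : 0 < γ) (hκ : 0 ≤ κ)
    (hbd : ∀ t (ht : t ∈ Ioc 0 T), ‖D.lambda hC t ht.1‖ ≤ κ * max (t ^ (-γ)) 1) :
    D.MemS1Prog T γ (D.RP φbar) := by
  have hsc : SecondCountableTopology K := UniformSpace.secondCountable_of_separable K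
  have hM0 : 0 ≤ M := (abs_nonneg _).trans (hM (D.P 0) ⟨0, rfl⟩)
  have hR := D.continuousOn_RP hP hφ hM
  obtain ⟨hd, hg⟩ := D.continuousOn_cGrad_of_semigroup hΛ (f := D.RP φbar)
    (fun t ht => D.abs_RP_le hP hM ht) hR (fun t ht => D.exists_isPathRep
      (hR.comp_continuous (f := fun x => (t, x)) (by fun_prop) fun x => ⟨ht, mem_univ _⟩)
      (fun x x' hx => D.RP_congr ht (D.path_eq_iff.1 hx t ht)) (D.abs_RP_le hP hM ht))
    fun r s hr hs => D.RP_add hP hφ hM hr hs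
  have hB0 : 0 ≤ M * κ := mul_nonneg hM0 hκ
  have hB : ∀ t ∈ Ioc 0 T, ∀ x, ‖cGrad D.C (D.RP φbar t) x‖ ≤ M * κ * max (t ^ (-γ)) 1 :=
    fun t ht x => by
      refine (D.norm_cGrad_RP_le hP hφ hM hC hM0 ht.1 x).trans ?_
      rw [mul_assoc]
      exact mul_le_mul_of_nonneg_left (hbd t ht) hM0
  have hcg : ∀ t ∈ Ioc 0 T, ∀ x x', D.PS t x = D.PS t x' →
      cGrad D.C (D.RP φbar t) x = cGrad D.C (D.RP φbar t) x' := fun t ht x x' hx =>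
    cGrad_congr fun v => D.RP_congr ht.1 (by rw [map_add, map_add, hx])
  exact ⟨D.memC01C_of_continuousOn hγ hB0 (D.continuousOn_RP_ι hφ hM)
      (fun t ht x => D.abs_RP_ι_le hM ht x) (fun t ht => D.abs_RP_le hP hM ht) hR hd hg hB,
    D.memSProg_of_continuousOn hR (fun t ht x x' hx => D.RP_congr ht.1 hx)
      (fun t ht => D.abs_RP_le hP hM ht.1),
    D.memSProg_of_continuousOn (f := fun t x => t ^ γ • cGrad D.C (D.RP φbar t) x)
      (D.continuousOn_rpow_smul_cGrad γ hg)
      (fun t ht x x' hx => congrArg (t ^ γ • ·) (hcg t ht x x' hx))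
      fun t ht x => D.norm_rpow_smul_cGrad_le hγ hB0 hB ht x⟩

end OUSetting

end

theorem proposition2p12
    {H K Ξ Hb Ω : Type*}
    [NormedAddCommGroup H] [InnerProductSpace ℝ H] [CompleteSpace H]
    [TopologicalSpace.SeparableSpace H] [MeasurableSpace H] [BorelSpace H]
    [NormedAddCommGroup K] [InnerProductSpace ℝ K] [CompleteSpace K]
    [TopologicalSpace.SeparableSpace K]
    [NormedAddCommGroup Ξ] [InnerProductSpace ℝ Ξ] [CompleteSpace Ξ]
    [TopologicalSpace.SeparableSpace Ξ]
    [NormedAddCommGroup Hb] [NormedSpace ℝ Hb] [CompleteSpace Hb]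
    (D : OUSetting H K Ξ Hb)
    [MeasurableSpace Ω] (ℙ : Measure Ω) [IsProbabilityMeasure ℙ]
    (W : ℝ≥0 → Ξ → Ω → ℝ) (hW : IsCylindricalWiener W ℙ)
    (hΛ : D.LiftedControllable) :
    -- bounded Borel functions of the path
    (∀ (φ : Hb → ℝ) (φhat : D.PathSpace → ℝ), D.IsPathRep φ φhat →
      -- differentiability
      (∀ t, 0 < t → ∀ x, CFDifferentiableAt D.C (D.R t φ) x) ∧
      -- the two formulas for the derivative
      (∀ t (ht : 0 < t) (k : K),
        (∃ ξ, IsGaussianFunctional (D.liftedCov t) (D.liftedLambda hΛ t ht k) ξ) ∧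
        ∀ ξ, IsGaussianFunctional (D.liftedCov t) (D.liftedLambda hΛ t ht k) ξ → ∀ x : Hb,
          ⟪cGrad D.C (D.R t φ) x, k⟫ =
            ∫ z, D.extendL2 φhat (z + D.upsilon (D.Sb t x)) * ξ z
              ∂centeredGaussian (D.liftedCov t) ∧
          ∀ Y : Ω → H, IsStochasticConvolution D.S D.G W ℙ t Y →
            ⟪cGrad D.C (D.R t φ) x, k⟫ =
              ∫ ω, φhat (D.toPath (D.Sb t x + D.ι (Y ω))) * ξ (D.upsilon (D.ι (Y ω))) ∂ℙ) ∧
      -- the bound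
      (∀ t (ht : 0 < t) (x : Hb) (k : K),
        |⟪cGrad D.C (D.R t φ) x, k⟫| ≤ ‖D.liftedLambda hΛ t ht‖ * (⨆ y, |φ y|) * ‖k‖) ∧
      -- continuity of the derivative
      (Continuous φhat → ∀ T, 0 < T →
        ContinuousOn (fun p : ℝ × Hb => cGrad D.C (D.R p.1 φ) p.2) (Ioc 0 T ×ˢ univ)) ∧
      -- membership under the growth bound
      (Continuous φhat → ∀ γ ∈ Ioo (0 : ℝ) 1,
        (∃ κ > 0, ∀ t (ht : 0 < t), ‖D.liftedLambda hΛ t ht‖ ≤ κ * max (t ^ (-γ)) 1) →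
        ∀ T, 0 < T → D.MemS1 T γ fun t => D.R t φ)) ∧
    -- continuous functions of `P x`
    (∀ (T : ℝ) (hT : 0 < T) (γ : ℝ) (hγ : γ ∈ Ioo (0 : ℝ) 1) (hC : D.Controllable),
      (∃ κ > 0, ∀ t (ht : t ∈ Ioc 0 T), ‖D.lambda hC t ht.1‖ ≤ κ * max (t ^ (-γ)) 1) →
      (∀ t, 0 < t → range (D.PS t) ⊆ range D.P) →
      ∀ φbar : H → ℝ, ContinuousOn φbar (range D.P) → (∃ M, ∀ z ∈ range D.P, |φbar z| ≤ M) →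
        D.MemS1Prog T γ (D.RP φbar)) := by
  refine ⟨fun φ φhat h => ⟨fun t ht x => ?_, fun t ht k =>
    ⟨D.exists_isGaussianFunctional_liftedLambda hΛ ht k, fun ξ hξ x => ?_⟩,
    fun t ht x k => h.abs_inner_cGrad_R_le hΛ ht x k, fun hc T _ => ?_, ?_⟩, ?_⟩
  · obtain ⟨L, hL, -⟩ := h.exists_hasCFDerivAt_R hΛ ht x
    exact ⟨L, hL⟩
  · obtain ⟨L, hL, -, hL'⟩ := h.exists_hasCFDerivAt_R hΛ ht x
    have h1 := (hL.inner_cGrad k).trans (hL' k ξ hξ)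
    exact ⟨h1, fun Y hY => h1.trans
      (h.integral_liftedCov_eq_integral_stochasticConvolution hW ht.le hY x hξ.1.1)⟩
  · exact (h.continuousOn_cGrad_R hΛ hc).2.mono (prod_mono Ioc_subset_Ioi_self Subset.rfl)
  · rintro hc γ hγ ⟨κ, hκ, hbd⟩ T -
    exact h.memS1_R hΛ hc hγ.1 hκ.le hbd
  · rintro T - γ hγ hC ⟨κ, hκ, hbd⟩ hP φbar hφ ⟨M, hM⟩
    exact D.memS1Prog_RP hP hφ hM hΛ hC hγ.1 hκ.le hbd
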